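/- Let $J_A,G_A$ be Hermitian operators on a finite-dimensional space $\mathcal H_A$ and $J_B,G_B$ Hermitian operators on a finite-dimensional space $\mathcal H_B$, and let $$H=J_A\otimes J_B+G_A\otimes G_B .$$ For a Hermitian operator $M$ let $\Delta(M)$ be the difference of its largest and smallest eigenvalues, let its *extremal subspace* be the sum of the eigenspaces of these two eigenvalues, and let $M^{\rm e}$ be the restriction of $M$ to its extremal subspace, made traceless by subtracting a multiple of the identity of that subspace. Let the factors be normalised so that $\Delta(J_A)=\Delta(J_B)=:\Delta_J$ and $\Delta(G_A)=\Delta(G_B)=:\Delta_G$, and assume: (i) $J_A$ and $G_A$ have the same extremal subspace and it is $2$-dimensional; likewise for $J_B$ and $G_B$; (ii) $\operatorname{tr}J_A^{\rm e}G_A^{\rm e}=\operatorname{tr}J_B^{\rm e}G_B^{\rm e}$. Then, given catalytic entanglement, $H$ is locally equivalent to $\frac{\Delta_J^2+\Delta_G^2}{4}H_{\rm Ising}$, where $H_{\rm Ising}=\sigma_z\otimes\sigma_z$. Consequently $$E_H=\frac{\alpha}{4}\,(\Delta_J^2+\Delta_G^2),\qquad \alpha=2\max_{x\in[0,1]}\sqrt{x(1-x)}\,\log_2\frac{x}{1-x}$$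 (the function being maximised is extended by $0$ to $x=0,1$). The notions are as follows. A *protocol of duration $T$* for a bipartite Hamiltonian $H$ is a finite alternation of evolutions under $H\otimes I$, of total time $T$, with instantaneous local unitaries of Alice and of Bob, each acting on that party's half of the system of $H$ and on finite-dimensional local ancillas. With catalytic entanglement, $H$ *simulates $K$ at rate $\gamma$* if there are finite-dimensional ancillas and a, possibly entangled, pure state $\eta$ of the system of $H$ and these ancillas such that for all $t\ge0$ and $\varepsilon>0$ some protocol of duration $T$ with $\gamma T\le t$ maps $\psi\otimes\eta$ to within $\varepsilon$ of $(e^{-iKt}\psi)\otimes\eta$ for every pure state $\psi$ of registers held by Alice and Bob on which $K$ acts. The optimal rate $\gamma_{K|H}$ is the supremum of such $\gamma$. $H$ and $K$ are *locally equivalent* if each simulates the other at rate $1$ and, unless $H$ is of the form $X\otimes I+I\otimes Y$ (when the rates are unbounded), $\gamma_{K|H}=\gamma_{H|K}=1$. The *entanglement capacity* is $E_H=\lim_{T\to\infty}\sup\,[E(\text{final state})-E(\text{initial state})]/T$, where the supremum is over all protocols of duration $T$ with arbitrary finite-dimensional ancillas (which may hold any number of copies of the interacting systems) and all initial pure states,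 and $E$ is the entropy of entanglement in ebits; that the limit exists is part of the claim. -/

import Mathlib

open scoped Matrix Kronecker NNReal ENNReal

noncomputable section

namespace BipartiteSimulation

/- ### Bipartite Hamiltonians
A Hamiltonian on `ℂ^a ⊗ ℂ^b` is a (Hermitian) matrix indexed by `a × b`. -/

/-- The Pauli matrix `σ_z = diag(1, -1)`. -/
def pauliZ : Matrix (Fin 2) (Fin 2) ℂ := !![1, 0; 0, -1]

/-- The Ising interaction `σ_z ⊗ σ_z` on two qubits. -/
def isingHamiltonian : Matrix (Fin 2 × Fin 2) (Fin 2 × Fin 2) ℂ := pauliZ ⊗ₖ pauliZ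

/-- `H` is local: `H = X ⊗ I + I ⊗ Y`. -/
def IsLocal {a b : Type*} [DecidableEq a] [DecidableEq b]
    (H : Matrix (a × b) (a × b) ℂ) : Prop :=
  ∃ (X : Matrix a a ℂ) (Y : Matrix b b ℂ),
    H = X ⊗ₖ (1 : Matrix b b ℂ) + (1 : Matrix a a ℂ) ⊗ₖ Y

/-- The time evolution `exp (-i t H)`. -/
def evolution {ι : Type*} [Fintype ι] [DecidableEq ι] (H : Matrix ι ι ℂ) (t : ℝ) :
    Matrix ι ι ℂ :=
  NormedSpace.exp ((-(Complex.I * (t : ℂ))) • H)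

/-- `H ⊗ I` on the interacting systems `a`, `b` together with an ancilla `r` of Alice and an
ancilla `s` of Bob; the tensor factors are ordered as (Alice's systems) × (Bob's systems). -/
def withAncillas {a b : Type*} (r s : Type*) [DecidableEq r] [DecidableEq s]
    (H : Matrix (a × b) (a × b) ℂ) :
    Matrix ((a × r) × (b × s)) ((a × r) × (b × s)) ℂ :=
  (H ⊗ₖ (1 : Matrix (r × s) (r × s) ℂ)).submatrix
    (Equiv.prodProdProdComm a r b s) (Equiv.prodProdProdComm a r b s)

/- ### Extremal eigenvalues -/

section Extremal

variable {a : Type*} [Fintype a] [DecidableEq a]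

/-- The largest (real) eigenvalue. -/
def maxEigenvalue (M : Matrix a a ℂ) : ℝ := sSup (spectrum ℝ M)

/-- The smallest (real) eigenvalue. -/
def minEigenvalue (M : Matrix a a ℂ) : ℝ := sInf (spectrum ℝ M)

/-- The difference `Δ` of the largest and the smallest eigenvalue. -/
def spread (M : Matrix a a ℂ) : ℝ := maxEigenvalue M - minEigenvalue M

/-- The subspace that belongs to the two extremal eigenvalues: the sum of their eigenspaces. -/
def extremalSpace (M : Matrix a a ℂ) : Submodule ℂ (EuclideanSpace ℂ a) :=
  Module.End.eigenspace (Matrix.toEuclideanLin M) ((maxEigenvalue M : ℝ) : ℂ) ⊔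
    Module.End.eigenspace (Matrix.toEuclideanLin M) ((minEigenvalue M : ℝ) : ℂ)

/-- The orthogonal projection onto the extremal subspace. -/
def extremalProj (M : Matrix a a ℂ) : EuclideanSpace ℂ a →ₗ[ℂ] EuclideanSpace ℂ a :=
  ((extremalSpace M).starProjection : EuclideanSpace ℂ a →L[ℂ] EuclideanSpace ℂ a)

/-- The restriction of `M` to its extremal subspace, extended by zero to the orthogonal
complement. -/
def extremalRestriction (M : Matrix a a ℂ) : EuclideanSpace ℂ a →ₗ[ℂ] EuclideanSpace ℂ a :=
  extremalProj M ∘ₗ Matrix.toEuclideanLin M ∘ₗ extremalProj M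

/-- The restriction `M^e` of `M` to its extremal subspace, made traceless by subtracting a multiple
of the identity of that subspace. -/
def extremalPart (M : Matrix a a ℂ) : EuclideanSpace ℂ a →ₗ[ℂ] EuclideanSpace ℂ a :=
  extremalRestriction M -
    (LinearMap.trace ℂ (EuclideanSpace ℂ a) (extremalRestriction M) /
      (Module.finrank ℂ (extremalSpace M) : ℂ)) • extremalProj M

end Extremal

/- ### Protocols -/

/-- One step of a protocol: the interaction is on for a time `time`; then Alice and Bob apply
instantaneous unitaries to everything they hold (interacting system and ancilla). -/
structure Step (a b r s : Type*) [Fintype a] [DecidableEq a] [Fintype b] [DecidableEq b]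
    [Fintype r] [DecidableEq r] [Fintype s] [DecidableEq s] where
  time : ℝ≥0
  alice : Matrix.unitaryGroup (a × r) ℂ
  bob : Matrix.unitaryGroup (b × s) ℂ

section Protocol

variable {a b r s : Type*} [Fintype a] [DecidableEq a] [Fintype b] [DecidableEq b]
  [Fintype r] [DecidableEq r] [Fintype s] [DecidableEq s]

/-- Total time during which the interaction is used. -/
def duration (P : List (Step a b r s)) : ℝ := (P.map fun p => (p.time : ℝ)).sum

/-- The operator effected by one step when the interaction is `H`. -/
def Step.operator (H : Matrix (a × b) (a × b) ℂ) (p : Step a b r s) :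
    Matrix ((a × r) × (b × s)) ((a × r) × (b × s)) ℂ :=
  ((p.alice : Matrix (a × r) (a × r) ℂ) ⊗ₖ (p.bob : Matrix (b × s) (b × s) ℂ)) *
    evolution (withAncillas r s H) p.time

/-- The operator effected by a protocol; the head of the list is executed last. -/
def protocolOperator (H : Matrix (a × b) (a × b) ℂ) (P : List (Step a b r s)) :
    Matrix ((a × r) × (b × s)) ((a × r) × (b × s)) ℂ :=
  (P.map (Step.operator H)).prod

end Protocol

/- ### Simulation with catalytic entanglement -/

/-- The product `ψ ⊗ η` of a state `ψ` of the registers `a'`, `b'` (held by Alice and Bob) and a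
state `η` of their remaining systems. -/
def attach {a b a' b' u v : Type*} (ψ : a' × b' → ℂ) (η : (a × u) × (b × v) → ℂ) :
    (a × (a' × u)) × (b × (b' × v)) → ℂ :=
  fun x => ψ (x.1.2.1, x.2.2.1) * η ((x.1.1, x.1.2.2), (x.2.1, x.2.2.2))

/-- With catalytic entanglement, `H` can simulate `K` at rate `γ`.
There are ancillas of finite dimension and a (possibly entangled) state `η` of the systems on which
`H` acts and of the ancillas, such that for every `t ≥ 0` the evolution `exp (-i t K)` of registers
`a'`, `b'` is obtained, to any accuracy and with `η` returned, by a protocol that uses `H` for a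
total time at most `t / γ`. The same `η` serves for all times and all accuracies. -/
def SimulatesAtRate {a b a' b' : Type*}
    [Fintype a] [DecidableEq a] [Fintype b] [DecidableEq b]
    [Fintype a'] [DecidableEq a'] [Fintype b'] [DecidableEq b']
    (H : Matrix (a × b) (a × b) ℂ) (K : Matrix (a' × b') (a' × b') ℂ) (γ : ℝ) : Prop :=
  ∃ (m n : ℕ) (η : (a × Fin m) × (b × Fin n) → ℂ),
    ‖WithLp.toLp 2 η‖ = 1 ∧
    ∀ t : ℝ, 0 ≤ t → ∀ ε : ℝ, 0 < ε →
      ∃ P : List (Step a b (a' × Fin m) (b' × Fin n)),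
        γ * duration P ≤ t ∧
        ∀ ψ : a' × b' → ℂ, ‖WithLp.toLp 2 ψ‖ = 1 →
          ‖WithLp.toLp 2 (protocolOperator H P *ᵥ attach ψ η -
              attach (evolution K t *ᵥ ψ) η)‖ ≤ ε

/-- The optimal rate `γ_{K|H}` at which `H` can simulate `K` with catalytic entanglement. -/
def optimalRate {a b a' b' : Type*}
    [Fintype a] [DecidableEq a] [Fintype b] [DecidableEq b]
    [Fintype a'] [DecidableEq a'] [Fintype b'] [DecidableEq b']
    (K : Matrix (a' × b') (a' × b') ℂ) (H : Matrix (a × b) (a × b) ℂ) : ℝ≥0∞ :=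
  ⨆ (γ : ℝ≥0) (_ : SimulatesAtRate H K (γ : ℝ)), (γ : ℝ≥0∞)

/-- With catalytic entanglement, `H` and `K` are locally equivalent: each simulates the other at unit
rate and, unless `H` is local (when the rates are unbounded), one is the optimal rate in
both directions. -/
def LocallyEquivalent {a b a' b' : Type*}
    [Fintype a] [DecidableEq a] [Fintype b] [DecidableEq b]
    [Fintype a'] [DecidableEq a'] [Fintype b'] [DecidableEq b']
    (H : Matrix (a × b) (a × b) ℂ) (K : Matrix (a' × b') (a' × b') ℂ) : Prop :=
  SimulatesAtRate H K 1 ∧ SimulatesAtRate K H 1 ∧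
    (¬ IsLocal H → optimalRate K H = 1 ∧ optimalRate H K = 1)

/- ### Entanglement capacity -/

/-- The entropy of entanglement, in ebits, of a pure state of `α × β`: the von Neumann entropy to
base two of Alice's reduced density matrix. -/
def entanglement {α β : Type*} [Fintype α] [DecidableEq α] [Fintype β] (ψ : α × β → ℂ) : ℝ :=
  ∑ k, Real.negMulLog ((Matrix.isHermitian_mul_conjTranspose_self
    (Matrix.of fun (i : α) (j : β) => ψ (i, j))).eigenvalues k) / Real.log 2

/-- The largest average rate at which entanglement can be generated when `H` is used for a total
time `T`: the supremum of (final entanglement - initial entanglement) / `T` over all ancillas of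
finite dimension (which may hold any number of copies of the interacting systems, swapped in
by local unitaries), all initial pure states, and all protocols of duration `T`. -/
def entanglementRate {a b : Type*} [Fintype a] [DecidableEq a] [Fintype b] [DecidableEq b]
    (H : Matrix (a × b) (a × b) ℂ) (T : ℝ) : EReal :=
  sSup {e : EReal | ∃ (m n : ℕ) (ψ : (a × Fin m) × (b × Fin n) → ℂ)
    (P : List (Step a b (Fin m) (Fin n))),
    ‖WithLp.toLp 2 ψ‖ = 1 ∧ duration P = T ∧
    e = (((entanglement (protocolOperator H P *ᵥ ψ) - entanglement ψ) / T : ℝ) : EReal)}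

/-- `E_H = E`: the asymptotic entanglement capacity of `H` (ebits per unit of time). -/
def HasEntanglementCapacity {a b : Type*}
    [Fintype a] [DecidableEq a] [Fintype b] [DecidableEq b]
    (H : Matrix (a × b) (a × b) ℂ) (E : ℝ) : Prop :=
  Filter.Tendsto (entanglementRate H) Filter.atTop (nhds (E : EReal))

/-- `α = 2 max_{x ∈ [0,1]} √(x (1 - x)) log₂ (x / (1 - x))`. -/
def alphaConst : ℝ :=
  2 * sSup ((fun x : ℝ => √(x * (1 - x)) * Real.logb 2 (x / (1 - x))) '' Set.Icc 0 1)

end BipartiteSimulation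

end

open scoped Matrix Kronecker NNReal ENNReal
set_option linter.unusedSectionVars false
noncomputable section

namespace BipartiteSimulation

/-! ### Time evolutions: intertwining, unitarity, derivative. -/

section Evolution

open scoped Matrix.Norms.L2Operator

variable {n m k : Type*} [Fintype n] [DecidableEq n] [Fintype m] [DecidableEq m]
  [Fintype k] [DecidableEq k]

/-! Two simulations and one entropy inequality share the constant c = (Δ_J² + Δ_G²)/4. Subtracting
from each factor the midpoint of its spectrum changes `H` only by local terms, which cost no
interaction time, and leaves factors of norm at most Δ_J/2 or Δ_G/2.

`H` simulates c σ_z ⊗ σ_z (`simulatesWith_ising`). In suitable frames of the extremal subspaces the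
centred J factors become (Δ_J/2) σ_z and the centred G factors real symmetric traceless matrices
(`exists_canonical_frame`); the trace condition makes the latter equal for Alice and Bob. If M is
real symmetric with M² = g² and Φ is maximally entangled, then (M ⊗ M)Φ = (M Mᵀ ⊗ 1)Φ = g²Φ. So Φ is
an eigenvector of the centred `H` with eigenvalue c, and a quarter turn by either party, which
anticommutes with M, reverses the sign of the eigenvalue (`bell_eigenvector`). When each party turns
its half of Φ conditionally on a qubit, the interaction gives the two qubits exactly the Ising
phases, and undoing the turns returns the catalyst Φ.

Conversely, a Hermitian J with norm at most x, multiplied by σ_z of an extra qubit, is x times the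
mean of two rotated copies of σ_z (`exists_dilation`). Trotter averaging over local rotations
(`Reach.add`), with the extra qubits in |0⟩, turns c σ_z ⊗ σ_z into `H` at the cost (Δ_J²/4 +
Δ_G²/4)/c = 1.

For the capacity, X ⊗ Y with ‖X‖ ≤ x and ‖Y‖ ≤ y creates entanglement at a rate of at most α x y,
whatever the ancillas (`rateForm_kronecker_le`): in the Schmidt basis the rate is a sum over pairs
of Schmidt coefficients, each pair is controlled by the function defining α, and Cauchy–Schwarz does
the rest. Summing the two terms of `H` gives the bound α c. It is attained: the Ising interaction
reaches the slope α c, up to any error, at a suitable two-qubit state, `H` inherits this through the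
simulation, and the short run is repeated on fresh copies (`SimulatesWith.attains`).

Optimality of the unit rates is then entropic: a simulation faster than 1 would lower the bound on
the simulated interaction below what that interaction attains (`optimalRate_eq_one`). -/

theorem exp_mul_of_intertwine {G : Matrix n n ℂ} {K : Matrix m m ℂ} {L : Matrix n m ℂ}
    (h : G * L = L * K) : NormedSpace.exp G * L = L * NormedSpace.exp K := by
  have hpow : ∀ j : ℕ, G ^ j * L = L * K ^ j := by
    intro j
    induction j with
    | zero => simp
    | succ j ih => rw [pow_succ, Matrix.mul_assoc, h, ← Matrix.mul_assoc, ih, Matrix.mul_assoc,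
        ← pow_succ]
  have h1 := NormedSpace.exp_series_hasSum_exp' (𝕂 := ℂ) G
  have h2 := NormedSpace.exp_series_hasSum_exp' (𝕂 := ℂ) K
  have h3 := h1.map (AddMonoidHom.mk' (fun A : Matrix n n ℂ => A * L) fun A B => Matrix.add_mul A B L)
    (by exact continuous_id.matrix_mul continuous_const)
  have h4 := h2.map (AddMonoidHom.mk' (fun A : Matrix m m ℂ => L * A) fun A B => Matrix.mul_add L A B)
    (by exact continuous_const.matrix_mul continuous_id)
  refine h3.unique ?_
  have e : (fun j : ℕ => ((j.factorial : ℂ)⁻¹ • G ^ j) * L) =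
      fun j : ℕ => L * ((j.factorial : ℂ)⁻¹ • K ^ j) := by
    funext j
    simp [hpow]
  exact (show HasSum (fun j : ℕ => ((j.factorial : ℂ)⁻¹ • G ^ j) * L) _ from e ▸ h4)

/-- A rectangular `L` is allowed because the relation is used both for conjugation by a unitary and
for the isometry that attaches a catalyst. -/
theorem evolution_mul_of_intertwine {G : Matrix n n ℂ} {K : Matrix m m ℂ} {L : Matrix n m ℂ}
    (h : G * L = L * K) (t : ℝ) : evolution G t * L = L * evolution K t := by
  apply exp_mul_of_intertwine
  simp [h]

@[simp] theorem evolution_zero (G : Matrix n n ℂ) : evolution G 0 = 1 := by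
  simp [evolution]

theorem evolution_add_time (G : Matrix n n ℂ) (s t : ℝ) :
    evolution G (s + t) = evolution G s * evolution G t := by
  unfold evolution
  rw [← Matrix.exp_add_of_commute]
  · rw [← add_smul]; congr 2; push_cast; ring
  · exact ((Commute.refl G).smul_left _).smul_right _

theorem evolution_conjTranspose {G : Matrix n n ℂ} (hG : G.IsHermitian) (t : ℝ) :
    (evolution G t)ᴴ = evolution G (-t) := by
  unfold evolution
  rw [← Matrix.exp_conjTranspose]
  congr 1
  rw [Matrix.conjTranspose_smul, hG.eq]
  simp

theorem evolution_mem_unitary {G : Matrix n n ℂ} (hG : G.IsHermitian) (t : ℝ) :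
    evolution G t ∈ Matrix.unitaryGroup n ℂ := by
  rw [Matrix.mem_unitaryGroup_iff, Matrix.star_eq_conjTranspose, evolution_conjTranspose hG,
    ← evolution_add_time]
  simp

theorem hasDerivAt_evolution (G : Matrix n n ℂ) (t : ℝ) :
    HasDerivAt (evolution G) (-(Complex.I • (G * evolution G t))) t := by
  have h := hasDerivAt_exp_smul_const' (𝕂 := ℝ) (-(Complex.I • G)) t
  have e : (fun u : ℝ => NormedSpace.exp (u • (-(Complex.I • G)))) = evolution G := by
    funext u
    unfold evolution
    congr 1
    rw [← Complex.coe_smul, smul_neg, smul_smul, neg_smul, mul_comm]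
  rw [e] at h
  refine h.congr_deriv ?_
  rw [show NormedSpace.exp (t • (-(Complex.I • G))) = evolution G t from congrFun e t]
  simp

theorem continuous_evolution (G : Matrix n n ℂ) : Continuous (evolution G) :=
  continuous_iff_continuousAt.2 fun t => (hasDerivAt_evolution G t).continuousAt

theorem norm_le_one_of_mem_unitary {U : Matrix n n ℂ} (hU : U ∈ Matrix.unitaryGroup n ℂ) :
    ‖U‖ ≤ 1 := by
  cases isEmpty_or_nonempty n
  · rw [Subsingleton.elim U 0]; simp
  · exact (CStarRing.norm_of_mem_unitary hU).le

theorem norm_mulVec_le {n m : Type*} [Fintype n] [Fintype m] [DecidableEq m] (A : Matrix n m ℂ) (x : m → ℂ) :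
    ‖WithLp.toLp 2 (A *ᵥ x)‖ ≤ ‖A‖ * ‖WithLp.toLp 2 x‖ :=
  Matrix.l2_opNorm_mulVec A (WithLp.toLp 2 x)

theorem norm_unitary_mulVec {U : Matrix n n ℂ} (hU : U ∈ Matrix.unitaryGroup n ℂ) (x : n → ℂ) :
    ‖WithLp.toLp 2 (U *ᵥ x)‖ = ‖WithLp.toLp 2 x‖ := by
  apply le_antisymm
  · exact (norm_mulVec_le U x).trans
      (mul_le_of_le_one_left (norm_nonneg _) (norm_le_one_of_mem_unitary hU))
  · have h := norm_mulVec_le (star U) (U *ᵥ x)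
    rw [Matrix.mulVec_mulVec, Matrix.mem_unitaryGroup_iff'.1 hU, Matrix.one_mulVec] at h
    refine h.trans (mul_le_of_le_one_left (norm_nonneg _) (norm_le_one_of_mem_unitary ?_))
    exact Unitary.star_mem hU

end Evolution

/- ### Ampliation -/

section Ampliate

variable {n m k : Type*} [Fintype n] [DecidableEq n] [Fintype m] [DecidableEq m]
  [Fintype k] [DecidableEq k]

/-- `A ⊗ I`, reindexed along `e`. -/
def ampliate (e : n ≃ m × k) : Matrix m m ℂ →ₐ[ℂ] Matrix n n ℂ where
  toFun A := (A ⊗ₖ (1 : Matrix k k ℂ)).submatrix e e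
  map_one' := by simp
  map_mul' A B := by
    rw [Matrix.submatrix_mul_equiv, ← Matrix.mul_kronecker_mul, one_mul]
  map_zero' := by simp
  map_add' A B := by rw [Matrix.add_kronecker]; rfl
  commutes' r := by
    rw [Matrix.algebraMap_eq_diagonal, Matrix.algebraMap_eq_diagonal]
    ext i j
    by_cases h : i = j
    · subst h; simp [Matrix.kroneckerMap_apply]
    · have h' : e i ≠ e j := fun q => h (e.injective q)
      rw [Matrix.diagonal_apply_ne _ h]
      simp only [Matrix.submatrix_apply, Matrix.kroneckerMap_apply, Matrix.diagonal_apply,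
        Matrix.one_apply]
      by_cases h1 : (e i).1 = (e j).1
      · have : (e i).2 ≠ (e j).2 := fun q => h' (Prod.ext h1 q)
        simp [this]
      · simp [h1]

theorem ampliate_apply (e : n ≃ m × k) (A : Matrix m m ℂ) (x y : n) :
    ampliate e A x y = if (e x).2 = (e y).2 then A (e x).1 (e y).1 else 0 := by
  simp [ampliate, Matrix.kroneckerMap_apply, Matrix.one_apply]

theorem ampliate_conjTranspose (e : n ≃ m × k) (A : Matrix m m ℂ) :
    (ampliate e A)ᴴ = ampliate e Aᴴ := by
  ext x y
  simp only [Matrix.conjTranspose_apply, ampliate_apply, eq_comm (a := (e y).2)]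
  split_ifs <;> simp

theorem ampliate_isHermitian (e : n ≃ m × k) {A : Matrix m m ℂ} (hA : A.IsHermitian) :
    (ampliate e A).IsHermitian := by
  rw [Matrix.IsHermitian, ampliate_conjTranspose, hA.eq]

theorem ampliate_mem_unitary (e : n ≃ m × k) {A : Matrix m m ℂ}
    (hA : A ∈ Matrix.unitaryGroup m ℂ) : ampliate e A ∈ Matrix.unitaryGroup n ℂ := by
  rw [Matrix.mem_unitaryGroup_iff, Matrix.star_eq_conjTranspose, ampliate_conjTranspose, ← map_mul,
    ← Matrix.star_eq_conjTranspose, Matrix.mem_unitaryGroup_iff.1 hA, map_one]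

theorem ampliate_mulVec (e : n ≃ m × k) (A : Matrix m m ℂ) (Ψ : n → ℂ) (x : n) :
    (ampliate e A *ᵥ Ψ) x = (A *ᵥ fun i => Ψ (e.symm (i, (e x).2))) (e x).1 := by
  simp only [Matrix.mulVec, dotProduct]
  rw [← e.symm.sum_comp, Fintype.sum_prod_type]
  refine Finset.sum_congr rfl fun i _ => ?_
  simp [ampliate_apply]

theorem continuous_ampliate (e : n ≃ m × k) : Continuous (ampliate e : Matrix m m ℂ → Matrix n n ℂ) :=
  (ampliate e).toLinearMap.continuous_of_finiteDimensional

open scoped Matrix.Norms.L2Operator in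
theorem evolution_ampliate (e : n ≃ m × k) (A : Matrix m m ℂ) (t : ℝ) :
    evolution (ampliate e A) t = ampliate e (evolution A t) := by
  unfold evolution
  let _ : NormedAlgebra ℚ (Matrix m m ℂ) := NormedAlgebra.restrictScalars ℚ ℂ _
  rw [NormedSpace.map_exp (ampliate e) (continuous_ampliate e), map_smul]

end Ampliate

/-! ### Protocols in the presence of idle ancillas. -/

section Lift

variable {a b r s : Type*} [Fintype a] [DecidableEq a] [Fintype b] [DecidableEq b]
  [Fintype r] [DecidableEq r] [Fintype s] [DecidableEq s]

theorem withAncillas_eq_ampliate (H : Matrix (a × b) (a × b) ℂ) :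
    withAncillas r s H = ampliate (Equiv.prodProdProdComm a r b s) H := rfl

theorem withAncillas_isHermitian {H : Matrix (a × b) (a × b) ℂ} (hH : H.IsHermitian) :
    (withAncillas r s H).IsHermitian := ampliate_isHermitian _ hH

theorem kronecker_mem_unitary {U : Matrix a a ℂ} {V : Matrix b b ℂ}
    (hU : U ∈ Matrix.unitaryGroup a ℂ) (hV : V ∈ Matrix.unitaryGroup b ℂ) :
    U ⊗ₖ V ∈ Matrix.unitaryGroup (a × b) ℂ := Matrix.kronecker_mem_unitary hU hV

theorem Step.operator_mem_unitary {H : Matrix (a × b) (a × b) ℂ} (hH : H.IsHermitian)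
    (p : Step a b r s) : p.operator H ∈ Matrix.unitaryGroup _ ℂ :=
  mul_mem (kronecker_mem_unitary p.alice.2 p.bob.2)
    (evolution_mem_unitary (withAncillas_isHermitian hH) _)

theorem protocolOperator_mem_unitary {H : Matrix (a × b) (a × b) ℂ} (hH : H.IsHermitian)
    (P : List (Step a b r s)) : protocolOperator H P ∈ Matrix.unitaryGroup _ ℂ := by
  apply Submonoid.list_prod_mem
  intro x hx
  obtain ⟨p, -, rfl⟩ := List.mem_map.1 hx
  exact p.operator_mem_unitary hH

@[simp] theorem protocolOperator_nil (H : Matrix (a × b) (a × b) ℂ) :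
    protocolOperator H ([] : List (Step a b r s)) = 1 := by simp [protocolOperator]

theorem protocolOperator_cons (H : Matrix (a × b) (a × b) ℂ) (p : Step a b r s)
    (P : List (Step a b r s)) :
    protocolOperator H (p :: P) = p.operator H * protocolOperator H P := by simp [protocolOperator]

theorem protocolOperator_append (H : Matrix (a × b) (a × b) ℂ) (P Q : List (Step a b r s)) :
    protocolOperator H (P ++ Q) = protocolOperator H P * protocolOperator H Q := by
  simp [protocolOperator]

@[simp] theorem duration_nil : duration ([] : List (Step a b r s)) = 0 := by simp [duration]

theorem duration_cons (p : Step a b r s) (P : List (Step a b r s)) :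
    duration (p :: P) = p.time + duration P := by simp [duration]

theorem duration_append (P Q : List (Step a b r s)) :
    duration (P ++ Q) = duration P + duration Q := by simp [duration]

variable {r' s' u v : Type*} [Fintype r'] [DecidableEq r'] [Fintype s'] [DecidableEq s']
  [Fintype u] [DecidableEq u] [Fintype v] [DecidableEq v]

/-- Splitting an ancilla `r' ≃ r × u` next to the interacting system `a`. -/
def splitAncilla (a : Type*) (e : r' ≃ r × u) : a × r' ≃ (a × r) × u :=
  (Equiv.prodCongr (Equiv.refl a) e).trans (Equiv.prodAssoc a r u).symm

/-- Splitting the ancillas of both parties. -/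
def splitAncillas (a b : Type*) (e : r' ≃ r × u) (f : s' ≃ s × v) :
    (a × r') × (b × s') ≃ ((a × r) × (b × s)) × (u × v) :=
  (Equiv.prodCongr (splitAncilla a e) (splitAncilla b f)).trans
    (Equiv.prodProdProdComm (a × r) u (b × s) v)

/-- The same step in the presence of idle ancillas. -/
def Step.lift (e : r' ≃ r × u) (f : s' ≃ s × v) (p : Step a b r s) : Step a b r' s' where
  time := p.time
  alice := ⟨ampliate (splitAncilla a e) p.alice, ampliate_mem_unitary _ p.alice.2⟩
  bob := ⟨ampliate (splitAncilla b f) p.bob, ampliate_mem_unitary _ p.bob.2⟩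

theorem Step.operator_lift (H : Matrix (a × b) (a × b) ℂ) (e : r' ≃ r × u) (f : s' ≃ s × v)
    (p : Step a b r s) :
    (p.lift e f).operator H = ampliate (splitAncillas a b e f) (p.operator H) := by
  unfold Step.operator
  rw [map_mul, ← evolution_ampliate]
  congr 1
  · ext x y
    simp only [Step.lift, Matrix.kroneckerMap_apply, ampliate_apply, splitAncillas,
      Equiv.trans_apply, Equiv.prodCongr_apply, Prod.map, Equiv.prodProdProdComm_apply,
      Prod.mk.injEq]
    split_ifs <;> simp_all
  · congr 1
    ext x y
    obtain ⟨⟨x1, x2⟩, x3, x4⟩ := x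
    obtain ⟨⟨y1, y2⟩, y3, y4⟩ := y
    have h1 : (e x2 = e y2) ↔ x2 = y2 := e.injective.eq_iff
    have h2 : (f x4 = f y4) ↔ x4 = y4 := f.injective.eq_iff
    rw [Prod.ext_iff] at h1 h2
    simp only [withAncillas_eq_ampliate, ampliate_apply, splitAncillas, splitAncilla,
      Equiv.trans_apply, Equiv.prodCongr_apply, Prod.map, Equiv.prodProdProdComm_apply,
      Prod.mk.injEq, Equiv.prodAssoc_symm_apply, Equiv.refl_apply, ← h1, ← h2]
    split_ifs <;> tauto

theorem protocolOperator_lift (H : Matrix (a × b) (a × b) ℂ) (e : r' ≃ r × u) (f : s' ≃ s × v)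
    (P : List (Step a b r s)) :
    protocolOperator H (P.map (Step.lift e f)) =
      ampliate (splitAncillas a b e f) (protocolOperator H P) := by
  induction P with
  | nil => simp
  | cons p P ih => rw [List.map_cons, protocolOperator_cons, protocolOperator_cons, map_mul, ih,
      Step.operator_lift]

@[simp] theorem duration_lift (e : r' ≃ r × u) (f : s' ≃ s × v) (P : List (Step a b r s)) :
    duration (P.map (Step.lift e f)) = duration P := by
  simp [duration, Step.lift, Function.comp_def]

end Lift

/-! ### Sums over spectra of Hermitian matrices. -/

section SpectralSum

variable {n m : Type*} [Fintype n] [DecidableEq n] [Fintype m] [DecidableEq m]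

/-- The indexing of `eigenvalues` carries no meaning; the multiset of roots of the characteristic
polynomial does, and it can be compared even across different index types. -/
theorem sum_eigenvalues_eq_of_roots {A : Matrix n n ℂ} (hA : A.IsHermitian) (d : m → ℝ)
    (h : A.charpoly.roots = Finset.univ.val.map fun i => (d i : ℂ)) (g : ℝ → ℝ) :
    ∑ i, g (hA.eigenvalues i) = ∑ i, g (d i) := by
  rw [hA.roots_charpoly_eq_eigenvalues] at h
  have h2 := congrArg (fun s : Multiset ℂ => (s.map fun z => g z.re).sum) h
  simpa [Multiset.map_map, Function.comp_def] using h2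

theorem sum_eigenvalues_eq_of_charpoly {A : Matrix n n ℂ} {B : Matrix m m ℂ} (hA : A.IsHermitian)
    (hB : B.IsHermitian) (h : A.charpoly = B.charpoly) (g : ℝ → ℝ) :
    ∑ i, g (hA.eigenvalues i) = ∑ i, g (hB.eigenvalues i) := by
  apply sum_eigenvalues_eq_of_roots
  rw [h, hB.roots_charpoly_eq_eigenvalues]
  rfl

theorem charpoly_unitary_conj {U : Matrix n n ℂ} (hU : U ∈ Matrix.unitaryGroup n ℂ)
    (A : Matrix n n ℂ) : (U * A * Uᴴ).charpoly = A.charpoly := by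
  rw [Matrix.charpoly_mul_comm, ← Matrix.mul_assoc, ← Matrix.star_eq_conjTranspose,
    Matrix.mem_unitaryGroup_iff'.1 hU, Matrix.one_mul]

theorem sum_eigenvalues_eq_of_diagonalization {A : Matrix n n ℂ} (hA : A.IsHermitian)
    {U : Matrix n n ℂ} (hU : U ∈ Matrix.unitaryGroup n ℂ) (d : n → ℝ)
    (h : A = U * Matrix.diagonal (fun i => (d i : ℂ)) * Uᴴ) (g : ℝ → ℝ) :
    ∑ i, g (hA.eigenvalues i) = ∑ i, g (d i) := by
  apply sum_eigenvalues_eq_of_roots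
  rw [h, charpoly_unitary_conj hU, Matrix.charpoly_diagonal, Polynomial.roots_prod]
  · simp
  · simp [Finset.prod_ne_zero_iff, Polynomial.X_sub_C_ne_zero]

theorem trace_cfc_eq_sum {A : Matrix n n ℂ} (hA : A.IsHermitian) (g : ℝ → ℝ) :
    (cfc g A).trace = ((∑ i, g (hA.eigenvalues i) : ℝ) : ℂ) := by
  rw [hA.cfc_eq, Matrix.IsHermitian.cfc, Unitary.conjStarAlgAut_apply, Matrix.trace_mul_comm,
    ← Matrix.mul_assoc]
  simp [Matrix.trace_diagonal]

-- Near any point the norms, hence the spectra, stay in one compact ball, and this is what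
-- continuity of the functional calculus requires.
open scoped Matrix.Norms.L2Operator in
theorem continuous_cfc_of_isHermitian {X : Type*} [TopologicalSpace X] {f : X → Matrix n n ℂ}
    (hf : Continuous f) (hh : ∀ x, (f x).IsHermitian) {g : ℝ → ℝ} (hg : Continuous g) :
    Continuous fun x => cfc g (f x) := by
  refine continuous_iff_continuousAt.2 fun x₀ => ?_
  set R : ℝ := (‖f x₀‖ + 1) * ‖(1 : Matrix n n ℂ)‖
  refine ContinuousAt.cfc (p := IsSelfAdjoint) (isCompact_closedBall (0 : ℝ) R) g hf.continuousAt ?_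
    (Filter.Eventually.of_forall fun x => hh x) hg.continuousOn
  have h1 : ∀ᶠ x in nhds x₀, ‖f x‖ < ‖f x₀‖ + 1 :=
    (hf.norm.continuousAt (x := x₀)).eventually_lt_const (by linarith)
  filter_upwards [h1] with x hx
  refine (spectrum.subset_closedBall_norm_mul (f x)).trans (Metric.closedBall_subset_closedBall ?_)
  exact mul_le_mul_of_nonneg_right hx.le (norm_nonneg _)

end SpectralSum

/-! ### Schmidt coefficients and entropy of entanglement. -/

section Schmidt

variable {α β : Type*} [Fintype α] [DecidableEq α] [Fintype β]

/-- The coefficients of a bipartite vector, as a matrix. -/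
def coeffMatrix (ψ : α × β → ℂ) : Matrix α β ℂ := Matrix.of fun i j => ψ (i, j)

/-- The reduced density matrix of Alice. -/
def reducedState (ψ : α × β → ℂ) : Matrix α α ℂ := coeffMatrix ψ * (coeffMatrix ψ)ᴴ

theorem reducedState_isHermitian (ψ : α × β → ℂ) : (reducedState ψ).IsHermitian :=
  Matrix.isHermitian_mul_conjTranspose_self _

open scoped ComplexOrder in
theorem reducedState_posSemidef (ψ : α × β → ℂ) : (reducedState ψ).PosSemidef :=
  Matrix.posSemidef_self_mul_conjTranspose _

/-- The sum of `g` over the squared Schmidt coefficients. -/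
def schmidtSum (g : ℝ → ℝ) (ψ : α × β → ℂ) : ℝ :=
  ∑ k, g ((reducedState_isHermitian ψ).eigenvalues k)

theorem entanglement_eq_schmidtSum (ψ : α × β → ℂ) :
    entanglement ψ = schmidtSum Real.negMulLog ψ / Real.log 2 := by
  rw [schmidtSum, Finset.sum_div]
  rfl

theorem continuous_coeffMatrix : Continuous (coeffMatrix : (α × β → ℂ) → Matrix α β ℂ) :=
  continuous_matrix fun i j => continuous_apply (i, j)

theorem continuous_reducedState : Continuous (reducedState : (α × β → ℂ) → Matrix α α ℂ) :=
  continuous_coeffMatrix.matrix_mul continuous_coeffMatrix.matrix_conjTranspose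

/-- Writing the sum as the trace of `cfc g` gives continuity without following single eigenvalues.
-/
theorem continuous_schmidtSum {g : ℝ → ℝ} (hg : Continuous g) :
    Continuous (schmidtSum g : (α × β → ℂ) → ℝ) := by
  have h : (schmidtSum g : (α × β → ℂ) → ℝ) = fun ψ => ((cfc g (reducedState ψ)).trace).re := by
    funext ψ
    rw [trace_cfc_eq_sum (reducedState_isHermitian ψ), Complex.ofReal_re, schmidtSum]
  rw [h]
  exact Complex.continuous_re.comp
    (continuous_cfc_of_isHermitian continuous_reducedState reducedState_isHermitian hg).matrix_trace

theorem continuous_entanglement : Continuous (entanglement : (α × β → ℂ) → ℝ) := by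
  have h : (entanglement : (α × β → ℂ) → ℝ) = fun ψ => schmidtSum Real.negMulLog ψ / Real.log 2 :=
    funext entanglement_eq_schmidtSum
  rw [h]
  exact (continuous_schmidtSum Real.continuous_negMulLog).div_const _

theorem coeffMatrix_kronecker_mulVec [DecidableEq β] {α' β' : Type*} [Fintype α'] [Fintype β']
    (A : Matrix α' α ℂ) (B : Matrix β' β ℂ)
    (ψ : α × β → ℂ) : coeffMatrix ((A ⊗ₖ B) *ᵥ ψ) = A * coeffMatrix ψ * Bᵀ := by
  ext i j
  simp only [coeffMatrix, Matrix.of_apply, Matrix.mulVec, dotProduct, Fintype.sum_prod_type,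
    Matrix.mul_apply, Matrix.kroneckerMap_apply, Matrix.transpose_apply, Finset.sum_mul]
  rw [Finset.sum_comm]
  refine Finset.sum_congr rfl fun x _ => Finset.sum_congr rfl fun y _ => by ring

theorem schmidtSum_local_unitary [DecidableEq β] (g : ℝ → ℝ) {U : Matrix α α ℂ} {V : Matrix β β ℂ}
    (hU : U ∈ Matrix.unitaryGroup α ℂ) (hV : V ∈ Matrix.unitaryGroup β ℂ) (ψ : α × β → ℂ) :
    schmidtSum g ((U ⊗ₖ V) *ᵥ ψ) = schmidtSum g ψ := by
  apply sum_eigenvalues_eq_of_charpoly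
  rw [← charpoly_unitary_conj hU (reducedState ψ)]
  congr 1
  have hV' : Vᵀ * Vᵀᴴ = 1 := by
    have h := congrArg Matrix.transpose (Matrix.mem_unitaryGroup_iff'.1 hV)
    rwa [Matrix.star_eq_conjTranspose, Matrix.transpose_mul, Matrix.transpose_one] at h
  rw [reducedState, coeffMatrix_kronecker_mulVec, Matrix.conjTranspose_mul,
    Matrix.conjTranspose_mul, Matrix.mul_assoc (U * coeffMatrix ψ), ← Matrix.mul_assoc Vᵀ, hV',
    Matrix.one_mul, reducedState]
  simp only [Matrix.mul_assoc]

theorem entanglement_local_unitary [DecidableEq β] {U : Matrix α α ℂ} {V : Matrix β β ℂ}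
    (hU : U ∈ Matrix.unitaryGroup α ℂ) (hV : V ∈ Matrix.unitaryGroup β ℂ) (ψ : α × β → ℂ) :
    entanglement ((U ⊗ₖ V) *ᵥ ψ) = entanglement ψ := by
  rw [entanglement_eq_schmidtSum, schmidtSum_local_unitary _ hU hV, ← entanglement_eq_schmidtSum]

theorem norm_sq_toLp (ψ : α × β → ℂ) :
    ‖WithLp.toLp 2 ψ‖ ^ 2 = ∑ i, ∑ j, ‖ψ (i, j)‖ ^ 2 := by
  rw [EuclideanSpace.norm_sq_eq, Fintype.sum_prod_type]

theorem sum_schmidt_eq_norm_sq (ψ : α × β → ℂ) :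
    ∑ k, (reducedState_isHermitian ψ).eigenvalues k = ‖WithLp.toLp 2 ψ‖ ^ 2 := by
  have h := (reducedState_isHermitian ψ).trace_eq_sum_eigenvalues
  rw [norm_sq_toLp]
  apply Complex.ofReal_injective
  push_cast
  refine h.symm.trans ?_
  simp only [Matrix.trace, Matrix.diag, reducedState, Matrix.mul_apply, coeffMatrix,
    Matrix.conjTranspose_apply, Matrix.of_apply]
  refine Finset.sum_congr rfl fun i _ => Finset.sum_congr rfl fun j _ => ?_
  exact Complex.mul_conj' _

theorem schmidt_nonneg (ψ : α × β → ℂ) (k : α) :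
    0 ≤ (reducedState_isHermitian ψ).eigenvalues k :=
  (reducedState_posSemidef ψ).eigenvalues_nonneg k

variable {α₁ α₂ β₁ β₂ : Type*} [Fintype α₁] [DecidableEq α₁] [Fintype α₂] [DecidableEq α₂]
  [Fintype β₁] [Fintype β₂]

/-- The tensor product of two bipartite vectors, in the arrangement given by `eA` and `eB`. -/
def tensorVec (eA : α ≃ α₁ × α₂) (eB : β ≃ β₁ × β₂) (ψ : α₁ × β₁ → ℂ) (χ : α₂ × β₂ → ℂ) :
    α × β → ℂ :=
  fun x => ψ ((eA x.1).1, (eB x.2).1) * χ ((eA x.1).2, (eB x.2).2)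

theorem norm_tensorVec (eA : α ≃ α₁ × α₂) (eB : β ≃ β₁ × β₂) (ψ : α₁ × β₁ → ℂ)
    (χ : α₂ × β₂ → ℂ) :
    ‖WithLp.toLp 2 (tensorVec eA eB ψ χ)‖ = ‖WithLp.toLp 2 ψ‖ * ‖WithLp.toLp 2 χ‖ := by
  rw [← sq_eq_sq₀ (norm_nonneg _) (by positivity), mul_pow, norm_sq_toLp, norm_sq_toLp,
    norm_sq_toLp, ← eA.symm.sum_comp, Fintype.sum_prod_type, Finset.sum_mul_sum]
  refine Finset.sum_congr rfl fun i _ => Finset.sum_congr rfl fun i' _ => ?_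
  rw [← eB.symm.sum_comp, Fintype.sum_prod_type, Finset.sum_mul_sum]
  simp [tensorVec, mul_pow]

theorem reducedState_tensorVec (eA : α ≃ α₁ × α₂) (eB : β ≃ β₁ × β₂) (ψ : α₁ × β₁ → ℂ)
    (χ : α₂ × β₂ → ℂ) :
    reducedState (tensorVec eA eB ψ χ) =
      Matrix.reindex eA.symm eA.symm (reducedState ψ ⊗ₖ reducedState χ) := by
  ext x y
  simp only [reducedState, Matrix.mul_apply, coeffMatrix, Matrix.conjTranspose_apply,
    Matrix.of_apply, Matrix.reindex_apply, Matrix.submatrix_apply, Matrix.kroneckerMap_apply,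
    Equiv.symm_symm, tensorVec]
  rw [← eB.symm.sum_comp, Fintype.sum_prod_type, Finset.sum_mul_sum]
  refine Finset.sum_congr rfl fun i _ => Finset.sum_congr rfl fun j _ => ?_
  simp
  ring

/-- The reduced state of a product is a Kronecker product, diagonalised by the product of the two
eigenbases. -/
theorem schmidtSum_tensorVec (g : ℝ → ℝ) (eA : α ≃ α₁ × α₂) (eB : β ≃ β₁ × β₂)
    (ψ : α₁ × β₁ → ℂ) (χ : α₂ × β₂ → ℂ) :
    schmidtSum g (tensorVec eA eB ψ χ) = ∑ i, ∑ j,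
      g ((reducedState_isHermitian ψ).eigenvalues i *
        (reducedState_isHermitian χ).eigenvalues j) := by
  have hk : (reducedState ψ ⊗ₖ reducedState χ).IsHermitian := by
    rw [Matrix.IsHermitian, Matrix.conjTranspose_kronecker, (reducedState_isHermitian ψ).eq,
      (reducedState_isHermitian χ).eq]
  rw [schmidtSum, sum_eigenvalues_eq_of_charpoly _ hk
    (by rw [reducedState_tensorVec, Matrix.charpoly_reindex]), ← Fintype.sum_prod_type']
  set U := (reducedState_isHermitian ψ).eigenvectorUnitary
  set V := (reducedState_isHermitian χ).eigenvectorUnitary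
  refine sum_eigenvalues_eq_of_diagonalization hk (kronecker_mem_unitary U.2 V.2)
    (fun x : α₁ × α₂ => (reducedState_isHermitian ψ).eigenvalues x.1 *
        (reducedState_isHermitian χ).eigenvalues x.2) ?_ g
  have h1 := (reducedState_isHermitian ψ).spectral_theorem
  have h2 := (reducedState_isHermitian χ).spectral_theorem
  rw [Unitary.conjStarAlgAut_apply] at h1 h2
  rw [Matrix.conjTranspose_kronecker]
  conv_lhs => rw [h1, h2]
  rw [Matrix.mul_kronecker_mul, Matrix.mul_kronecker_mul, Matrix.diagonal_kronecker_diagonal]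
  simp [Matrix.star_eq_conjTranspose, U, V]

/-- Additivity is the product rule of `negMulLog` together with both normalisations. It makes
catalysts and further copies cancel in the entanglement balances. -/
theorem entanglement_tensorVec (eA : α ≃ α₁ × α₂) (eB : β ≃ β₁ × β₂) {ψ : α₁ × β₁ → ℂ}
    {χ : α₂ × β₂ → ℂ} (hψ : ‖WithLp.toLp 2 ψ‖ = 1) (hχ : ‖WithLp.toLp 2 χ‖ = 1) :
    entanglement (tensorVec eA eB ψ χ) = entanglement ψ + entanglement χ := by
  rw [entanglement_eq_schmidtSum, entanglement_eq_schmidtSum, entanglement_eq_schmidtSum,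
    schmidtSum_tensorVec, ← add_div]
  congr 1
  have h1 := sum_schmidt_eq_norm_sq ψ
  have h2 := sum_schmidt_eq_norm_sq χ
  rw [hψ, one_pow] at h1
  rw [hχ, one_pow] at h2
  simp only [Real.negMulLog_mul, Finset.sum_add_distrib, ← Finset.sum_mul, ← Finset.mul_sum, h1, h2,
    one_mul]
  rfl

end Schmidt

/- ### The constant `α` -/

section Alpha

/-- Only boundedness matters here, so that the supremum in `alphaConst` is a genuine one. With y =
x/(1-x), the estimate log y ≤ 2√y suffices, since √(x(1-x)) √y = x. -/
theorem alpha_function_le {x : ℝ} (hx : x ∈ Set.Icc (0 : ℝ) 1) :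
    √(x * (1 - x)) * Real.logb 2 (x / (1 - x)) ≤ 2 / Real.log 2 := by
  have hl : 0 < Real.log 2 := Real.log_pos (by norm_num)
  rcases hx.2.eq_or_lt with rfl | h1
  · simp; positivity
  rcases hx.1.eq_or_lt with rfl | h0
  · simp; positivity
  have h1' : 0 < 1 - x := by linarith
  rw [Real.logb, ← mul_div_assoc]
  apply div_le_div_of_nonneg_right _ hl.le
  have hy : 0 < x / (1 - x) := by positivity
  have hlog : Real.log (x / (1 - x)) ≤ 2 * √(x / (1 - x)) := by
    have := Real.log_le_sub_one_of_pos (Real.sqrt_pos.2 hy)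
    rw [Real.log_sqrt hy.le] at this
    linarith
  calc √(x * (1 - x)) * Real.log (x / (1 - x))
      ≤ √(x * (1 - x)) * (2 * √(x / (1 - x))) :=
        mul_le_mul_of_nonneg_left hlog (Real.sqrt_nonneg _)
    _ = 2 * √((x * (1 - x)) * (x / (1 - x))) := by
        rw [Real.sqrt_mul (x := x * (1 - x)) (by positivity) (x / (1 - x))]; ring
    _ = 2 * x := by
        rw [show (x * (1 - x)) * (x / (1 - x)) = x ^ 2 by field_simp, Real.sqrt_sq h0.le]
    _ ≤ 2 := by linarith

theorem le_alphaConst {x : ℝ} (hx : x ∈ Set.Icc (0 : ℝ) 1) :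
    2 * (√(x * (1 - x)) * Real.logb 2 (x / (1 - x))) ≤ alphaConst := by
  unfold alphaConst
  apply mul_le_mul_of_nonneg_left _ zero_le_two
  refine le_csSup ⟨2 / Real.log 2, ?_⟩ (Set.mem_image_of_mem _ hx)
  rintro _ ⟨y, hy, rfl⟩
  exact alpha_function_le hy

theorem alphaConst_pos : 0 < alphaConst := by
  -- Any point strictly between 1/2 and 1 would do.
  have h := le_alphaConst (x := 4 / 5) (by constructor <;> norm_num)
  refine lt_of_lt_of_le ?_ h
  have : 0 < Real.logb 2 (4 / 5 / (1 - 4 / 5)) := Real.logb_pos (by norm_num) (by norm_num)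
  have : 0 < √((4 : ℝ) / 5 * (1 - 4 / 5)) := Real.sqrt_pos.2 (by norm_num)
  positivity

/-- Without `ε` both sides are homogeneous in (p, q), and x = p/(p+q) reduces the claim to the
function defining α. The shift `ε` only shrinks the logarithm when q ≤ p, and for p ≤ q the left
side is not positive. -/
theorem sqrt_mul_log_le {p q ε : ℝ} (hp : 0 < p) (hq : 0 < q) (hε : 0 ≤ ε) :
    √p * √q * (Real.log (p + ε) - Real.log (q + ε)) ≤
      alphaConst * Real.log 2 / 2 * (p + q) := by
  have hl : 0 < Real.log 2 := Real.log_pos (by norm_num)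
  rcases le_total p q with hpq | hpq
  · have h1 : Real.log (p + ε) - Real.log (q + ε) ≤ 0 :=
      sub_nonpos.2 (Real.log_le_log (by linarith) (by linarith))
    have h2 : 0 ≤ alphaConst * Real.log 2 / 2 * (p + q) := by
      have := alphaConst_pos; positivity
    exact (mul_nonpos_of_nonneg_of_nonpos (by positivity) h1).trans h2
  have h1 : Real.log (p + ε) - Real.log (q + ε) ≤ Real.log (p / q) := by
    rw [← Real.log_div (by positivity) (by positivity)]
    apply Real.log_le_log (by positivity)
    rw [div_le_div_iff₀ (by positivity) hq]
    nlinarith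
  have hs : 0 < p + q := by positivity
  have h2 := le_alphaConst (x := p / (p + q))
    ⟨by positivity, (div_le_one hs).2 (by linarith)⟩
  have e1 : 1 - p / (p + q) = q / (p + q) := by field_simp; ring
  have e2 : p / (p + q) / (q / (p + q)) = p / q := by field_simp
  have e3 : √(p / (p + q) * (q / (p + q))) = √p * √q / (p + q) := by
    rw [← Real.sqrt_mul hp.le, show p / (p + q) * (q / (p + q)) = p * q / (p + q) ^ 2 by
        rw [div_mul_div_comm, sq],
      Real.sqrt_div (by positivity), Real.sqrt_sq hs.le]
  rw [e1, e2, e3, Real.logb] at h2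
  calc √p * √q * (Real.log (p + ε) - Real.log (q + ε))
      ≤ √p * √q * Real.log (p / q) := mul_le_mul_of_nonneg_left h1 (by positivity)
    _ = 2 * (√p * √q / (p + q) * (Real.log (p / q) / Real.log 2)) * Real.log 2 / 2 * (p + q) := by
        field_simp
    _ ≤ _ := by gcongr

theorem sqrt_mul_abs_log_le {p q ε : ℝ} (hp : 0 < p) (hq : 0 < q) (hε : 0 ≤ ε) :
    √p * √q * |Real.log (p + ε) - Real.log (q + ε)| ≤
      alphaConst * Real.log 2 / 2 * (p + q) := by
  rcases abs_choice (Real.log (p + ε) - Real.log (q + ε)) with h | h <;> rw [h]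
  · exact sqrt_mul_log_le hp hq hε
  · rw [neg_sub, mul_comm (√p), add_comm p q]
    exact sqrt_mul_log_le hq hp hε

end Alpha

/- ### Concavity -/

section Concavity

/-- A concave function lies below its tangents. The shift by `ε` keeps the slope finite at y = 0,
where the entropy itself has a vertical tangent. -/
theorem negMulLog_shift_le {ε x y : ℝ} (hε : 0 < ε) (hx : 0 ≤ x) (hy : 0 ≤ y) :
    Real.negMulLog (x + ε) ≤
      Real.negMulLog (y + ε) + (-Real.log (y + ε) - 1) * (x - y) := by
  have hp : 0 < x + ε := by linarith
  have hq : 0 < y + ε := by linarith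
  have h := Real.log_le_sub_one_of_pos (div_pos hq hp)
  rw [Real.log_div hq.ne' hp.ne'] at h
  have h2 := mul_le_mul_of_nonneg_left h hp.le
  have e : (x + ε) * ((y + ε) / (x + ε) - 1) = y - x := by field_simp; ring
  rw [e] at h2
  simp only [Real.negMulLog]
  linarith

variable {n : Type*} [Fintype n] [DecidableEq n]

theorem sum_normSq_row_of_unitary {U : Matrix n n ℂ} (hU : U ∈ Matrix.unitaryGroup n ℂ) (k : n) :
    ∑ j, Complex.normSq (U k j) = 1 := by
  have h := congrFun (congrFun (Matrix.mem_unitaryGroup_iff.1 hU) k) k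
  simp only [Matrix.mul_apply, Matrix.star_apply, Matrix.one_apply_eq, RCLike.star_def,
    Complex.mul_conj] at h
  exact_mod_cast h

theorem sum_normSq_col_of_unitary {U : Matrix n n ℂ} (hU : U ∈ Matrix.unitaryGroup n ℂ) (j : n) :
    ∑ k, Complex.normSq (U k j) = 1 := by
  have h := sum_normSq_row_of_unitary (Unitary.star_mem hU) j
  simpa [Matrix.star_apply] using h

open scoped ComplexOrder in
/-- Klein's inequality for a function `g` below its tangents `g y + w y * (x - y)`. -/
theorem klein_inequality {A B : Matrix n n ℂ} (hA : A.PosSemidef) (hB : B.PosSemidef)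
    {g w : ℝ → ℝ} (hg : ∀ x y, 0 ≤ x → 0 ≤ y → g x ≤ g y + w y * (x - y)) :
    ∑ k, g (hA.1.eigenvalues k) ≤ ∑ k, (g (hB.1.eigenvalues k) + w (hB.1.eigenvalues k) *
      ((((hB.1.eigenvectorUnitary : Matrix n n ℂ)ᴴ * A * hB.1.eigenvectorUnitary) k k).re -
        hB.1.eigenvalues k)) := by
  set U := (hB.1.eigenvectorUnitary : Matrix n n ℂ) with hUdef
  set V := (hA.1.eigenvectorUnitary : Matrix n n ℂ) with hVdef
  have hU : U ∈ Matrix.unitaryGroup n ℂ := hB.1.eigenvectorUnitary.2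
  have hV : V ∈ Matrix.unitaryGroup n ℂ := hA.1.eigenvectorUnitary.2
  -- The squared moduli of the overlaps of the two eigenbases form a doubly stochastic matrix.
  -- Column sums spread `g` of the eigenvalues of `A` over pairs; row sums collect the tangent
  -- terms.
  set O : Matrix n n ℂ := Uᴴ * V with hO
  have hOu : O ∈ Matrix.unitaryGroup n ℂ := mul_mem (Unitary.star_mem hU) hV
  have hdiag : ∀ k, ((Uᴴ * A * U) k k).re =
      ∑ j, Complex.normSq (O k j) * hA.1.eigenvalues j := by
    intro k
    have h1 : A = V * Matrix.diagonal (fun i => (hA.1.eigenvalues i : ℂ)) * Vᴴ := by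
      have := hA.1.spectral_theorem
      rw [Unitary.conjStarAlgAut_apply] at this
      exact this
    have h2 : Uᴴ * A * U = O * Matrix.diagonal (fun i => (hA.1.eigenvalues i : ℂ)) * Oᴴ := by
      conv_lhs => rw [h1]
      simp only [hO, Matrix.conjTranspose_mul, Matrix.conjTranspose_conjTranspose, Matrix.mul_assoc]
    rw [h2, Matrix.mul_apply, Complex.re_sum]
    refine Finset.sum_congr rfl fun j _ => ?_
    rw [Matrix.mul_diagonal, Matrix.conjTranspose_apply, mul_right_comm,
      show star (O k j) = (starRingEnd ℂ) (O k j) from rfl, Complex.mul_conj, ← Complex.ofReal_mul, Complex.ofReal_re]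
  calc ∑ j, g (hA.1.eigenvalues j)
      = ∑ j, ∑ k, Complex.normSq (O k j) * g (hA.1.eigenvalues j) := by
        refine Finset.sum_congr rfl fun j _ => ?_
        rw [← Finset.sum_mul, sum_normSq_col_of_unitary hOu, one_mul]
    _ ≤ ∑ j, ∑ k, Complex.normSq (O k j) * (g (hB.1.eigenvalues k) + w (hB.1.eigenvalues k) *
          (hA.1.eigenvalues j - hB.1.eigenvalues k)) := by
        refine Finset.sum_le_sum fun j _ => Finset.sum_le_sum fun k _ => ?_
        exact mul_le_mul_of_nonneg_left
          (hg _ _ (hA.eigenvalues_nonneg j) (hB.eigenvalues_nonneg k)) (Complex.normSq_nonneg _)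
    _ = _ := by
        rw [Finset.sum_comm]
        refine Finset.sum_congr rfl fun k _ => ?_
        rw [hdiag k]
        have h3 := sum_normSq_row_of_unitary hOu k
        calc ∑ j, Complex.normSq (O k j) * (g (hB.1.eigenvalues k) + w (hB.1.eigenvalues k) *
              (hA.1.eigenvalues j - hB.1.eigenvalues k))
            = (∑ j, Complex.normSq (O k j)) * (g (hB.1.eigenvalues k) -
                w (hB.1.eigenvalues k) * hB.1.eigenvalues k) + w (hB.1.eigenvalues k) *
                ∑ j, Complex.normSq (O k j) * hA.1.eigenvalues j := by
              rw [Finset.sum_mul, Finset.mul_sum, ← Finset.sum_add_distrib]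
              exact Finset.sum_congr rfl fun j _ => by ring
          _ = _ := by rw [h3]; ring

end Concavity

/- ### The rate of entanglement generation -/

section Rate

variable {α β : Type*} [Fintype α] [DecidableEq α] [Fintype β] [DecidableEq β]

/-- The eigenvector matrix of Alice's reduced state. -/
def schmidtBasis (ψ : α × β → ℂ) : Matrix α α ℂ := (reducedState_isHermitian ψ).eigenvectorUnitary

theorem schmidtBasis_mem (ψ : α × β → ℂ) : schmidtBasis ψ ∈ Matrix.unitaryGroup α ℂ :=
  (reducedState_isHermitian ψ).eigenvectorUnitary.2

/-- The squared Schmidt coefficients. -/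
def schmidtCoeff (ψ : α × β → ℂ) (k : α) : ℝ := (reducedState_isHermitian ψ).eigenvalues k

/-- The coefficients of `φ` when Alice's basis is the Schmidt basis of `ψ`. -/
def schmidtRows (ψ φ : α × β → ℂ) : Matrix α β ℂ := (schmidtBasis ψ)ᴴ * coeffMatrix φ

theorem schmidtRows_mul_conjTranspose (ψ : α × β → ℂ) :
    schmidtRows ψ ψ * (schmidtRows ψ ψ)ᴴ =
      Matrix.diagonal fun k => (schmidtCoeff ψ k : ℂ) := by
  have h := (reducedState_isHermitian ψ).spectral_theorem
  rw [Unitary.conjStarAlgAut_apply] at h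
  have hU := Matrix.mem_unitaryGroup_iff'.1 (schmidtBasis_mem ψ)
  rw [Matrix.star_eq_conjTranspose] at hU
  have e : schmidtRows ψ ψ * (schmidtRows ψ ψ)ᴴ =
      (schmidtBasis ψ)ᴴ * reducedState ψ * schmidtBasis ψ := by
    simp only [schmidtRows, reducedState, Matrix.conjTranspose_mul,
      Matrix.conjTranspose_conjTranspose, Matrix.mul_assoc]
  have h' : reducedState ψ = schmidtBasis ψ * Matrix.diagonal (fun k => (schmidtCoeff ψ k : ℂ)) *
      (schmidtBasis ψ)ᴴ := h
  rw [e, h', Matrix.mul_assoc, Matrix.mul_assoc, Matrix.mul_assoc, hU, Matrix.mul_one,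
    ← Matrix.mul_assoc, hU, Matrix.one_mul]

theorem sum_schmidtCoeff {ψ : α × β → ℂ} (hψ : ‖WithLp.toLp 2 ψ‖ = 1) :
    ∑ k, schmidtCoeff ψ k = 1 := by
  have := sum_schmidt_eq_norm_sq ψ
  rw [hψ, one_pow] at this
  exact this

/-- The derivative of `∑ k, w k * p k`, where `p k` is the weight of the evolving state in the
`k`-th vector of the Schmidt basis of `ψ`. -/
def rateForm (ψ : α × β → ℂ) (w : α → ℝ) (G : Matrix (α × β) (α × β) ℂ) : ℝ :=
  ∑ k, w k * (2 * (∑ y, star (schmidtRows ψ ψ k y) * schmidtRows ψ (G *ᵥ ψ) k y).im)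

theorem rateForm_add (ψ : α × β → ℂ) (w : α → ℝ) (G G' : Matrix (α × β) (α × β) ℂ) :
    rateForm ψ w (G + G') = rateForm ψ w G + rateForm ψ w G' := by
  have h : ∀ k y, schmidtRows ψ ((G + G') *ᵥ ψ) k y =
      schmidtRows ψ (G *ᵥ ψ) k y + schmidtRows ψ (G' *ᵥ ψ) k y := by
    intro k y
    rw [Matrix.add_mulVec, ← Matrix.add_apply, schmidtRows, schmidtRows, schmidtRows,
      ← Matrix.mul_add]
    rfl
  simp only [rateForm, h, mul_add, Finset.sum_add_distrib, Complex.add_im]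

/-- The operator `X` of Alice in the Schmidt basis. -/
def schmidtConj (ψ : α × β → ℂ) (X : Matrix α α ℂ) : Matrix α α ℂ :=
  (schmidtBasis ψ)ᴴ * X * schmidtBasis ψ

/-- The matrix elements of Bob's operator `Y` between his (unnormalised) Schmidt vectors. -/
def schmidtGram (ψ : α × β → ℂ) (Y : Matrix β β ℂ) : Matrix α α ℂ :=
  (schmidtRows ψ ψ)ᵀᴴ * Y * (schmidtRows ψ ψ)ᵀ

theorem schmidtConj_isHermitian (ψ : α × β → ℂ) {X : Matrix α α ℂ} (hX : X.IsHermitian) :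
    (schmidtConj ψ X).IsHermitian := Matrix.isHermitian_conjTranspose_mul_mul _ hX

theorem schmidtGram_isHermitian (ψ : α × β → ℂ) {Y : Matrix β β ℂ} (hY : Y.IsHermitian) :
    (schmidtGram ψ Y).IsHermitian := Matrix.isHermitian_conjTranspose_mul_mul _ hY

theorem schmidtConj_one (ψ : α × β → ℂ) : schmidtConj ψ 1 = 1 := by
  have hU := Matrix.mem_unitaryGroup_iff'.1 (schmidtBasis_mem ψ)
  rwa [Matrix.star_eq_conjTranspose, ← Matrix.mul_one (schmidtBasis ψ)ᴴ] at hU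

theorem schmidtGram_one (ψ : α × β → ℂ) :
    schmidtGram ψ 1 = Matrix.diagonal fun k => (schmidtCoeff ψ k : ℂ) := by
  have h := congrArg Matrix.transpose (schmidtRows_mul_conjTranspose ψ)
  rw [Matrix.transpose_mul, Matrix.diagonal_transpose] at h
  rw [schmidtGram, Matrix.mul_one]
  exact h

/-- Both matrices in the sum are Hermitian, so the imaginary part is antisymmetric in (k, j). The
factor 2 in `rateForm` is thus traded for a difference of weights. -/
theorem rateForm_kronecker (ψ : α × β → ℂ) (w : α → ℝ) {X : Matrix α α ℂ} {Y : Matrix β β ℂ}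
    (hX : X.IsHermitian) (hY : Y.IsHermitian) :
    rateForm ψ w (X ⊗ₖ Y) =
      ∑ k, ∑ j, (w k - w j) * (schmidtConj ψ X k j * schmidtGram ψ Y k j).im := by
  have hrows : schmidtRows ψ ((X ⊗ₖ Y) *ᵥ ψ) = schmidtConj ψ X * (schmidtRows ψ ψ * Yᵀ) := by
    have hU := Matrix.mem_unitaryGroup_iff.1 (schmidtBasis_mem ψ)
    rw [Matrix.star_eq_conjTranspose] at hU
    rw [schmidtRows, coeffMatrix_kronecker_mulVec, schmidtConj, schmidtRows]
    simp only [Matrix.mul_assoc]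
    rw [← Matrix.mul_assoc (schmidtBasis ψ) (schmidtBasis ψ)ᴴ, hU, Matrix.one_mul]
  have hgram : ∀ k j, schmidtGram ψ Y k j =
      ∑ y, star (schmidtRows ψ ψ k y) * (schmidtRows ψ ψ * Yᵀ) j y := by
    intro k j
    rw [schmidtGram, Matrix.mul_assoc, Matrix.mul_apply]
    refine Finset.sum_congr rfl fun y _ => ?_
    rw [← Matrix.transpose_apply (schmidtRows ψ ψ * Yᵀ), Matrix.transpose_mul,
      Matrix.transpose_transpose]
    rfl
  have hinner : ∀ k, (∑ y, star (schmidtRows ψ ψ k y) * schmidtRows ψ ((X ⊗ₖ Y) *ᵥ ψ) k y) =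
      ∑ j, schmidtConj ψ X k j * schmidtGram ψ Y k j := by
    intro k
    simp only [hrows, hgram, Matrix.mul_apply (M := schmidtConj ψ X), Finset.mul_sum]
    rw [Finset.sum_comm]
    exact Finset.sum_congr rfl fun j _ => Finset.sum_congr rfl fun y _ => by ring
  have hanti : ∀ k j, (schmidtConj ψ X k j * schmidtGram ψ Y k j).im =
      -(schmidtConj ψ X j k * schmidtGram ψ Y j k).im := by
    intro k j
    rw [← (schmidtConj_isHermitian ψ hX).apply k j, ← (schmidtGram_isHermitian ψ hY).apply k j,
      ← star_mul', RCLike.star_def, Complex.conj_im]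
  have hswap : ∑ k, ∑ j, w j * (schmidtConj ψ X k j * schmidtGram ψ Y k j).im =
      -∑ k, ∑ j, w k * (schmidtConj ψ X k j * schmidtGram ψ Y k j).im := by
    rw [Finset.sum_comm]
    simp only [← Finset.sum_neg_distrib]
    exact Finset.sum_congr rfl fun k _ => Finset.sum_congr rfl fun j _ => by rw [hanti]; ring
  simp only [rateForm, hinner, sub_mul, Finset.sum_sub_distrib, hswap, Complex.im_sum]
  rw [sub_neg_eq_add, ← Finset.sum_add_distrib]
  refine Finset.sum_congr rfl fun k _ => ?_
  rw [← Finset.mul_sum]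
  ring

/-- Bob's Schmidt vectors are orthogonal, so only k = j contributes, where the weight difference
vanishes. -/
theorem rateForm_alice (ψ : α × β → ℂ) (w : α → ℝ) {X : Matrix α α ℂ} (hX : X.IsHermitian) :
    rateForm ψ w (X ⊗ₖ (1 : Matrix β β ℂ)) = 0 := by
  rw [rateForm_kronecker ψ w hX Matrix.isHermitian_one, schmidtGram_one]
  refine Finset.sum_eq_zero fun k _ => Finset.sum_eq_zero fun j _ => ?_
  by_cases h : k = j
  · simp [h]
  · simp [Matrix.diagonal_apply_ne _ h]

theorem rateForm_bob (ψ : α × β → ℂ) (w : α → ℝ) {Y : Matrix β β ℂ} (hY : Y.IsHermitian) :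
    rateForm ψ w ((1 : Matrix α α ℂ) ⊗ₖ Y) = 0 := by
  rw [rateForm_kronecker ψ w Matrix.isHermitian_one hY, schmidtConj_one]
  refine Finset.sum_eq_zero fun k _ => Finset.sum_eq_zero fun j _ => ?_
  by_cases h : k = j
  · simp [h]
  · simp [Matrix.one_apply_ne h]

open scoped Matrix.Norms.L2Operator

theorem sum_norm_sq_row_le (A : Matrix α α ℂ) (k : α) : ∑ j, ‖A k j‖ ^ 2 ≤ ‖A‖ ^ 2 := by
  have h := norm_mulVec_le Aᴴ (Pi.single k (1 : ℂ))
  rw [Matrix.l2_opNorm_conjTranspose] at h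
  have h1 : ‖WithLp.toLp 2 (Pi.single k (1 : ℂ) : α → ℂ)‖ = 1 := by
    simp
  rw [h1, mul_one] at h
  have h2 := pow_le_pow_left₀ (norm_nonneg _) h 2
  rw [EuclideanSpace.norm_sq_eq] at h2
  simpa using h2

theorem norm_le_one_of_conjTranspose_mul_self {R : Matrix β α ℂ} {d : α → ℂ}
    (hR : Rᴴ * R = Matrix.diagonal d) (hd : ∀ k, ‖d k‖ ≤ 1) : ‖R‖ ≤ 1 := by
  have h := Matrix.l2_opNorm_conjTranspose_mul_self R
  rw [hR, Matrix.l2_opNorm_diagonal] at h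
  have h1 : ‖d‖ ≤ 1 := (pi_norm_le_iff_of_nonneg zero_le_one).2 hd
  nlinarith [norm_nonneg R]

/-- `W` is `Y` compressed to Bob's normalised Schmidt vectors. Dividing by the square roots of the
Schmidt weights leaves columns that are orthonormal, or zero where the weight is zero because the
inverse of 0 is 0; hence `N * D` is a contraction. -/
theorem exists_normalized_schmidtGram (ψ : α × β → ℂ) (Y : Matrix β β ℂ) :
    ∃ W : Matrix α α ℂ, ‖W‖ ≤ ‖Y‖ ∧ ∀ k j, ‖schmidtGram ψ Y k j‖ =
      √(schmidtCoeff ψ k) * √(schmidtCoeff ψ j) * ‖W k j‖ := by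
  set N := (schmidtRows ψ ψ)ᵀ with hN
  set D : Matrix α α ℂ := Matrix.diagonal fun k => (((√(schmidtCoeff ψ k))⁻¹ : ℝ) : ℂ) with hD
  have hNN : Nᴴ * N = Matrix.diagonal fun k => (schmidtCoeff ψ k : ℂ) := by
    rw [← schmidtGram_one ψ, schmidtGram, Matrix.mul_one]
  have hDh : Dᴴ = D := by
    rw [hD, Matrix.diagonal_conjTranspose]
    congr 1
    funext k
    simp
  have hnn : ∀ k, 0 ≤ schmidtCoeff ψ k := schmidt_nonneg ψ
  have hR : ‖N * D‖ ≤ 1 := by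
    refine norm_le_one_of_conjTranspose_mul_self (d := fun k =>
      (((√(schmidtCoeff ψ k))⁻¹ * (schmidtCoeff ψ k * (√(schmidtCoeff ψ k))⁻¹) : ℝ) : ℂ)) ?_ ?_
    · rw [Matrix.conjTranspose_mul, hDh, Matrix.mul_assoc, ← Matrix.mul_assoc Nᴴ, hNN, hD,
        Matrix.diagonal_mul_diagonal, Matrix.diagonal_mul_diagonal]
      push_cast
      rfl
    · intro k
      rw [Complex.norm_real, Real.norm_eq_abs]
      by_cases h0 : schmidtCoeff ψ k = 0
      · simp [h0]
      · have hpos : 0 < √(schmidtCoeff ψ k) := Real.sqrt_pos.2 (lt_of_le_of_ne (hnn k) (Ne.symm h0))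
        have : (√(schmidtCoeff ψ k))⁻¹ * (schmidtCoeff ψ k * (√(schmidtCoeff ψ k))⁻¹) = 1 := by
          nth_rw 2 [← Real.mul_self_sqrt (hnn k)]
          field_simp
        rw [this, abs_one]
  refine ⟨(N * D)ᴴ * Y * (N * D), ?_, fun k j => ?_⟩
  · refine (Matrix.l2_opNorm_mul _ _).trans ?_
    refine (mul_le_mul_of_nonneg_right (Matrix.l2_opNorm_mul _ _) (norm_nonneg _)).trans ?_
    rw [Matrix.l2_opNorm_conjTranspose]
    calc ‖N * D‖ * ‖Y‖ * ‖N * D‖ ≤ 1 * ‖Y‖ * 1 := by gcongr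
      _ = ‖Y‖ := by ring
  · have e : (N * D)ᴴ * Y * (N * D) = D * schmidtGram ψ Y * D := by
      rw [Matrix.conjTranspose_mul, hDh, schmidtGram]
      simp only [Matrix.mul_assoc, hN]
    -- A vanishing Schmidt weight means a vanishing column, so both sides are zero in the cases
    -- where dividing by the weight loses information.
    have hcol : ∀ l, schmidtCoeff ψ l = 0 → ∀ y, N y l = 0 := by
      intro l hl y
      have h := congrFun (congrFun hNN l) l
      rw [Matrix.diagonal_apply_eq, hl, Matrix.mul_apply] at h
      simp only [Matrix.conjTranspose_apply, RCLike.star_def, Complex.conj_mul'] at h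
      have h' : ∑ x, ‖N x l‖ ^ 2 = 0 := by exact_mod_cast h
      have := (Finset.sum_eq_zero_iff_of_nonneg fun x _ => sq_nonneg ‖N x l‖).1 h' y
        (Finset.mem_univ _)
      simpa using this
    rw [e, hD, Matrix.mul_diagonal, Matrix.diagonal_mul, norm_mul, norm_mul, Complex.norm_real,
      Complex.norm_real, Real.norm_of_nonneg (by positivity), Real.norm_of_nonneg (by positivity)]
    by_cases hk : schmidtCoeff ψ k = 0
    · have : schmidtGram ψ Y k j = 0 := by
        rw [schmidtGram, Matrix.mul_assoc, Matrix.mul_apply]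
        refine Finset.sum_eq_zero fun y _ => ?_
        rw [Matrix.conjTranspose_apply, show (schmidtRows ψ ψ)ᵀ y k = 0 from hcol k hk y]
        simp
      simp [this]
    by_cases hj : schmidtCoeff ψ j = 0
    · have : schmidtGram ψ Y k j = 0 := by
        rw [schmidtGram, Matrix.mul_apply]
        refine Finset.sum_eq_zero fun y _ => ?_
        rw [show (schmidtRows ψ ψ)ᵀ y j = 0 from hcol j hj y]
        simp
      simp [this]
    have hk' : √(schmidtCoeff ψ k) ≠ 0 :=
      (Real.sqrt_pos.2 (lt_of_le_of_ne (hnn k) (Ne.symm hk))).ne'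
    have hj' : √(schmidtCoeff ψ j) ≠ 0 :=
      (Real.sqrt_pos.2 (lt_of_le_of_ne (hnn j) (Ne.symm hj))).ne'
    field_simp

/-- The factor √λ_k √λ_j from Bob's vectors tames the difference of logarithms: together they are at
most c (λ_k + λ_j). By Cauchy–Schwarz the products ‖A k j‖ ‖W k j‖ sum to at most x y along every
row and every column. As the λ_k sum to 1, the total is 2 c x y, with c = α log 2 / 2. -/
theorem rateForm_kronecker_le {ψ : α × β → ℂ} (hψ : ‖WithLp.toLp 2 ψ‖ = 1) {ε : ℝ} (hε : 0 < ε)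
    {X : Matrix α α ℂ} {Y : Matrix β β ℂ} (hX : X.IsHermitian) (hY : Y.IsHermitian) {x y : ℝ}
    (hx : ‖X‖ ≤ x) (hy : ‖Y‖ ≤ y) :
    rateForm ψ (fun k => -Real.log (schmidtCoeff ψ k + ε) - 1) (X ⊗ₖ Y) ≤
      alphaConst * (x * y) * Real.log 2 := by
  obtain ⟨W, hW, hWe⟩ := exists_normalized_schmidtGram ψ Y
  set lam := schmidtCoeff ψ with hlam
  set A := schmidtConj ψ X with hA
  set c := alphaConst * Real.log 2 / 2 with hc
  have hc0 : 0 ≤ c := by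
    have := alphaConst_pos
    have : 0 < Real.log 2 := Real.log_pos (by norm_num)
    positivity
  have hnn : ∀ k, 0 ≤ lam k := schmidt_nonneg ψ
  have hAx : ‖A‖ ≤ x := by
    have hU := norm_le_one_of_mem_unitary (schmidtBasis_mem ψ)
    calc ‖A‖ ≤ ‖(schmidtBasis ψ)ᴴ‖ * ‖X‖ * ‖schmidtBasis ψ‖ :=
          (Matrix.l2_opNorm_mul _ _).trans
            (mul_le_mul_of_nonneg_right (Matrix.l2_opNorm_mul _ _) (norm_nonneg _))
      _ ≤ 1 * ‖X‖ * 1 := by rw [Matrix.l2_opNorm_conjTranspose]; gcongr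
      _ ≤ x := by simpa using hx
  have hWy : ‖W‖ ≤ y := hW.trans hy
  have hx0 : 0 ≤ x := (norm_nonneg _).trans hx
  have hy0 : 0 ≤ y := (norm_nonneg _).trans hy
  have hterm : ∀ k j, ((-Real.log (lam k + ε) - 1) - (-Real.log (lam j + ε) - 1)) *
      (A k j * schmidtGram ψ Y k j).im ≤ c * (lam k + lam j) * (‖A k j‖ * ‖W k j‖) := by
    intro k j
    have h1 : |(A k j * schmidtGram ψ Y k j).im| ≤ ‖A k j‖ * (√(lam k) * √(lam j) * ‖W k j‖) := by
      rw [← hWe, ← norm_mul]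
      exact Complex.abs_im_le_norm _
    refine (le_abs_self _).trans ?_
    rw [abs_mul, show (-Real.log (lam k + ε) - 1) - (-Real.log (lam j + ε) - 1) =
      -(Real.log (lam k + ε) - Real.log (lam j + ε)) by ring, abs_neg]
    have h2 : √(lam k) * √(lam j) * |Real.log (lam k + ε) - Real.log (lam j + ε)| ≤
        c * (lam k + lam j) := by
      rcases (hnn k).eq_or_lt with h | h
      · rw [← h]; simpa using mul_nonneg hc0 (hnn j)
      rcases (hnn j).eq_or_lt with h' | h'
      · rw [← h']; simpa using mul_nonneg hc0 (hnn k)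
      exact sqrt_mul_abs_log_le h h' hε.le
    calc |Real.log (lam k + ε) - Real.log (lam j + ε)| * |(A k j * schmidtGram ψ Y k j).im|
        ≤ |Real.log (lam k + ε) - Real.log (lam j + ε)| *
            (‖A k j‖ * (√(lam k) * √(lam j) * ‖W k j‖)) := by gcongr
      _ = (√(lam k) * √(lam j) * |Real.log (lam k + ε) - Real.log (lam j + ε)|) *
            (‖A k j‖ * ‖W k j‖) := by ring
      _ ≤ _ := by gcongr
  have hrow : ∀ k, ∑ j, ‖A k j‖ * ‖W k j‖ ≤ x * y := by
    intro k
    refine (Real.sum_mul_le_sqrt_mul_sqrt Finset.univ _ _).trans ?_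
    refine mul_le_mul ?_ ?_ (Real.sqrt_nonneg _) hx0
    · exact Real.sqrt_le_iff.2 ⟨hx0, (sum_norm_sq_row_le A k).trans (by gcongr)⟩
    · exact Real.sqrt_le_iff.2 ⟨hy0, (sum_norm_sq_row_le W k).trans (by gcongr)⟩
  have hcol : ∀ j, ∑ k, ‖A k j‖ * ‖W k j‖ ≤ x * y := by
    intro j
    have e : ∀ B : Matrix α α ℂ, ∀ k, ‖B k j‖ = ‖Bᴴ j k‖ := by intro B k; simp
    simp only [e]
    refine (Real.sum_mul_le_sqrt_mul_sqrt Finset.univ _ _).trans ?_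
    refine mul_le_mul ?_ ?_ (Real.sqrt_nonneg _) hx0
    · refine Real.sqrt_le_iff.2 ⟨hx0, (sum_norm_sq_row_le Aᴴ j).trans ?_⟩
      rw [Matrix.l2_opNorm_conjTranspose]
      gcongr
    · refine Real.sqrt_le_iff.2 ⟨hy0, (sum_norm_sq_row_le Wᴴ j).trans ?_⟩
      rw [Matrix.l2_opNorm_conjTranspose]
      gcongr
  rw [rateForm_kronecker ψ _ hX hY]
  calc _ ≤ ∑ k, ∑ j, c * (lam k + lam j) * (‖A k j‖ * ‖W k j‖) :=
        Finset.sum_le_sum fun k _ => Finset.sum_le_sum fun j _ => hterm k j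
    _ = c * (∑ k, lam k * ∑ j, ‖A k j‖ * ‖W k j‖) + c * (∑ j, lam j * ∑ k, ‖A k j‖ * ‖W k j‖) := by
        have h1 : ∑ j, lam j * ∑ k, ‖A k j‖ * ‖W k j‖ =
            ∑ k, ∑ j, lam j * (‖A k j‖ * ‖W k j‖) := by
          simp only [Finset.mul_sum]
          exact Finset.sum_comm
        rw [h1]
        simp only [Finset.mul_sum, ← Finset.sum_add_distrib]
        exact Finset.sum_congr rfl fun k _ => Finset.sum_congr rfl fun j _ => by ring
    _ ≤ c * (∑ k, lam k * (x * y)) + c * (∑ j, lam j * (x * y)) := by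
        refine add_le_add (mul_le_mul_of_nonneg_left ?_ hc0) (mul_le_mul_of_nonneg_left ?_ hc0)
        · exact Finset.sum_le_sum fun k _ => mul_le_mul_of_nonneg_left (hrow k) (hnn k)
        · exact Finset.sum_le_sum fun k _ => mul_le_mul_of_nonneg_left (hcol k) (hnn k)
    _ = _ := by
        rw [← Finset.sum_mul, sum_schmidtCoeff hψ, hc]
        ring

end Rate

/-! ### From the instantaneous rate to finite times. -/

section Integrate

variable {α β : Type*} [Fintype α] [DecidableEq α] [Fintype β] [DecidableEq β]

/-- The weight of `φ` in the `k`-th vector of the Schmidt basis of `ψ`. -/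
def schmidtWeight (ψ φ : α × β → ℂ) (k : α) : ℝ := ∑ y, Complex.normSq (schmidtRows ψ φ k y)

theorem re_schmidtConj_reducedState (ψ φ : α × β → ℂ) (k : α) :
    (((schmidtBasis ψ)ᴴ * reducedState φ * schmidtBasis ψ) k k).re = schmidtWeight ψ φ k := by
  have e : (schmidtBasis ψ)ᴴ * reducedState φ * schmidtBasis ψ =
      schmidtRows ψ φ * (schmidtRows ψ φ)ᴴ := by
    simp only [schmidtRows, reducedState, Matrix.conjTranspose_mul,
      Matrix.conjTranspose_conjTranspose, Matrix.mul_assoc]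
  rw [e, Matrix.mul_apply, Complex.re_sum, schmidtWeight]
  refine Finset.sum_congr rfl fun y _ => ?_
  rw [Matrix.conjTranspose_apply, RCLike.star_def, Complex.mul_conj, Complex.ofReal_re]

theorem schmidtWeight_self (ψ : α × β → ℂ) (k : α) : schmidtWeight ψ ψ k = schmidtCoeff ψ k := by
  have h := congrFun (congrFun (schmidtRows_mul_conjTranspose ψ) k) k
  rw [Matrix.diagonal_apply_eq, Matrix.mul_apply] at h
  simp only [Matrix.conjTranspose_apply, RCLike.star_def, Complex.mul_conj] at h
  exact_mod_cast h

/-- The majorant is expressed in the fixed Schmidt basis of `ψ` and is exact at φ = ψ. It is smooth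
along an evolution, so no eigenvalue or eigenvector ever has to be differentiated. -/
theorem schmidtSum_shift_le {ε : ℝ} (hε : 0 < ε) (ψ φ : α × β → ℂ) :
    schmidtSum (fun x => Real.negMulLog (x + ε)) φ ≤
      schmidtSum (fun x => Real.negMulLog (x + ε)) ψ +
        ∑ k, (-Real.log (schmidtCoeff ψ k + ε) - 1) *
          (schmidtWeight ψ φ k - schmidtWeight ψ ψ k) := by
  have h := klein_inequality (reducedState_posSemidef φ) (reducedState_posSemidef ψ)
    (g := fun x => Real.negMulLog (x + ε)) (w := fun y => -Real.log (y + ε) - 1)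
    fun x y hx hy => negMulLog_shift_le hε hx hy
  rw [Finset.sum_add_distrib] at h
  refine h.trans (le_of_eq ?_)
  congr 1
  refine Finset.sum_congr rfl fun k _ => ?_
  rw [schmidtWeight_self, ← re_schmidtConj_reducedState]
  rfl

open scoped Matrix.Norms.L2Operator in
theorem hasDerivAt_schmidtRows (ψ χ : α × β → ℂ) (G : Matrix (α × β) (α × β) ℂ) (t : ℝ) (k : α)
    (y : β) :
    HasDerivAt (fun z : ℝ => schmidtRows ψ (evolution G z *ᵥ χ) k y)
      (-Complex.I * schmidtRows ψ (G *ᵥ (evolution G t *ᵥ χ)) k y) t := by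
  let ℓ : Matrix (α × β) (α × β) ℂ →ₗ[ℝ] ℂ :=
    { toFun := fun A => schmidtRows ψ (A *ᵥ χ) k y
      map_add' := fun A B => by
        rw [Matrix.add_mulVec, ← Matrix.add_apply, schmidtRows, schmidtRows, schmidtRows,
          ← Matrix.mul_add]
        rfl
      map_smul' := fun c A => by
        rw [Matrix.smul_mulVec, RingHom.id_apply, ← Matrix.smul_apply, schmidtRows, schmidtRows,
          ← Matrix.mul_smul]
        rfl }
  have h := ℓ.toContinuousLinearMap.hasFDerivAt.comp_hasDerivAt t (hasDerivAt_evolution G t)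
  refine h.congr_deriv ?_
  change schmidtRows ψ ((-(Complex.I • (G * evolution G t))) *ᵥ χ) k y = _
  rw [← smul_neg, ← Matrix.mul_neg, Matrix.smul_mulVec, Matrix.mul_neg, Matrix.neg_mulVec,
    ← Matrix.mulVec_mulVec, smul_neg, ← neg_smul]
  have : schmidtRows ψ ((-Complex.I) • G *ᵥ evolution G t *ᵥ χ) =
      (-Complex.I) • schmidtRows ψ (G *ᵥ evolution G t *ᵥ χ) := by
    rw [schmidtRows, schmidtRows, ← Matrix.mul_smul]
    rfl
  rw [this]
  rfl

theorem hasDerivAt_schmidtWeight (χ : α × β → ℂ) (G : Matrix (α × β) (α × β) ℂ) (t : ℝ) (k : α) :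
    HasDerivAt (fun z : ℝ => schmidtWeight (evolution G t *ᵥ χ) (evolution G z *ᵥ χ) k)
      (2 * (∑ y, star (schmidtRows (evolution G t *ᵥ χ) (evolution G t *ᵥ χ) k y) *
        schmidtRows (evolution G t *ᵥ χ) (G *ᵥ (evolution G t *ᵥ χ)) k y).im) t := by
  have h : ∀ y, HasDerivAt
      (fun z : ℝ => Complex.normSq (schmidtRows (evolution G t *ᵥ χ) (evolution G z *ᵥ χ) k y))
      (2 * (star (schmidtRows (evolution G t *ᵥ χ) (evolution G t *ᵥ χ) k y) *
        schmidtRows (evolution G t *ᵥ χ) (G *ᵥ (evolution G t *ᵥ χ)) k y).im) t := by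
    intro y
    have h1 := hasDerivAt_schmidtRows (evolution G t *ᵥ χ) χ G t k y
    have hre := Complex.reCLM.hasFDerivAt.comp_hasDerivAt t h1
    have him := Complex.imCLM.hasFDerivAt.comp_hasDerivAt t h1
    have h2 := (hre.mul hre).add (him.mul him)
    refine h2.congr_deriv ?_
    simp [Complex.mul_im, Complex.mul_re]
    ring
  have h3 := HasDerivAt.fun_sum (u := Finset.univ) fun y _ => h y
  refine h3.congr_deriv ?_
  rw [Complex.im_sum, Finset.mul_sum]

/-- At each time the increment of the shifted entropy is at most that of the function `V`, built
from the Schmidt basis frozen at that time and having derivative `rateForm`. So right slopes are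
eventually below any r > C, and a continuous function with such slopes stays below the line of slope
C. -/
theorem schmidtSum_shift_evolution_le {G : Matrix (α × β) (α × β) ℂ} (hG : G.IsHermitian)
    {ε C : ℝ} (hε : 0 < ε)
    (h : ∀ ψ : α × β → ℂ, ‖WithLp.toLp 2 ψ‖ = 1 →
      rateForm ψ (fun k => -Real.log (schmidtCoeff ψ k + ε) - 1) G ≤ C)
    {ψ : α × β → ℂ} (hψ : ‖WithLp.toLp 2 ψ‖ = 1) {t : ℝ} (ht : 0 ≤ t) :
    schmidtSum (fun x => Real.negMulLog (x + ε)) (evolution G t *ᵥ ψ) ≤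
      schmidtSum (fun x => Real.negMulLog (x + ε)) ψ + C * t := by
  set f : ℝ → ℝ := fun z =>
    schmidtSum (fun x => Real.negMulLog (x + ε)) (evolution G z *ᵥ ψ) with hf
  have hcont : Continuous f := by
    have h1 : Continuous fun x : ℝ => Real.negMulLog (x + ε) :=
      Real.continuous_negMulLog.comp (continuous_id.add continuous_const)
    exact (continuous_schmidtSum h1).comp
      ((continuous_evolution G).matrix_mulVec continuous_const)
  have key := image_le_of_liminf_slope_right_le_deriv_boundary (f := f) (a := 0) (b := t)
    hcont.continuousOn (B := fun z => f 0 + C * z) (B' := fun _ => C) (by simp)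
    (by fun_prop) (fun x _ => by
      simpa using (((hasDerivAt_id x).const_mul C).const_add (f 0)).hasDerivWithinAt) ?_
  · have := key (Set.right_mem_Icc.2 ht)
    simpa [hf] using this
  · intro x _ r hr
    apply Filter.Eventually.frequently
    set φ := evolution G x *ᵥ ψ with hφ
    have hφ1 : ‖WithLp.toLp 2 φ‖ = 1 := by
      rw [hφ, norm_unitary_mulVec (evolution_mem_unitary hG x), hψ]
    set V : ℝ → ℝ := fun z => ∑ k, (-Real.log (schmidtCoeff φ k + ε) - 1) *
      schmidtWeight φ (evolution G z *ᵥ ψ) k with hV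
    have hd : HasDerivAt V
        (rateForm φ (fun k => -Real.log (schmidtCoeff φ k + ε) - 1) G) x :=
      HasDerivAt.fun_sum fun k _ => (hasDerivAt_schmidtWeight ψ G x k).const_mul _
    have hlt := (h φ hφ1).trans_lt hr
    have hev : ∀ᶠ z in nhdsWithin x (Set.Ioi x), slope V x z < r := by
      have h1 := hd.hasDerivWithinAt (s := Set.Ioi x)
      rw [hasDerivWithinAt_iff_tendsto_slope' (by simp)] at h1
      exact h1.eventually_lt_const hlt
    filter_upwards [hev, self_mem_nhdsWithin] with z hz hxz
    refine lt_of_le_of_lt ?_ hz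
    have hxz' : 0 < z - x := sub_pos.2 hxz
    rw [slope_def_field, slope_def_field]
    apply div_le_div_of_nonneg_right _ hxz'.le
    have h2 := schmidtSum_shift_le hε φ (evolution G z *ᵥ ψ)
    have e : V z - V x = ∑ k, (-Real.log (schmidtCoeff φ k + ε) - 1) *
          (schmidtWeight φ (evolution G z *ᵥ ψ) k - schmidtWeight φ φ k) := by
      simp only [hV, mul_sub, Finset.sum_sub_distrib, hφ]
    rw [e]
    simp only [hf, ← hφ]
    linarith

/-- Integration of a bound on the instantaneous rate of entanglement generation. -/
theorem entanglement_evolution_le {G : Matrix (α × β) (α × β) ℂ} (hG : G.IsHermitian) {C : ℝ}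
    (h : ∀ ε : ℝ, 0 < ε → ∀ ψ : α × β → ℂ, ‖WithLp.toLp 2 ψ‖ = 1 →
      rateForm ψ (fun k => -Real.log (schmidtCoeff ψ k + ε) - 1) G ≤ C * Real.log 2)
    {ψ : α × β → ℂ} (hψ : ‖WithLp.toLp 2 ψ‖ = 1) {t : ℝ} (ht : 0 ≤ t) :
    entanglement (evolution G t *ᵥ ψ) ≤ entanglement ψ + C * t := by
  have hl : 0 < Real.log 2 := Real.log_pos (by norm_num)
  have hlim : ∀ φ : α × β → ℂ, Filter.Tendsto
      (fun ε : ℝ => schmidtSum (fun x => Real.negMulLog (x + ε)) φ) (nhdsWithin 0 (Set.Ioi 0))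
      (nhds (schmidtSum Real.negMulLog φ)) := by
    intro φ
    have hc : Continuous fun ε : ℝ => schmidtSum (fun x => Real.negMulLog (x + ε)) φ := by
      unfold schmidtSum
      exact continuous_finsetSum _ fun k _ =>
        Real.continuous_negMulLog.comp (continuous_const.add continuous_id)
    have := hc.tendsto 0
    simp only [add_zero] at this
    exact this.mono_left nhdsWithin_le_nhds
  -- The bound on the rate is uniform in `ε`, so the regularisation can be removed by letting `ε`
  -- tend to 0.
  have key : schmidtSum Real.negMulLog (evolution G t *ᵥ ψ) ≤
      schmidtSum Real.negMulLog ψ + C * Real.log 2 * t := by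
    refine le_of_tendsto_of_tendsto (hlim _) ((hlim ψ).add_const _) ?_
    filter_upwards [self_mem_nhdsWithin] with ε hε
    exact schmidtSum_shift_evolution_le hG hε (h ε hε) hψ ht
  rw [entanglement_eq_schmidtSum, entanglement_eq_schmidtSum, div_add' _ _ _ hl.ne']
  apply div_le_div_of_nonneg_right _ hl.le
  linarith

end Integrate

/- ### Upper bounds on entanglement generation -/

section GainBound

variable {a b : Type*} [Fintype a] [DecidableEq a] [Fintype b] [DecidableEq b]

/-- No protocol generates more than `C` ebits per unit of time. -/
def GainBound (H : Matrix (a × b) (a × b) ℂ) (C : ℝ) : Prop :=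
  ∀ (m n : ℕ) (ψ : (a × Fin m) × (b × Fin n) → ℂ) (P : List (Step a b (Fin m) (Fin n))),
    ‖WithLp.toLp 2 ψ‖ = 1 →
      entanglement (protocolOperator H P *ᵥ ψ) ≤ entanglement ψ + C * duration P

theorem entanglement_protocol_le {r s : Type*} [Fintype r] [DecidableEq r] [Fintype s]
    [DecidableEq s] {H : Matrix (a × b) (a × b) ℂ} (hH : H.IsHermitian) {C : ℝ}
    (h : ∀ ψ : (a × r) × (b × s) → ℂ, ‖WithLp.toLp 2 ψ‖ = 1 → ∀ t : ℝ, 0 ≤ t →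
      entanglement (evolution (withAncillas r s H) t *ᵥ ψ) ≤ entanglement ψ + C * t)
    (P : List (Step a b r s)) {ψ : (a × r) × (b × s) → ℂ} (hψ : ‖WithLp.toLp 2 ψ‖ = 1) :
    entanglement (protocolOperator H P *ᵥ ψ) ≤ entanglement ψ + C * duration P := by
  induction P with
  | nil => simp
  | cons p P ih =>
    rw [protocolOperator_cons, ← Matrix.mulVec_mulVec, Step.operator, ← Matrix.mulVec_mulVec,
      entanglement_local_unitary p.alice.2 p.bob.2, duration_cons]
    have h1 := h (protocolOperator H P *ᵥ ψ)
      (by rw [norm_unitary_mulVec (protocolOperator_mem_unitary hH P), hψ]) p.time p.time.2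
    linarith

theorem withAncillas_kronecker {r s : Type*} [Fintype r] [DecidableEq r] [Fintype s]
    [DecidableEq s] (X : Matrix a a ℂ) (Y : Matrix b b ℂ) :
    withAncillas r s (X ⊗ₖ Y) =
      ampliate (Equiv.refl (a × r)) X ⊗ₖ ampliate (Equiv.refl (b × s)) Y := by
  ext x y
  simp only [withAncillas_eq_ampliate, ampliate_apply, Matrix.kroneckerMap_apply,
    Equiv.prodProdProdComm_apply, Equiv.refl_apply, Prod.mk.injEq]
  split_ifs <;> simp_all

open scoped Matrix.Norms.L2Operator

theorem norm_ampliate_le {n m k : Type*} [Fintype n] [DecidableEq n] [Fintype m] [DecidableEq m]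
    [Fintype k] [DecidableEq k] (e : n ≃ m × k) (A : Matrix m m ℂ) : ‖ampliate e A‖ ≤ ‖A‖ := by
  rw [Matrix.l2_opNorm_def]
  refine ContinuousLinearMap.opNorm_le_bound _ (norm_nonneg _) fun x => ?_
  rw [← sq_le_sq₀ (norm_nonneg _) (by positivity), mul_pow, EuclideanSpace.norm_sq_eq,
    EuclideanSpace.norm_sq_eq, ← e.symm.sum_comp, ← e.symm.sum_comp, Fintype.sum_prod_type_right,
    Fintype.sum_prod_type_right, Finset.mul_sum]
  refine Finset.sum_le_sum fun u _ => ?_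
  have h := norm_mulVec_le A (fun i => x.ofLp (e.symm (i, u)))
  have h2 := pow_le_pow_left₀ (norm_nonneg _) h 2
  rw [mul_pow, EuclideanSpace.norm_sq_eq, EuclideanSpace.norm_sq_eq] at h2
  refine le_trans (le_of_eq (Finset.sum_congr rfl fun i _ => ?_)) h2
  congr 2
  change (ampliate e A *ᵥ x.ofLp) (e.symm (i, u)) = _
  rw [ampliate_mulVec]
  simp

theorem isHermitian_ofReal_smul {n : Type*} {A : Matrix n n ℂ} (hA : A.IsHermitian) (κ : ℝ) :
    ((κ : ℂ) • A).IsHermitian := by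
  rw [Matrix.IsHermitian, Matrix.conjTranspose_smul, hA.eq, RCLike.star_def, Complex.conj_ofReal]

theorem isHermitian_kronecker {X : Matrix a a ℂ} {Y : Matrix b b ℂ} (hX : X.IsHermitian)
    (hY : Y.IsHermitian) : (X ⊗ₖ Y).IsHermitian := by
  rw [Matrix.IsHermitian, Matrix.conjTranspose_kronecker, hX.eq, hY.eq]

theorem rateForm_withAncillas_kronecker_le {r s : Type*} [Fintype r] [DecidableEq r] [Fintype s]
    [DecidableEq s] {X : Matrix a a ℂ} {Y : Matrix b b ℂ} (hX : X.IsHermitian) (hY : Y.IsHermitian)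
    {x y μ ν : ℝ} (hx : ‖X - (μ : ℂ) • 1‖ ≤ x) (hy : ‖Y - (ν : ℂ) • 1‖ ≤ y)
    {ψ : (a × r) × (b × s) → ℂ} (hψ : ‖WithLp.toLp 2 ψ‖ = 1) {ε : ℝ} (hε : 0 < ε) :
    rateForm ψ (fun k => -Real.log (schmidtCoeff ψ k + ε) - 1) (withAncillas r s (X ⊗ₖ Y)) ≤
      alphaConst * (x * y) * Real.log 2 := by
  have hX' : (X - (μ : ℂ) • 1).IsHermitian :=
    hX.sub (isHermitian_ofReal_smul Matrix.isHermitian_one μ)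
  have hY' : (Y - (ν : ℂ) • 1).IsHermitian :=
    hY.sub (isHermitian_ofReal_smul Matrix.isHermitian_one ν)
  -- Centring the factors changes the interaction by local terms only, and these do not contribute
  -- to the rate.
  have e : X ⊗ₖ Y = (X - (μ : ℂ) • 1) ⊗ₖ (Y - (ν : ℂ) • 1) +
      ((ν : ℂ) • (X - (μ : ℂ) • 1)) ⊗ₖ (1 : Matrix b b ℂ) +
      (1 : Matrix a a ℂ) ⊗ₖ ((μ : ℂ) • Y) := by
    ext i j
    simp only [Matrix.kroneckerMap_apply, Matrix.add_apply, Matrix.sub_apply, Matrix.smul_apply,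
      smul_eq_mul]
    ring
  rw [e, withAncillas_eq_ampliate, map_add, map_add, rateForm_add, rateForm_add,
    ← withAncillas_eq_ampliate, ← withAncillas_eq_ampliate, ← withAncillas_eq_ampliate,
    withAncillas_kronecker, withAncillas_kronecker, withAncillas_kronecker, map_one, map_one,
    rateForm_alice _ _ (ampliate_isHermitian _ (isHermitian_ofReal_smul hX' ν)),
    rateForm_bob _ _ (ampliate_isHermitian _ (isHermitian_ofReal_smul hY μ)), add_zero, add_zero]
  exact rateForm_kronecker_le hψ hε (ampliate_isHermitian _ hX')
    (ampliate_isHermitian _ hY') ((norm_ampliate_le _ _).trans hx)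
    ((norm_ampliate_le _ _).trans hy)

theorem gainBound_of_norm_le {JA GA : Matrix a a ℂ} {JB GB : Matrix b b ℂ}
    (hJA : JA.IsHermitian) (hGA : GA.IsHermitian) (hJB : JB.IsHermitian) (hGB : GB.IsHermitian)
    {μJ νJ μG νG xJ yJ xG yG : ℝ} (h1 : ‖JA - (μJ : ℂ) • 1‖ ≤ xJ) (h2 : ‖JB - (νJ : ℂ) • 1‖ ≤ yJ)
    (h3 : ‖GA - (μG : ℂ) • 1‖ ≤ xG) (h4 : ‖GB - (νG : ℂ) • 1‖ ≤ yG) :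
    GainBound (JA ⊗ₖ JB + GA ⊗ₖ GB) (alphaConst * (xJ * yJ + xG * yG)) := by
  have hH : (JA ⊗ₖ JB + GA ⊗ₖ GB).IsHermitian :=
    (isHermitian_kronecker hJA hJB).add (isHermitian_kronecker hGA hGB)
  intro m n ψ P hψ
  refine entanglement_protocol_le hH (fun φ hφ t ht => ?_) P hψ
  refine entanglement_evolution_le (withAncillas_isHermitian hH) (fun ε hε χ hχ => ?_) hφ ht
  rw [withAncillas_eq_ampliate, map_add, rateForm_add, ← withAncillas_eq_ampliate,
    ← withAncillas_eq_ampliate]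
  have e1 := rateForm_withAncillas_kronecker_le hJA hJB h1 h2 hχ hε
  have e2 := rateForm_withAncillas_kronecker_le hGA hGB h3 h4 hχ hε
  linarith

end GainBound

/- ### Midpoint of the spectrum -/

section Midpoint

variable {a : Type*} [Fintype a] [DecidableEq a]

/-- The midpoint between the largest and the smallest eigenvalue. -/
def midpointEigenvalue (M : Matrix a a ℂ) : ℝ := (maxEigenvalue M + minEigenvalue M) / 2

theorem eigenvalues_mem_Icc {M : Matrix a a ℂ} (hM : M.IsHermitian) (i : a) :
    hM.eigenvalues i ∈ Set.Icc (minEigenvalue M) (maxEigenvalue M) := by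
  have hf : (spectrum ℝ M).Finite := Matrix.finite_real_spectrum
  exact ⟨csInf_le hf.bddBelow (hM.eigenvalues_mem_spectrum_real i),
    le_csSup hf.bddAbove (hM.eigenvalues_mem_spectrum_real i)⟩

theorem sub_smul_one_eq_conj_diagonal {M : Matrix a a ℂ} (hM : M.IsHermitian) (μ : ℝ) :
    M - (μ : ℂ) • 1 = (hM.eigenvectorUnitary : Matrix a a ℂ) *
      Matrix.diagonal (fun i => ((hM.eigenvalues i - μ : ℝ) : ℂ)) *
        (hM.eigenvectorUnitary : Matrix a a ℂ)ᴴ := by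
  have h := hM.spectral_theorem
  rw [Unitary.conjStarAlgAut_apply] at h
  have hU := Matrix.mem_unitaryGroup_iff.1 hM.eigenvectorUnitary.2
  have e : Matrix.diagonal (fun i => ((hM.eigenvalues i - μ : ℝ) : ℂ)) =
      Matrix.diagonal (RCLike.ofReal ∘ hM.eigenvalues) - (μ : ℂ) • (1 : Matrix a a ℂ) := by
    rw [← Matrix.diagonal_one, ← Matrix.diagonal_smul, Matrix.diagonal_sub]
    congr 1
    funext i
    simp
  rw [e, Matrix.mul_sub, Matrix.sub_mul, Matrix.mul_smul, Matrix.smul_mul, Matrix.mul_one,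
    ← Matrix.star_eq_conjTranspose, hU, ← h]

open scoped Matrix.Norms.L2Operator in
theorem norm_sub_midpoint_le {M : Matrix a a ℂ} (hM : M.IsHermitian) :
    ‖M - (midpointEigenvalue M : ℂ) • 1‖ ≤ spread M / 2 := by
  cases isEmpty_or_nonempty a
  -- In dimension 0 the spectrum is empty and both extremal eigenvalues take the default value 0.
  · rw [Subsingleton.elim (M - (midpointEigenvalue M : ℂ) • 1) 0, norm_zero, spread, maxEigenvalue,
      minEigenvalue, show spectrum ℝ M = ∅ from spectrum.of_subsingleton M]
    simp
  have h0 : 0 ≤ spread M / 2 := by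
    obtain ⟨i⟩ := ‹Nonempty a›
    have := eigenvalues_mem_Icc hM i
    rw [spread]
    linarith [this.1, this.2]
  rw [sub_smul_one_eq_conj_diagonal hM]
  have hU := norm_le_one_of_mem_unitary hM.eigenvectorUnitary.2
  refine (Matrix.l2_opNorm_mul _ _).trans ?_
  refine (mul_le_mul_of_nonneg_right (Matrix.l2_opNorm_mul _ _) (norm_nonneg _)).trans ?_
  rw [Matrix.l2_opNorm_conjTranspose, Matrix.l2_opNorm_diagonal]
  have hd : ‖fun i => ((hM.eigenvalues i - midpointEigenvalue M : ℝ) : ℂ)‖ ≤ spread M / 2 := by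
    refine (pi_norm_le_iff_of_nonneg h0).2 fun i => ?_
    have := eigenvalues_mem_Icc hM i
    rw [Complex.norm_real, Real.norm_eq_abs, abs_le, spread, midpointEigenvalue]
    constructor <;> linarith [this.1, this.2]
  calc _ ≤ 1 * (spread M / 2) * 1 := by gcongr
    _ = _ := by ring

end Midpoint

/- ### Generators that an interaction can reach -/

section Reach

open scoped Matrix.Norms.L2Operator

/-- Telescoping: for contractions the errors of single steps add up without being amplified. -/
theorem norm_pow_sub_pow_le {R : Type*} [NormedRing R] {x y : R} (hx : ‖x‖ ≤ 1) (hy : ‖y‖ ≤ 1)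
    (n : ℕ) : ‖x ^ n - y ^ n‖ ≤ n * ‖x - y‖ := by
  have hpow : ∀ k : ℕ, ‖x ^ k * (x - y)‖ ≤ ‖x - y‖ := by
    intro k
    induction k with
    | zero => simp
    | succ k ih =>
      rw [pow_succ', mul_assoc]
      exact (norm_mul_le _ _).trans ((mul_le_of_le_one_left (norm_nonneg _) hx).trans ih)
  induction n with
  | zero => simp
  | succ n ih =>
    have e : x ^ (n + 1) - y ^ (n + 1) = x ^ n * (x - y) + (x ^ n - y ^ n) * y := by
      rw [pow_succ, pow_succ]; noncomm_ring
    rw [e]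
    have h1 : ‖(x ^ n - y ^ n) * y‖ ≤ n * ‖x - y‖ :=
      (norm_mul_le _ _).trans ((mul_le_of_le_one_right (norm_nonneg _) hy).trans ih)
    calc _ ≤ ‖x - y‖ + n * ‖x - y‖ := (norm_add_le _ _).trans (add_le_add (hpow n) h1)
      _ = _ := by push_cast; ring

variable {n : Type*} [Fintype n] [DecidableEq n]

/-- The difference vanishes to first order at time 0, hence is o(1/N) after time t/N. -/
theorem exists_trotter_step (G₁ G₂ : Matrix n n ℂ) {t ε : ℝ} (ht : 0 ≤ t) (hε : 0 < ε) :
    ∃ N : ℕ, 0 < N ∧ N * ‖evolution G₁ (t / N) * evolution G₂ (t / N) -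
      evolution (G₁ + G₂) (t / N)‖ ≤ ε := by
  have hd : HasDerivAt (fun τ => evolution G₁ τ * evolution G₂ τ - evolution (G₁ + G₂) τ) 0 0 := by
    have h := ((hasDerivAt_evolution G₁ 0).mul (hasDerivAt_evolution G₂ 0)).sub
      (hasDerivAt_evolution (G₁ + G₂) 0)
    refine h.congr_deriv ?_
    simp only [evolution_zero, mul_one, one_mul, smul_add]
    abel
  rw [hasDerivAt_iff_isLittleO] at hd
  -- The denominator t + 1 instead of t also covers t = 0.
  have hb := hd.def (c := ε / (t + 1)) (by positivity)
  simp only [sub_zero, evolution_zero, mul_one, sub_self, smul_zero] at hb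
  have hlim : Filter.Tendsto (fun N : ℕ => t / (N : ℝ)) Filter.atTop (nhds 0) :=
    tendsto_const_div_atTop_nhds_zero_nat t
  obtain ⟨N, hN, hN0⟩ := ((hlim.eventually hb).and (Filter.eventually_gt_atTop 0)).exists
  refine ⟨N, hN0, ?_⟩
  have hN0' : (0 : ℝ) < N := by exact_mod_cast hN0
  rw [Real.norm_of_nonneg (by positivity)] at hN
  calc (N : ℝ) * ‖evolution G₁ (t / N) * evolution G₂ (t / N) - evolution (G₁ + G₂) (t / N)‖
      ≤ N * (ε / (t + 1) * (t / N)) := by gcongr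
    _ = ε * (t / (t + 1)) := by field_simp
    _ ≤ ε * 1 := by
        gcongr
        exact (div_le_one (by positivity)).2 (by linarith)
    _ = ε := mul_one ε

variable {a b r s : Type*} [Fintype a] [DecidableEq a] [Fintype b] [DecidableEq b]
  [Fintype r] [DecidableEq r] [Fintype s] [DecidableEq s]

/-- The evolution generated by `G` is a limit of protocols that use `H` at the cost of `κ` units of
time per unit of time. -/
def Reach (H : Matrix (a × b) (a × b) ℂ) (G : Matrix ((a × r) × (b × s)) ((a × r) × (b × s)) ℂ)
    (κ : ℝ) : Prop :=
  ∀ t : ℝ, 0 ≤ t → ∀ ε : ℝ, 0 < ε → ∃ P : List (Step a b r s),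
    duration P = κ * t ∧ ‖protocolOperator H P - evolution G t‖ ≤ ε

variable {H : Matrix (a × b) (a × b) ℂ}

theorem Reach.interaction (H : Matrix (a × b) (a × b) ℂ) : Reach H (withAncillas r s H) 1 := by
  intro t ht ε hε
  lift t to ℝ≥0 using ht
  refine ⟨[⟨t, 1, 1⟩], by simp [duration], ?_⟩
  simp [protocolOperator, Step.operator, hε.le]

theorem evolution_alice (X : Matrix (a × r) (a × r) ℂ) (t : ℝ) :
    evolution (X ⊗ₖ (1 : Matrix (b × s) (b × s) ℂ)) t = evolution X t ⊗ₖ 1 :=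
  evolution_ampliate (Equiv.refl _) X t

theorem evolution_bob (Y : Matrix (b × s) (b × s) ℂ) (t : ℝ) :
    evolution ((1 : Matrix (a × r) (a × r) ℂ) ⊗ₖ Y) t = 1 ⊗ₖ evolution Y t := by
  have h : ∀ Z : Matrix (b × s) (b × s) ℂ, (1 : Matrix (a × r) (a × r) ℂ) ⊗ₖ Z =
      ampliate (Equiv.prodComm (a × r) (b × s)) Z := by
    intro Z
    ext x y
    rw [ampliate_apply, Matrix.kroneckerMap_apply, Matrix.one_apply, ite_mul, one_mul, zero_mul]
    exact if_congr Iff.rfl rfl rfl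
  rw [h, h, evolution_ampliate]

theorem Reach.alice {X : Matrix (a × r) (a × r) ℂ} (hX : X.IsHermitian) :
    Reach H (X ⊗ₖ (1 : Matrix (b × s) (b × s) ℂ)) 0 := by
  intro t _ ε hε
  refine ⟨[⟨0, ⟨evolution X t, evolution_mem_unitary hX t⟩, 1⟩], by simp [duration], ?_⟩
  simp [protocolOperator, Step.operator, evolution_alice, hε.le]

theorem Reach.bob {Y : Matrix (b × s) (b × s) ℂ} (hY : Y.IsHermitian) :
    Reach H ((1 : Matrix (a × r) (a × r) ℂ) ⊗ₖ Y) 0 := by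
  intro t _ ε hε
  refine ⟨[⟨0, 1, ⟨evolution Y t, evolution_mem_unitary hY t⟩⟩], by simp [duration], ?_⟩
  simp [protocolOperator, Step.operator, evolution_bob, hε.le]

theorem Reach.conj {G : Matrix ((a × r) × (b × s)) ((a × r) × (b × s)) ℂ} {κ : ℝ}
    (h : Reach H G κ) (U : Matrix.unitaryGroup (a × r) ℂ) (V : Matrix.unitaryGroup (b × s) ℂ) :
    Reach H (((U : Matrix (a × r) (a × r) ℂ) ⊗ₖ (V : Matrix (b × s) (b × s) ℂ))ᴴ * G *
      ((U : Matrix (a × r) (a × r) ℂ) ⊗ₖ (V : Matrix (b × s) (b × s) ℂ))) κ := by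
  intro t ht ε hε
  obtain ⟨P, hP, hPε⟩ := h t ht ε hε
  set W := (U : Matrix (a × r) (a × r) ℂ) ⊗ₖ (V : Matrix (b × s) (b × s) ℂ) with hW
  have hWu : W ∈ Matrix.unitaryGroup _ ℂ := kronecker_mem_unitary U.2 V.2
  have hWW : W * Wᴴ = 1 := Matrix.mem_unitaryGroup_iff.1 hWu
  have hWW' : Wᴴ * W = 1 := Matrix.mem_unitaryGroup_iff'.1 hWu
  -- The head of the list acts last, so the list is read in operator order.
  refine ⟨⟨0, U⁻¹, V⁻¹⟩ :: (P ++ [⟨0, U, V⟩]), ?_, ?_⟩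
  · rw [duration_cons, duration_append, hP]
    simp [duration]
  · have hop : protocolOperator H (⟨0, U⁻¹, V⁻¹⟩ :: (P ++ [⟨0, U, V⟩])) =
        Wᴴ * protocolOperator H P * W := by
      rw [protocolOperator_cons, protocolOperator_append]
      have e1 : Step.operator H (⟨0, U⁻¹, V⁻¹⟩ : Step a b r s) = Wᴴ := by
        rw [hW, Matrix.conjTranspose_kronecker]
        simp [Step.operator, Matrix.star_eq_conjTranspose]
      have e2 : protocolOperator H [(⟨0, U, V⟩ : Step a b r s)] = W := by
        simp [protocolOperator, Step.operator, hW]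
      rw [e1, e2, Matrix.mul_assoc]
    have hev : evolution (Wᴴ * G * W) t = Wᴴ * evolution G t * W := by
      have h1 : (Wᴴ * G * W) * Wᴴ = Wᴴ * G := by
        rw [Matrix.mul_assoc, hWW, Matrix.mul_one]
      rw [← evolution_mul_of_intertwine h1, Matrix.mul_assoc _ Wᴴ W, hWW', Matrix.mul_one]
    rw [hop, hev, ← Matrix.sub_mul, ← Matrix.mul_sub]
    have hn := norm_le_one_of_mem_unitary hWu
    have hn' : ‖Wᴴ‖ ≤ 1 := by rwa [Matrix.l2_opNorm_conjTranspose]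
    calc _ ≤ ‖Wᴴ‖ * ‖protocolOperator H P - evolution G t‖ * ‖W‖ :=
          (norm_mul_le _ _).trans (mul_le_mul_of_nonneg_right (norm_mul_le _ _) (norm_nonneg _))
      _ ≤ 1 * ε * 1 := by gcongr
      _ = ε := by ring

theorem evolution_smul {n : Type*} [Fintype n] [DecidableEq n] (G : Matrix n n ℂ) (c t : ℝ) :
    evolution ((c : ℂ) • G) t = evolution G (c * t) := by
  unfold evolution
  congr 1
  rw [smul_smul]
  congr 1
  push_cast
  ring

theorem Reach.smul {G : Matrix ((a × r) × (b × s)) ((a × r) × (b × s)) ℂ} {κ c : ℝ}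
    (h : Reach H G κ) (hc : 0 ≤ c) : Reach H ((c : ℂ) • G) (c * κ) := by
  intro t ht ε hε
  obtain ⟨P, hP, hPε⟩ := h (c * t) (by positivity) ε hε
  exact ⟨P, by rw [hP]; ring, by rwa [evolution_smul]⟩

theorem protocolOperator_flatten_replicate (P : List (Step a b r s)) (N : ℕ) :
    protocolOperator H (List.replicate N P).flatten = protocolOperator H P ^ N := by
  induction N with
  | zero => simp
  | succ N ih =>
    rw [List.replicate_succ, List.flatten_cons, protocolOperator_append, ih, pow_succ']

theorem duration_flatten_replicate (P : List (Step a b r s)) (N : ℕ) :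
    duration (List.replicate N P).flatten = N * duration P := by
  induction N with
  | zero => simp
  | succ N ih =>
    rw [List.replicate_succ, List.flatten_cons, duration_append, ih]
    push_cast
    ring

theorem evolution_pow {n : Type*} [Fintype n] [DecidableEq n] (G : Matrix n n ℂ) (t : ℝ) (N : ℕ) :
    evolution G t ^ N = evolution G (N * t) := by
  induction N with
  | zero => simp
  | succ N ih =>
    rw [pow_succ, ih, ← evolution_add_time]
    congr 1
    push_cast
    ring

theorem Reach.add (hH : H.IsHermitian) {G₁ G₂ : Matrix ((a × r) × (b × s)) ((a × r) × (b × s)) ℂ}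
    (hG₁ : G₁.IsHermitian) (hG₂ : G₂.IsHermitian) {κ₁ κ₂ : ℝ} (h₁ : Reach H G₁ κ₁)
    (h₂ : Reach H G₂ κ₂) : Reach H (G₁ + G₂) (κ₁ + κ₂) := by
  intro t ht ε hε
  obtain ⟨N, hN, hNε⟩ := exists_trotter_step G₁ G₂ ht (half_pos hε)
  have hN' : (0 : ℝ) < N := by exact_mod_cast hN
  set τ := t / N with hτ
  have hτN : N * τ = t := by rw [hτ]; field_simp
  -- Two such errors in each of N rounds use up ε/2; the Trotter error takes the other half.
  obtain ⟨P₁, hP₁, hε₁⟩ := h₁ τ (by positivity) (ε / (4 * N)) (by positivity)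
  obtain ⟨P₂, hP₂, hε₂⟩ := h₂ τ (by positivity) (ε / (4 * N)) (by positivity)
  refine ⟨(List.replicate N (P₁ ++ P₂)).flatten, ?_, ?_⟩
  · rw [duration_flatten_replicate, duration_append, hP₁, hP₂, ← hτN]
    ring
  · rw [protocolOperator_flatten_replicate, ← hτN, ← evolution_pow]
    have hu := norm_le_one_of_mem_unitary (protocolOperator_mem_unitary hH (P₁ ++ P₂))
    have hv := norm_le_one_of_mem_unitary (evolution_mem_unitary (hG₁.add hG₂) τ)
    refine (norm_pow_sub_pow_le hu hv N).trans ?_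
    set A₁ := protocolOperator H P₁
    set A₂ := protocolOperator H P₂
    have hA₁ : ‖A₁‖ ≤ 1 := norm_le_one_of_mem_unitary (protocolOperator_mem_unitary hH P₁)
    have hE₂ : ‖evolution G₂ τ‖ ≤ 1 := norm_le_one_of_mem_unitary (evolution_mem_unitary hG₂ τ)
    have e : protocolOperator H (P₁ ++ P₂) - evolution (G₁ + G₂) τ =
        A₁ * (A₂ - evolution G₂ τ) + (A₁ - evolution G₁ τ) * evolution G₂ τ +
          (evolution G₁ τ * evolution G₂ τ - evolution (G₁ + G₂) τ) := by
      rw [protocolOperator_append]; noncomm_ring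
    have hb : ‖protocolOperator H (P₁ ++ P₂) - evolution (G₁ + G₂) τ‖ ≤
        ε / (4 * N) + ε / (4 * N) +
          ‖evolution G₁ τ * evolution G₂ τ - evolution (G₁ + G₂) τ‖ := by
      rw [e]
      refine (norm_add_le _ _).trans (add_le_add_left ((norm_add_le _ _).trans (add_le_add ?_ ?_)) _)
      · exact (norm_mul_le _ _).trans ((mul_le_of_le_one_left (norm_nonneg _) hA₁).trans hε₂)
      · exact (norm_mul_le _ _).trans ((mul_le_of_le_one_right (norm_nonneg _) hE₂).trans hε₁)
    calc _ ≤ N * (ε / (4 * N) + ε / (4 * N) +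
          ‖evolution G₁ τ * evolution G₂ τ - evolution (G₁ + G₂) τ‖) := by gcongr
      _ = ε / 2 + N * ‖evolution G₁ τ * evolution G₂ τ - evolution (G₁ + G₂) τ‖ := by
          field_simp; ring
      _ ≤ ε := by linarith

end Reach

/- ### From generators to simulations -/

section Simulation

variable {a b a' b' u v : Type*} [Fintype a] [DecidableEq a] [Fintype b] [DecidableEq b]
  [Fintype a'] [DecidableEq a'] [Fintype b'] [DecidableEq b']
  [Fintype u] [DecidableEq u] [Fintype v] [DecidableEq v]

/-- Moving the register to the front. -/
def registerFirst (a a' u : Type*) : a × (a' × u) ≃ a' × (a × u) where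
  toFun x := (x.2.1, (x.1, x.2.2))
  invFun x := (x.2.1, (x.1, x.2.2))
  left_inv _ := rfl
  right_inv _ := rfl

theorem attach_eq_tensorVec (ψ : a' × b' → ℂ) (η : (a × u) × (b × v) → ℂ) :
    attach ψ η = tensorVec (registerFirst a a' u) (registerFirst b b' v) ψ η := rfl

theorem norm_attach (ψ : a' × b' → ℂ) (η : (a × u) × (b × v) → ℂ) :
    ‖WithLp.toLp 2 (attach ψ η)‖ = ‖WithLp.toLp 2 ψ‖ * ‖WithLp.toLp 2 η‖ := by
  rw [attach_eq_tensorVec, norm_tensorVec]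

theorem entanglement_attach {ψ : a' × b' → ℂ} {η : (a × u) × (b × v) → ℂ}
    (hψ : ‖WithLp.toLp 2 ψ‖ = 1) (hη : ‖WithLp.toLp 2 η‖ = 1) :
    entanglement (attach ψ η) = entanglement ψ + entanglement η := by
  rw [attach_eq_tensorVec, entanglement_tensorVec _ _ hψ hη]

/-- The isometry `ψ ↦ ψ ⊗ η`. -/
def attachMatrix (a' b' : Type*) [DecidableEq a'] [DecidableEq b'] (η : (a × u) × (b × v) → ℂ) :
    Matrix ((a × (a' × u)) × (b × (b' × v))) (a' × b') ℂ :=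
  Matrix.of fun x i => if (x.1.2.1, x.2.2.1) = i then η ((x.1.1, x.1.2.2), (x.2.1, x.2.2.2)) else 0

theorem attachMatrix_mulVec (η : (a × u) × (b × v) → ℂ) (ψ : a' × b' → ℂ) :
    attachMatrix a' b' η *ᵥ ψ = attach ψ η := by
  funext x
  simp only [attachMatrix, Matrix.mulVec, dotProduct, Matrix.of_apply, ite_mul, zero_mul,
    Finset.sum_ite_eq, Finset.mem_univ, if_true, attach]
  ring

/-- A simulation need only be checked on generators: the intertwining by the isometry ψ ↦ ψ ⊗ η
passes to exponentials. -/
theorem evolution_attach {G : Matrix ((a × (a' × u)) × (b × (b' × v))) _ ℂ}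
    {K : Matrix (a' × b') (a' × b') ℂ} {η : (a × u) × (b × v) → ℂ}
    (h : ∀ ψ, G *ᵥ attach ψ η = attach (K *ᵥ ψ) η) (t : ℝ) (ψ : a' × b' → ℂ) :
    evolution G t *ᵥ attach ψ η = attach (evolution K t *ᵥ ψ) η := by
  have hL : G * attachMatrix a' b' η = attachMatrix a' b' η * K := by
    apply Matrix.ext_of_mulVec_single
    intro i
    rw [← Matrix.mulVec_mulVec, ← Matrix.mulVec_mulVec, attachMatrix_mulVec, attachMatrix_mulVec, h]
  rw [← attachMatrix_mulVec, Matrix.mulVec_mulVec, evolution_mul_of_intertwine hL,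
    ← Matrix.mulVec_mulVec, attachMatrix_mulVec]

/-- With the catalyst `η`, `H` simulates `K` at the cost of exactly `κ` units of time per unit
of time. -/
def SimulatesWith (H : Matrix (a × b) (a × b) ℂ) (K : Matrix (a' × b') (a' × b') ℂ)
    (η : (a × u) × (b × v) → ℂ) (κ : ℝ) : Prop :=
  ∀ t : ℝ, 0 ≤ t → ∀ ε : ℝ, 0 < ε → ∃ P : List (Step a b (a' × u) (b' × v)),
    duration P = κ * t ∧ ∀ ψ : a' × b' → ℂ, ‖WithLp.toLp 2 ψ‖ = 1 →
      ‖WithLp.toLp 2 (protocolOperator H P *ᵥ attach ψ η -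
        attach (evolution K t *ᵥ ψ) η)‖ ≤ ε

theorem Reach.simulatesWith {H : Matrix (a × b) (a × b) ℂ} {K : Matrix (a' × b') (a' × b') ℂ}
    {G : Matrix ((a × (a' × u)) × (b × (b' × v))) _ ℂ} {κ : ℝ} (hG : Reach H G κ)
    {η : (a × u) × (b × v) → ℂ} (hη : ‖WithLp.toLp 2 η‖ = 1)
    (h : ∀ ψ, G *ᵥ attach ψ η = attach (K *ᵥ ψ) η) : SimulatesWith H K η κ := by
  intro t ht ε hε
  obtain ⟨P, hP, hPε⟩ := hG t ht ε hε
  refine ⟨P, hP, fun ψ hψ => ?_⟩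
  rw [← evolution_attach h, ← Matrix.sub_mulVec]
  refine (norm_mulVec_le _ _).trans ?_
  rwa [norm_attach, hψ, hη, mul_one, mul_one]

theorem SimulatesWith.simulatesAtRate_one {H : Matrix (a × b) (a × b) ℂ}
    {K : Matrix (a' × b') (a' × b') ℂ} {m n : ℕ} {η : (a × Fin m) × (b × Fin n) → ℂ} {κ : ℝ}
    (h : SimulatesWith H K η κ) (hη : ‖WithLp.toLp 2 η‖ = 1) (hκ : κ ≤ 1) :
    SimulatesAtRate H K 1 := by
  refine ⟨m, n, η, hη, fun t ht ε hε => ?_⟩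
  obtain ⟨P, hP, hPε⟩ := h t ht ε hε
  exact ⟨P, by rw [hP, one_mul]; exact mul_le_of_le_one_left ht hκ, hPε⟩

end Simulation

/- ### The Ising interaction simulates `JA ⊗ JB + GA ⊗ GB` -/

section Dilation

open scoped Matrix.Norms.L2Operator

theorem pauliZ_isHermitian : pauliZ.IsHermitian := by
  ext i j
  fin_cases i <;> fin_cases j <;> simp [pauliZ]

theorem pauliZ_mul_self : pauliZ * pauliZ = 1 := by
  ext i j
  fin_cases i <;> fin_cases j <;> simp [pauliZ]

/-- The rotation by a right angle. -/
def quarterTurn : Matrix (Fin 2) (Fin 2) ℂ := !![0, -1; 1, 0]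

theorem quarterTurn_mul_self : quarterTurn * quarterTurn = -1 := by
  ext i j
  fin_cases i <;> fin_cases j <;> simp [quarterTurn]

theorem quarterTurn_conjTranspose : quarterTurnᴴ = -quarterTurn := by
  ext i j
  fin_cases i <;> fin_cases j <;> simp [quarterTurn]

theorem quarterTurn_mul_pauliZ : quarterTurn * pauliZ = -(pauliZ * quarterTurn) := by
  ext i j
  fin_cases i <;> fin_cases j <;> simp [quarterTurn, pauliZ]

variable {k : Type*} [Fintype k] [DecidableEq k]

theorem abs_eigenvalues_le_norm {J : Matrix k k ℂ} (hJ : J.IsHermitian) (i : k) :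
    |hJ.eigenvalues i| ≤ ‖J‖ := by
  have h := norm_mulVec_le J (hJ.eigenvectorBasis i).ofLp
  rw [hJ.mulVec_eigenvectorBasis] at h
  have h1 : ‖WithLp.toLp 2 (hJ.eigenvectorBasis i).ofLp‖ = 1 :=
    hJ.eigenvectorBasis.orthonormal.1 i
  rw [WithLp.toLp_smul, norm_smul, h1] at h
  simpa using h

/-- A Hermitian operator of norm at most `x`, multiplied with `σ_z`, is `x` times the mean of two
operators that are unitarily equivalent to `σ_z`. -/
theorem exists_dilation {J : Matrix k k ℂ} (hJ : J.IsHermitian) {x : ℝ} (hx : ‖J‖ ≤ x) :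
    ∃ U ∈ Matrix.unitaryGroup (Fin 2 × k) ℂ, ∃ V ∈ Matrix.unitaryGroup (Fin 2 × k) ℂ,
      ((x / 2 : ℝ) : ℂ) • (Uᴴ * (pauliZ ⊗ₖ 1) * U + Vᴴ * (pauliZ ⊗ₖ 1) * V) = pauliZ ⊗ₖ J := by
  -- If x = 0, every eigenvalue is 0 and the default `d i = 0` still satisfies x · d = eigenvalue.
  set d : k → ℝ := fun i => hJ.eigenvalues i / x with hd
  have hx0 : 0 ≤ x := (norm_nonneg _).trans hx
  have hd1 : ∀ i, |d i| ≤ 1 := by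
    intro i
    rw [hd, abs_div, abs_of_nonneg hx0]
    exact div_le_one_of_le₀ ((abs_eigenvalues_le_norm hJ i).trans hx) hx0
  have hxd : ∀ i, x * d i = hJ.eigenvalues i := by
    intro i
    rcases hx0.eq_or_lt with h | h
    · have := (abs_eigenvalues_le_norm hJ i).trans hx
      rw [← h] at this
      rw [← h, zero_mul, abs_nonpos_iff.1 this]
    · rw [hd]; field_simp
  -- `C` and `S` are the cosine and sine of half the angle whose cosine is `d i`. Rotating the qubit
  -- by the two opposite angles, conditionally on the eigenvector, and averaging cancels the
  -- off-diagonal part of σ_z and leaves C² - S² = d.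
  set C : Matrix k k ℂ := Matrix.diagonal fun i => ((√((1 + d i) / 2) : ℝ) : ℂ) with hC
  set S : Matrix k k ℂ := Matrix.diagonal fun i => ((√((1 - d i) / 2) : ℝ) : ℂ) with hS
  set W : Matrix k k ℂ := (hJ.eigenvectorUnitary : Matrix k k ℂ) with hW
  have hWu : W ∈ Matrix.unitaryGroup k ℂ := hJ.eigenvectorUnitary.2
  have hWW : W * Wᴴ = 1 := Matrix.mem_unitaryGroup_iff.1 hWu
  have hCh : Cᴴ = C := by
    rw [hC, Matrix.diagonal_conjTranspose]; congr 1; funext i; simp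
  have hSh : Sᴴ = S := by
    rw [hS, Matrix.diagonal_conjTranspose]; congr 1; funext i; simp
  have hCS : C * S = S * C := by
    rw [hC, hS, Matrix.diagonal_mul_diagonal, Matrix.diagonal_mul_diagonal]
    congr 1; funext i; ring
  have hCC : C * C = Matrix.diagonal fun i => (((1 + d i) / 2 : ℝ) : ℂ) := by
    rw [hC, Matrix.diagonal_mul_diagonal]
    congr 1; funext i
    rw [← Complex.ofReal_mul, Real.mul_self_sqrt (by linarith [(abs_le.1 (hd1 i)).1])]
  have hSS : S * S = Matrix.diagonal fun i => (((1 - d i) / 2 : ℝ) : ℂ) := by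
    rw [hS, Matrix.diagonal_mul_diagonal]
    congr 1; funext i
    rw [← Complex.ofReal_mul, Real.mul_self_sqrt (by linarith [(abs_le.1 (hd1 i)).2])]
  have hsum : C * C + S * S = 1 := by
    rw [hCC, hSS, Matrix.diagonal_add, ← Matrix.diagonal_one]
    congr 1; funext i; push_cast; ring
  have hdiff : C * C - S * S = Matrix.diagonal fun i => (d i : ℂ) := by
    rw [hCC, hSS, Matrix.diagonal_sub]
    congr 1; funext i; push_cast; ring
  have hRu : ∀ σ : ℂ, star σ = σ → σ * σ = 1 →
      (1 : Matrix (Fin 2) (Fin 2) ℂ) ⊗ₖ C + σ • (quarterTurn ⊗ₖ S) ∈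
        Matrix.unitaryGroup (Fin 2 × k) ℂ := by
    intro σ hσ hσσ
    rw [Matrix.mem_unitaryGroup_iff', Matrix.star_eq_conjTranspose, Matrix.conjTranspose_add,
      Matrix.conjTranspose_smul, Matrix.conjTranspose_kronecker, Matrix.conjTranspose_kronecker,
      Matrix.conjTranspose_one, hCh, hSh, hσ, quarterTurn_conjTranspose]
    simp only [Matrix.add_mul, Matrix.mul_add, Matrix.smul_mul, Matrix.mul_smul, smul_add,
      ← Matrix.mul_kronecker_mul, Matrix.one_mul, Matrix.mul_one, Matrix.neg_mul,
      quarterTurn_mul_self, hCS, smul_smul, hσσ, neg_neg, one_smul]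
    have e : ∀ A : Matrix k k ℂ, (-quarterTurn) ⊗ₖ A = -(quarterTurn ⊗ₖ A) := by
      intro A; ext i j; simp [Matrix.kroneckerMap_apply]
    rw [e, smul_neg]
    calc _ = (1 : Matrix (Fin 2) (Fin 2) ℂ) ⊗ₖ (C * C + S * S) := by
          rw [Matrix.kronecker_add]; abel
      _ = 1 := by rw [hsum, Matrix.one_kronecker_one]
  have hconj : ∀ σ : ℂ, star σ = σ → σ * σ = 1 →
      ((1 : Matrix (Fin 2) (Fin 2) ℂ) ⊗ₖ C + σ • (quarterTurn ⊗ₖ S))ᴴ * (pauliZ ⊗ₖ 1) *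
        ((1 : Matrix (Fin 2) (Fin 2) ℂ) ⊗ₖ C + σ • (quarterTurn ⊗ₖ S)) =
      pauliZ ⊗ₖ (C * C - S * S) + (2 * σ) • ((pauliZ * quarterTurn) ⊗ₖ (C * S)) := by
    intro σ hσ hσσ
    rw [Matrix.conjTranspose_add,
      Matrix.conjTranspose_smul, Matrix.conjTranspose_kronecker, Matrix.conjTranspose_kronecker,
      Matrix.conjTranspose_one, hCh, hSh, hσ, quarterTurn_conjTranspose]
    simp only [Matrix.add_mul, Matrix.mul_add, Matrix.smul_mul, Matrix.mul_smul, smul_add,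
      ← Matrix.mul_kronecker_mul, Matrix.one_mul, Matrix.mul_one, Matrix.neg_mul,
      quarterTurn_mul_pauliZ, ← hCS, smul_smul, hσσ, neg_neg, one_smul, Matrix.mul_assoc,
      quarterTurn_mul_self, Matrix.mul_neg]
    have e : ∀ A : Matrix k k ℂ, (-pauliZ) ⊗ₖ A = -(pauliZ ⊗ₖ A) := by
      intro A; ext i j; simp [Matrix.kroneckerMap_apply]
    rw [e, sub_eq_add_neg, Matrix.kronecker_add]
    have e' : ∀ A : Matrix k k ℂ, pauliZ ⊗ₖ (-A) = -(pauliZ ⊗ₖ A) := by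
      intro A; ext i j; simp [Matrix.kroneckerMap_apply]
    rw [e', two_mul, add_smul]
    abel
  have hT : (1 : Matrix (Fin 2) (Fin 2) ℂ) ⊗ₖ Wᴴ ∈ Matrix.unitaryGroup (Fin 2 × k) ℂ :=
    kronecker_mem_unitary (one_mem _) (Unitary.star_mem hWu)
  refine ⟨_, mul_mem (hRu 1 (by simp) (by simp)) hT,
    _, mul_mem (hRu (-1) (by simp) (by simp)) hT, ?_⟩
  have h1 := hconj 1 (by simp) (by simp)
  have h2 := hconj (-1) (by simp) (by simp)
  set R₁ := (1 : Matrix (Fin 2) (Fin 2) ℂ) ⊗ₖ C + (1 : ℂ) • (quarterTurn ⊗ₖ S)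
  set R₂ := (1 : Matrix (Fin 2) (Fin 2) ℂ) ⊗ₖ C + (-1 : ℂ) • (quarterTurn ⊗ₖ S)
  set T := (1 : Matrix (Fin 2) (Fin 2) ℂ) ⊗ₖ Wᴴ with hTdef
  have hTh : Tᴴ = (1 : Matrix (Fin 2) (Fin 2) ℂ) ⊗ₖ W := by
    rw [hTdef, Matrix.conjTranspose_kronecker]; simp
  have e : (R₁ * T)ᴴ * (pauliZ ⊗ₖ 1) * (R₁ * T) + (R₂ * T)ᴴ * (pauliZ ⊗ₖ 1) * (R₂ * T) =
      Tᴴ * (R₁ᴴ * (pauliZ ⊗ₖ 1) * R₁ + R₂ᴴ * (pauliZ ⊗ₖ 1) * R₂) * T := by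
    simp only [Matrix.conjTranspose_mul, Matrix.mul_add, Matrix.add_mul, Matrix.mul_assoc]
  have hsum2 : R₁ᴴ * (pauliZ ⊗ₖ 1) * R₁ + R₂ᴴ * (pauliZ ⊗ₖ 1) * R₂ =
      (2 : ℂ) • (pauliZ ⊗ₖ (C * C - S * S)) := by
    rw [h1, h2, two_smul, mul_neg, neg_smul]; abel
  change ((x / 2 : ℝ) : ℂ) •
    ((R₁ * T)ᴴ * (pauliZ ⊗ₖ 1) * (R₁ * T) + (R₂ * T)ᴴ * (pauliZ ⊗ₖ 1) * (R₂ * T)) = _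
  have hJd : W * Matrix.diagonal (fun i => ((x * d i : ℝ) : ℂ)) * Wᴴ = J := by
    have h3 := sub_smul_one_eq_conj_diagonal hJ 0
    simp only [Complex.ofReal_zero, zero_smul, sub_zero] at h3
    simp only [hxd]
    exact h3.symm
  rw [e, hsum2, hdiff, hTh, hTdef, Matrix.mul_smul, Matrix.smul_mul, ← Matrix.mul_kronecker_mul,
    ← Matrix.mul_kronecker_mul, smul_smul, Matrix.one_mul, Matrix.mul_one, ← hJd]
  have hdx : Matrix.diagonal (fun i => ((x * d i : ℝ) : ℂ)) =
      (x : ℂ) • Matrix.diagonal (fun i => (d i : ℂ)) := by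
    rw [← Matrix.diagonal_smul]; congr 1; funext i; simp
  rw [hdx, Matrix.mul_smul, Matrix.smul_mul, Matrix.kronecker_smul]
  congr 1
  push_cast; ring

end Dilation

/-! ### Product interactions reached by averaging rotated Ising interactions. -/

section IsingSimulates

open scoped Matrix.Norms.L2Operator

theorem isingHamiltonian_isHermitian : isingHamiltonian.IsHermitian :=
  isHermitian_kronecker pauliZ_isHermitian pauliZ_isHermitian

variable {r s : Type*} [Fintype r] [DecidableEq r] [Fintype s] [DecidableEq s]

/-- Dilating both factors gives the mean of four locally rotated Ising interactions, each used for a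
quarter of the time. The cost `w` is fixed by `w * c = x * y` rather than by a quotient, which
leaves room for c = 0. -/
theorem Reach.ising {c w x y : ℝ} {JA : Matrix r r ℂ} {JB : Matrix s s ℂ}
    (hJA : JA.IsHermitian) (hJB : JB.IsHermitian) (hx : ‖JA‖ ≤ x) (hy : ‖JB‖ ≤ y) (hw : 0 ≤ w)
    (hc : w * c = x * y) :
    Reach ((c : ℂ) • isingHamiltonian) ((pauliZ ⊗ₖ JA) ⊗ₖ (pauliZ ⊗ₖ JB)) w := by
  have hH : ((c : ℂ) • isingHamiltonian).IsHermitian :=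
    isHermitian_ofReal_smul isingHamiltonian_isHermitian c
  obtain ⟨U₁, hU₁, U₂, hU₂, hU⟩ := exists_dilation hJA hx
  obtain ⟨V₁, hV₁, V₂, hV₂, hV⟩ := exists_dilation hJB hy
  have hZ : withAncillas r s ((c : ℂ) • isingHamiltonian) =
      (c : ℂ) • ((pauliZ ⊗ₖ (1 : Matrix r r ℂ)) ⊗ₖ (pauliZ ⊗ₖ (1 : Matrix s s ℂ))) := by
    rw [withAncillas_eq_ampliate, map_smul, ← withAncillas_eq_ampliate, isingHamiltonian,
      withAncillas_kronecker]
    rfl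
  set A : Matrix (Fin 2 × r) (Fin 2 × r) ℂ → Matrix (Fin 2 × r) (Fin 2 × r) ℂ :=
    fun U => Uᴴ * (pauliZ ⊗ₖ 1) * U with hA
  set B : Matrix (Fin 2 × s) (Fin 2 × s) ℂ → Matrix (Fin 2 × s) (Fin 2 × s) ℂ :=
    fun V => Vᴴ * (pauliZ ⊗ₖ 1) * V with hB
  have hconj : ∀ U V, U ∈ Matrix.unitaryGroup (Fin 2 × r) ℂ →
      V ∈ Matrix.unitaryGroup (Fin 2 × s) ℂ → Reach ((c : ℂ) • isingHamiltonian)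
        (((w / 4 * c : ℝ) : ℂ) • (A U ⊗ₖ B V)) (w / 4) := by
    intro U V hU hV
    have h := ((Reach.interaction (r := r) (s := s) ((c : ℂ) • isingHamiltonian)).conj
      ⟨U, hU⟩ ⟨V, hV⟩).smul (c := w / 4) (by positivity)
    rw [hZ, Matrix.mul_smul, Matrix.smul_mul, smul_smul, Matrix.conjTranspose_kronecker,
      ← Matrix.mul_kronecker_mul, ← Matrix.mul_kronecker_mul, mul_one, ← Complex.ofReal_mul] at h
    exact h
  have hherm : ∀ U V, (((w / 4 * c : ℝ) : ℂ) • (A U ⊗ₖ B V)).IsHermitian :=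
    fun U V => isHermitian_ofReal_smul (isHermitian_kronecker
      (Matrix.isHermitian_conjTranspose_mul_mul _
        (isHermitian_kronecker pauliZ_isHermitian Matrix.isHermitian_one))
      (Matrix.isHermitian_conjTranspose_mul_mul _
        (isHermitian_kronecker pauliZ_isHermitian Matrix.isHermitian_one))) _
  have h := ((hconj U₁ V₁ hU₁ hV₁).add hH (hherm _ _) (hherm _ _) (hconj U₁ V₂ hU₁ hV₂)).add hH
    ((hherm _ _).add (hherm _ _)) ((hherm _ _).add (hherm _ _))
    ((hconj U₂ V₁ hU₂ hV₁).add hH (hherm _ _) (hherm _ _) (hconj U₂ V₂ hU₂ hV₂))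
  convert h using 1
  · rw [← hU, ← hV]
    have : w / 4 * c = x / 2 * (y / 2) := by linarith
    rw [this]
    simp only [Matrix.smul_kronecker, Matrix.kronecker_smul, Matrix.add_kronecker,
      Matrix.kronecker_add, smul_add, smul_smul, Complex.ofReal_mul]
    rw [mul_comm (((y / 2 : ℝ) : ℂ))]
    abel
  · ring

end IsingSimulates

/-! ### Assembling both product terms and the local corrections. -/

section IsingSimulatesSum

variable {a b : Type*} [Fintype a] [DecidableEq a] [Fintype b] [DecidableEq b]

/-- `v ↦ |0⟩ ⊗ v`, where the qubit precedes the register. -/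
def zeroQubit (a : Type*) [DecidableEq a] : Matrix (Fin 2 × (a × Fin 1)) a ℂ :=
  Matrix.of fun x i => if x.1 = 0 ∧ x.2.1 = i then 1 else 0

/-- The product state `|0⟩ ⊗ |0⟩`. -/
def zeroZero : (Fin 2 × Fin 1) × (Fin 2 × Fin 1) → ℂ :=
  fun x => if x.1.1 = 0 ∧ x.2.1 = 0 then 1 else 0

theorem norm_zeroZero : ‖WithLp.toLp 2 zeroZero‖ = 1 := by
  rw [← sq_eq_sq₀ (norm_nonneg _) zero_le_one, norm_sq_toLp]
  simp [Fintype.sum_prod_type, zeroZero]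

theorem attach_zeroZero (ψ : a × b → ℂ) :
    attach ψ zeroZero = (zeroQubit a ⊗ₖ zeroQubit b) *ᵥ ψ := by
  funext x
  simp only [attach, zeroZero, Matrix.mulVec, dotProduct, Fintype.sum_prod_type,
    Matrix.kroneckerMap_apply, zeroQubit, Matrix.of_apply]
  rw [Finset.sum_eq_single x.1.2.1, Finset.sum_eq_single x.2.2.1]
  · by_cases h1 : x.1.1 = 0 <;> by_cases h2 : x.2.1 = 0 <;> simp [h1, h2]
  · intro j _ hj
    simp [Ne.symm hj]
  · simp
  · intro i _ hi
    exact Finset.sum_eq_zero fun j _ => by simp [Ne.symm hi]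
  · simp

/-- Both σ_z and 1 fix |0⟩, so an extra qubit kept in |0⟩ hides the σ_z that the dilation
introduced. -/
theorem kronecker_register_mul_zeroQubit {Q : Matrix (Fin 2) (Fin 2) ℂ} (h0 : Q 0 0 = 1)
    (h1 : Q 1 0 = 0) (J : Matrix a a ℂ) :
    (Q ⊗ₖ ampliate (Equiv.refl (a × Fin 1)) J) * zeroQubit a = zeroQubit a * J := by
  ext x i
  obtain ⟨q, j, z⟩ := x
  rw [Matrix.mul_apply, Matrix.mul_apply, Fintype.sum_prod_type]
  fin_cases q <;>
  simp [zeroQubit, Matrix.kroneckerMap_apply, ampliate_apply, h0, h1, Fintype.sum_prod_type,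
    Subsingleton.elim z 0]

theorem mulVec_attach_zeroZero {A : Matrix (Fin 2 × (a × Fin 1)) (Fin 2 × (a × Fin 1)) ℂ}
    {B : Matrix (Fin 2 × (b × Fin 1)) (Fin 2 × (b × Fin 1)) ℂ} {X : Matrix a a ℂ}
    {Y : Matrix b b ℂ} (hA : A * zeroQubit a = zeroQubit a * X)
    (hB : B * zeroQubit b = zeroQubit b * Y) (ψ : a × b → ℂ) :
    (A ⊗ₖ B) *ᵥ attach ψ zeroZero = attach ((X ⊗ₖ Y) *ᵥ ψ) zeroZero := by
  rw [attach_zeroZero, attach_zeroZero, Matrix.mulVec_mulVec, Matrix.mulVec_mulVec,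
    ← Matrix.mul_kronecker_mul, hA, hB, Matrix.mul_kronecker_mul]

open scoped Matrix.Norms.L2Operator

/-- The two centred products are reached at costs `wJ` and `wG`; the terms lost by centring are
local, gathered in `X` and `Y`, and free. -/
theorem ising_simulatesWith {JA GA : Matrix a a ℂ} {JB GB : Matrix b b ℂ}
    (hJA : JA.IsHermitian) (hGA : GA.IsHermitian) (hJB : JB.IsHermitian) (hGB : GB.IsHermitian)
    {μJ νJ μG νG xJ yJ xG yG c wJ wG : ℝ} (h1 : ‖JA - (μJ : ℂ) • 1‖ ≤ xJ)
    (h2 : ‖JB - (νJ : ℂ) • 1‖ ≤ yJ) (h3 : ‖GA - (μG : ℂ) • 1‖ ≤ xG) (h4 : ‖GB - (νG : ℂ) • 1‖ ≤ yG)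
    (hwJ : 0 ≤ wJ) (hwG : 0 ≤ wG) (hJ : wJ * c = xJ * yJ) (hG : wG * c = xG * yG) :
    SimulatesWith ((c : ℂ) • isingHamiltonian) (JA ⊗ₖ JB + GA ⊗ₖ GB) zeroZero (wJ + wG) := by
  have hH : ((c : ℂ) • isingHamiltonian).IsHermitian :=
    isHermitian_ofReal_smul isingHamiltonian_isHermitian c
  have hsub : ∀ {X : Matrix a a ℂ}, X.IsHermitian → ∀ μ : ℝ, (X - (μ : ℂ) • 1).IsHermitian :=
    fun hX μ => hX.sub (isHermitian_ofReal_smul Matrix.isHermitian_one μ)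
  have hsub' : ∀ {X : Matrix b b ℂ}, X.IsHermitian → ∀ μ : ℝ, (X - (μ : ℂ) • 1).IsHermitian :=
    fun hX μ => hX.sub (isHermitian_ofReal_smul Matrix.isHermitian_one μ)
  set L : Matrix a a ℂ →ₐ[ℂ] Matrix (a × Fin 1) (a × Fin 1) ℂ := ampliate (Equiv.refl (a × Fin 1))
  set M : Matrix b b ℂ →ₐ[ℂ] Matrix (b × Fin 1) (b × Fin 1) ℂ := ampliate (Equiv.refl (b × Fin 1))
  have hL : ∀ {X : Matrix a a ℂ}, X.IsHermitian → (L X).IsHermitian := ampliate_isHermitian _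
  have hM : ∀ {X : Matrix b b ℂ}, X.IsHermitian → (M X).IsHermitian := ampliate_isHermitian _
  have hXherm : ((νJ : ℂ) • (JA - (μJ : ℂ) • 1) + (νG : ℂ) • (GA - (μG : ℂ) • 1)).IsHermitian :=
    (isHermitian_ofReal_smul (hsub hJA _) _).add (isHermitian_ofReal_smul (hsub hGA _) _)
  have hYherm : ((μJ : ℂ) • JB + (μG : ℂ) • GB).IsHermitian :=
    (isHermitian_ofReal_smul hJB _).add (isHermitian_ofReal_smul hGB _)
  set X := (νJ : ℂ) • (JA - (μJ : ℂ) • 1) + (νG : ℂ) • (GA - (μG : ℂ) • 1) with hX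
  set Y := (μJ : ℂ) • JB + (μG : ℂ) • GB with hY
  have r1 := Reach.ising (hL (hsub hJA μJ)) (hM (hsub' hJB νJ)) ((norm_ampliate_le _ _).trans h1)
    ((norm_ampliate_le _ _).trans h2) hwJ hJ
  have r2 := Reach.ising (hL (hsub hGA μG)) (hM (hsub' hGB νG)) ((norm_ampliate_le _ _).trans h3)
    ((norm_ampliate_le _ _).trans h4) hwG hG
  have hZ := pauliZ_isHermitian
  have k1 : (((1 : Matrix (Fin 2) (Fin 2) ℂ) ⊗ₖ L X)).IsHermitian :=
    isHermitian_kronecker Matrix.isHermitian_one (hL hXherm)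
  have k2 : (((1 : Matrix (Fin 2) (Fin 2) ℂ) ⊗ₖ M Y)).IsHermitian :=
    isHermitian_kronecker Matrix.isHermitian_one (hM hYherm)
  have r3 : Reach ((c : ℂ) • isingHamiltonian) _ 0 := Reach.alice (b := Fin 2) (s := b × Fin 1) k1
  have r4 : Reach ((c : ℂ) • isingHamiltonian) _ 0 := Reach.bob (a := Fin 2) (r := a × Fin 1) k2
  have i1 := isHermitian_kronecker (isHermitian_kronecker hZ (hL (hsub hJA μJ)))
    (isHermitian_kronecker hZ (hM (hsub' hJB νJ)))
  have i2 := isHermitian_kronecker (isHermitian_kronecker hZ (hL (hsub hGA μG)))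
    (isHermitian_kronecker hZ (hM (hsub' hGB νG)))
  have i3 := isHermitian_kronecker k1
    (Matrix.isHermitian_one : (1 : Matrix (Fin 2 × (b × Fin 1)) _ ℂ).IsHermitian)
  have i4 := isHermitian_kronecker
    (Matrix.isHermitian_one : (1 : Matrix (Fin 2 × (a × Fin 1)) _ ℂ).IsHermitian) k2
  have r := (r1.add hH i1 i2 r2).add hH (i1.add i2) (i3.add i4) (r3.add hH i3 i4 r4)
  rw [add_zero, add_zero] at r
  refine r.simulatesWith norm_zeroZero fun ψ => ?_
  have z0 : pauliZ 0 0 = 1 := by simp [pauliZ]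
  have z1 : pauliZ 1 0 = 0 := by simp [pauliZ]
  have o0 : (1 : Matrix (Fin 2) (Fin 2) ℂ) 0 0 = 1 := by simp
  have o1 : (1 : Matrix (Fin 2) (Fin 2) ℂ) 1 0 = 0 := by simp
  simp only [Matrix.add_mulVec]
  rw [mulVec_attach_zeroZero (kronecker_register_mul_zeroQubit z0 z1 _)
      (kronecker_register_mul_zeroQubit z0 z1 _),
    mulVec_attach_zeroZero (kronecker_register_mul_zeroQubit z0 z1 _)
      (kronecker_register_mul_zeroQubit z0 z1 _),
    mulVec_attach_zeroZero (Y := 1) (kronecker_register_mul_zeroQubit o0 o1 _) (by simp),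
    mulVec_attach_zeroZero (X := 1) (by simp) (kronecker_register_mul_zeroQubit o0 o1 _)]
  simp only [attach_zeroZero, ← Matrix.mulVec_add, ← Matrix.add_mulVec]
  congr 2
  ext i j
  simp only [Matrix.kroneckerMap_apply, Matrix.add_apply, Matrix.sub_apply, Matrix.smul_apply,
    smul_eq_mul, hX, hY]
  ring

end IsingSimulatesSum

/- ### Extremal subspaces -/

section Extremal

variable {a : Type*} [Fintype a] [DecidableEq a]

theorem toEuclideanLin_mul (A B : Matrix a a ℂ) :
    Matrix.toEuclideanLin (A * B) = Matrix.toEuclideanLin A ∘ₗ Matrix.toEuclideanLin B := by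
  ext x i
  simp [Matrix.toLpLin_apply]

/-- An adapted orthonormal pair of the extremal subspace. -/
theorem exists_orthonormal_extremal {M : Matrix a a ℂ} (hM : M.IsHermitian)
    (h2 : Module.finrank ℂ (extremalSpace M) = 2) :
    ∃ f : Fin 2 → EuclideanSpace ℂ a, Orthonormal ℂ f ∧ (∀ i, f i ∈ extremalSpace M) ∧
      Matrix.toEuclideanLin M (f 0) = ((maxEigenvalue M : ℝ) : ℂ) • f 0 ∧
      Matrix.toEuclideanLin M (f 1) = ((minEigenvalue M : ℝ) : ℂ) • f 1 := by
  -- If the extremal eigenvalues coincide, the subspace is one eigenspace and any orthonormal basis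
  -- serves. Otherwise one eigenvector for each is taken, and they are orthogonal.
  by_cases hd : maxEigenvalue M = minEigenvalue M
  · set B := (stdOrthonormalBasis ℂ (extremalSpace M)).reindex (finCongr h2) with hB
    have hmem : ∀ i, (B i : EuclideanSpace ℂ a) ∈
        Module.End.eigenspace (Matrix.toEuclideanLin M) ((maxEigenvalue M : ℝ) : ℂ) := by
      intro i
      have e : extremalSpace M =
          Module.End.eigenspace (Matrix.toEuclideanLin M) ((maxEigenvalue M : ℝ) : ℂ) := by
        rw [extremalSpace, ← hd, sup_idem]
      exact e.le (B i).2
    refine ⟨fun i => B i, ?_, fun i => (B i).2, Module.End.mem_eigenspace_iff.1 (hmem 0), ?_⟩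
    · exact B.orthonormal.comp_linearIsometry (extremalSpace M).subtypeₗᵢ
    · rw [← hd]
      exact Module.End.mem_eigenspace_iff.1 (hmem 1)
  · have hne : Nonempty a := by
      by_contra h
      rw [not_nonempty_iff] at h
      have : Module.finrank ℂ (extremalSpace M) = 0 := by
        have := Submodule.finrank_le (extremalSpace M)
        simpa using this
      omega
    have hfin : (spectrum ℝ M).Finite := Matrix.finite_real_spectrum
    have hnem : (spectrum ℝ M).Nonempty := ⟨_, hM.eigenvalues_mem_spectrum_real hne.some⟩
    have hvec : ∀ μ ∈ spectrum ℝ M, ∃ v : EuclideanSpace ℂ a, ‖v‖ = 1 ∧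
        Matrix.toEuclideanLin M v = (μ : ℂ) • v := by
      intro μ hμ
      rw [hM.spectrum_real_eq_range_eigenvalues] at hμ
      obtain ⟨i, rfl⟩ := hμ
      refine ⟨hM.eigenvectorBasis i, hM.eigenvectorBasis.orthonormal.1 i, ?_⟩
      have := hM.mulVec_eigenvectorBasis i
      ext j
      simpa [Matrix.toLpLin_apply] using congrFun this j
    obtain ⟨v, hv1, hv⟩ := hvec _ (hnem.csSup_mem hfin)
    obtain ⟨w, hw1, hw⟩ := hvec _ (hnem.csInf_mem hfin)
    have hsym : (Matrix.toEuclideanLin M).IsSymmetric := Matrix.isSymmetric_toEuclideanLin_iff.2 hM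
    have horth : inner ℂ v w = 0 := by
      have h := hsym v w
      rw [hv, hw, inner_smul_left, inner_smul_right, Complex.conj_ofReal] at h
      have h' : (((maxEigenvalue M - minEigenvalue M : ℝ)) : ℂ) * inner ℂ v w = 0 := by
        push_cast
        rw [sub_mul, sub_eq_zero]
        exact h
      rcases mul_eq_zero.1 h' with h0 | h0
      · exact absurd (sub_eq_zero.1 (Complex.ofReal_eq_zero.1 h0)) hd
      · exact h0
    refine ⟨![v, w], ?_, ?_, hv, hw⟩
    · rw [orthonormal_iff_ite]
      have horth' : inner ℂ w v = 0 := inner_eq_zero_symm.1 horth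
      intro i j
      fin_cases i <;> fin_cases j <;> simp [horth, horth', inner_self_eq_norm_sq_to_K, hv1, hw1]
    · intro i
      fin_cases i
      · exact Submodule.mem_sup_left (Module.End.mem_eigenspace_iff.2 hv)
      · exact Submodule.mem_sup_right (Module.End.mem_eigenspace_iff.2 hw)

theorem starProjection_eq_toEuclideanLin {S : Submodule ℂ (EuclideanSpace ℂ a)}
    {F : Matrix a (Fin 2) ℂ} (hF : Fᴴ * F = 1) (hS : Module.finrank ℂ S = 2)
    (hmem : ∀ i, WithLp.toLp 2 (F.col i) ∈ S) :
    ((S.starProjection : EuclideanSpace ℂ a →L[ℂ] EuclideanSpace ℂ a) :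
      EuclideanSpace ℂ a →ₗ[ℂ] EuclideanSpace ℂ a) = Matrix.toEuclideanLin (F * Fᴴ) := by
  set f : Fin 2 → EuclideanSpace ℂ a := fun i => WithLp.toLp 2 (F.col i) with hf
  have hinner : ∀ (i : Fin 2) (v : EuclideanSpace ℂ a), inner ℂ (f i) v = (Fᴴ *ᵥ v.ofLp) i := by
    intro i v
    rw [EuclideanSpace.inner_eq_star_dotProduct, dotProduct_comm]
    rfl
  have hon : Orthonormal ℂ f := by
    rw [orthonormal_iff_ite]
    intro i j
    rw [hinner, ← Matrix.one_apply, ← hF, Matrix.mul_apply]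
    rfl
  have hspan : Submodule.span ℂ (Set.range f) = S := by
    apply Submodule.eq_of_le_of_finrank_eq
    · rw [Submodule.span_le]
      rintro _ ⟨i, rfl⟩
      exact hmem i
    · rw [finrank_span_eq_card hon.linearIndependent, hS, Fintype.card_fin]
  have happ : ∀ v : EuclideanSpace ℂ a, Matrix.toEuclideanLin (F * Fᴴ) v =
      ∑ i, (Fᴴ *ᵥ v.ofLp) i • f i := by
    intro v
    ext j
    simp [Matrix.toLpLin_apply, -Matrix.mulVec_mulVec, Matrix.mulVec, dotProduct, hf, mul_comm]
  ext1 v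
  refine (Submodule.eq_starProjection_of_mem_of_inner_eq_zero (v := Matrix.toEuclideanLin (F * Fᴴ) v)
    ?_ ?_)
  · rw [happ]
    exact Submodule.sum_mem _ fun i _ => Submodule.smul_mem _ _ (hmem i)
  · intro w hw
    rw [← hspan] at hw
    induction hw using Submodule.span_induction with
    | mem x hx =>
      obtain ⟨i, rfl⟩ := hx
      apply inner_eq_zero_symm.1
      rw [inner_sub_right, hinner, hinner, Matrix.ofLp_toLpLin, Matrix.toLin'_apply,
        Matrix.mulVec_mulVec, ← Matrix.mul_assoc, hF, Matrix.one_mul, sub_self]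
    | zero => simp
    | add x y _ _ hx hy => rw [inner_add_right, hx, hy, add_zero]
    | smul c x _ hx => rw [inner_smul_right, hx, mul_zero]

end Extremal

/-! ### Simultaneous normal form of J and G on the common extremal subspace. -/

section CanonicalForm

variable {a : Type*} [Fintype a] [DecidableEq a]

/-- An isometry onto the extremal subspace that diagonalises `M`. -/
theorem exists_extremal_frame {M : Matrix a a ℂ} (hM : M.IsHermitian)
    (h2 : Module.finrank ℂ (extremalSpace M) = 2) :
    ∃ F : Matrix a (Fin 2) ℂ, Fᴴ * F = 1 ∧ extremalProj M = Matrix.toEuclideanLin (F * Fᴴ) ∧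
      (M - (midpointEigenvalue M : ℂ) • 1) * F = F * (((spread M / 2 : ℝ) : ℂ) • pauliZ) := by
  obtain ⟨f, hf, hmem, h0, h1⟩ := exists_orthonormal_extremal hM h2
  set F : Matrix a (Fin 2) ℂ := Matrix.of fun i k => f k i with hF
  have hFF : Fᴴ * F = 1 := by
    ext i j
    have h := (orthonormal_iff_ite.1 hf) i j
    rw [EuclideanSpace.inner_eq_star_dotProduct, dotProduct_comm] at h
    rw [Matrix.one_apply, ← h, Matrix.mul_apply]
    rfl
  refine ⟨F, hFF, starProjection_eq_toEuclideanLin hFF h2 hmem, ?_⟩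
  have e0 : ∀ i, (M *ᵥ (f 0).ofLp) i = (maxEigenvalue M : ℂ) * f 0 i := fun i =>
    congrFun (congrArg WithLp.ofLp h0) i
  have e1 : ∀ i, (M *ᵥ (f 1).ofLp) i = (minEigenvalue M : ℂ) * f 1 i := fun i =>
    congrFun (congrArg WithLp.ofLp h1) i
  ext i k
  rw [Matrix.sub_mul, Matrix.sub_apply, Matrix.smul_mul, Matrix.one_mul, Matrix.smul_apply,
    Matrix.mul_smul, Matrix.smul_apply]
  have hMF : (M * F) i k = (M *ᵥ (f k).ofLp) i := rfl
  rw [hMF]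
  fin_cases k
  · simp only [Fin.zero_eta, e0, hF, Matrix.of_apply, midpointEigenvalue, spread, smul_eq_mul,
      Matrix.mul_apply, Fin.sum_univ_two, pauliZ]
    simp
    ring
  · simp only [Fin.mk_one, e1, hF, Matrix.of_apply, midpointEigenvalue, spread, smul_eq_mul,
      Matrix.mul_apply, Fin.sum_univ_two, pauliZ]
    simp
    ring

theorem trace_toEuclideanLin (A : Matrix a a ℂ) :
    LinearMap.trace ℂ (EuclideanSpace ℂ a) (Matrix.toEuclideanLin A) = A.trace := by
  rw [show (Matrix.toEuclideanLin : Matrix a a ℂ ≃ₗ[ℂ] _) = _ from Matrix.toLpLin_eq_toLin 2 2,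
    Matrix.trace_toLin_eq]

/-- In the frame the restriction is μ + Γ with Γ traceless; its trace is 2μ, so removing the trace
leaves Γ. -/
theorem extremalPart_eq {M : Matrix a a ℂ} (h2 : Module.finrank ℂ (extremalSpace M) = 2)
    {F : Matrix a (Fin 2) ℂ} (hF : Fᴴ * F = 1)
    (hP : extremalProj M = Matrix.toEuclideanLin (F * Fᴴ)) {μ : ℝ} {Γ : Matrix (Fin 2) (Fin 2) ℂ}
    (hM : (M - (μ : ℂ) • 1) * F = F * Γ) (hΓ : Γ.trace = 0) :
    extremalPart M = Matrix.toEuclideanLin (F * Γ * Fᴴ) := by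
  have hMF : M * F = (μ : ℂ) • F + F * Γ := by
    rw [← hM, Matrix.sub_mul, Matrix.smul_mul, Matrix.one_mul]; abel
  have hr : extremalRestriction M =
      Matrix.toEuclideanLin ((μ : ℂ) • (F * Fᴴ) + F * Γ * Fᴴ) := by
    rw [extremalRestriction, hP, ← toEuclideanLin_mul, ← toEuclideanLin_mul]
    congr 1
    have h1 : F * Fᴴ * (M * (F * Fᴴ)) = F * (Fᴴ * (M * F)) * Fᴴ := by
      simp only [Matrix.mul_assoc]
    have h2 : Fᴴ * (F * Γ) = Γ := by rw [← Matrix.mul_assoc, hF, Matrix.one_mul]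
    rw [h1, hMF, Matrix.mul_add, Matrix.mul_smul, hF, h2, Matrix.mul_add, Matrix.add_mul,
      Matrix.mul_smul, Matrix.mul_one, Matrix.smul_mul]
  have ht : LinearMap.trace ℂ (EuclideanSpace ℂ a) (extremalRestriction M) = 2 * μ := by
    rw [hr, trace_toEuclideanLin, Matrix.trace_add, Matrix.trace_smul, Matrix.trace_mul_comm F,
      hF, Matrix.trace_mul_comm (F * Γ), ← Matrix.mul_assoc, hF, Matrix.one_mul, hΓ,
      Matrix.trace_one]
    simp [mul_comm]
  rw [extremalPart, ht, h2, hr, hP, ← map_smul, ← map_sub]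
  congr 1
  have : (2 * (μ : ℂ)) / ((2 : ℕ) : ℂ) = μ := by push_cast; field_simp
  rw [this, add_sub_cancel_left]

theorem pauliZ_trace : pauliZ.trace = 0 := by simp [pauliZ, Matrix.trace]

/-- The traceless symmetric matrix with first row `p`, `q`. -/
def symTraceless (p q : ℝ) : Matrix (Fin 2) (Fin 2) ℂ := !![(p : ℂ), q; q, -p]

theorem exists_phase (β : ℂ) : ∃ ω : ℂ, star ω * ω = 1 ∧ β * ω = ((‖β‖ : ℝ) : ℂ) := by
  by_cases h : β = 0
  · exact ⟨1, by simp, by simp [h]⟩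
  · have hn : ((‖β‖ : ℝ) : ℂ) ≠ 0 := by simpa using h
    refine ⟨star β / ‖β‖, ?_, ?_⟩
    · rw [star_div₀, star_star, RCLike.star_def, Complex.conj_ofReal,
        div_mul_div_comm, Complex.mul_conj']
      field_simp
    · rw [mul_div_assoc', RCLike.star_def, Complex.mul_conj']
      field_simp

/-- Diagonalising J leaves a relative phase free. It is spent on making the off-diagonal entry of Γ
real and nonnegative, so that Γ is determined by `p` and `g`. -/
theorem exists_canonical_phase {Γ : Matrix (Fin 2) (Fin 2) ℂ} (hΓ : Γ.IsHermitian)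
    (htr : Γ.trace = 0) {g : ℝ} (hsq : Γ * Γ = ((g ^ 2 : ℝ) : ℂ) • 1) :
    ∃ (D : Matrix (Fin 2) (Fin 2) ℂ) (p q : ℝ), Dᴴ * D = 1 ∧ D * Dᴴ = 1 ∧
      pauliZ * D = D * pauliZ ∧ Γ * D = D * symTraceless p q ∧ 0 ≤ q ∧ p ^ 2 + q ^ 2 = g ^ 2 := by
  obtain ⟨ω, hω, hβω⟩ := exists_phase (Γ 0 1)
  have h10 : Γ 1 0 = star (Γ 0 1) := (hΓ.apply 1 0).symm
  have h00 : Γ 0 0 = ((Γ 0 0).re : ℂ) := (Complex.conj_eq_iff_re.1 (hΓ.apply 0 0)).symm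
  have h11 : Γ 1 1 = -((Γ 0 0).re : ℂ) := by
    rw [Matrix.trace_fin_two, ← h00] at *
    linear_combination htr
  have hω' : ω * star ω = 1 := by rw [mul_comm, hω]
  have hβ' : Γ 1 0 = ω * ((‖Γ 0 1‖ : ℝ) : ℂ) := by
    have h := congrArg star hβω
    rw [star_mul', RCLike.star_def, Complex.conj_ofReal] at h
    rw [h10, ← h]
    simp only [RCLike.star_def] at hω' ⊢
    linear_combination (-(starRingEnd ℂ) (Γ 0 1)) * hω'
  refine ⟨Matrix.diagonal ![1, ω], (Γ 0 0).re, ‖Γ 0 1‖, ?_, ?_, ?_, ?_, norm_nonneg _, ?_⟩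
  · rw [Matrix.diagonal_conjTranspose, Matrix.diagonal_mul_diagonal, ← Matrix.diagonal_one]
    congr 1; funext i; fin_cases i
    · simp
    · simpa using hω
  · rw [Matrix.diagonal_conjTranspose, Matrix.diagonal_mul_diagonal, ← Matrix.diagonal_one]
    congr 1; funext i; fin_cases i
    · simp
    · simpa using hω'
  · ext i j
    rw [Matrix.mul_diagonal, Matrix.diagonal_mul]
    fin_cases i <;> fin_cases j <;> simp [pauliZ]
  · ext i j
    rw [Matrix.mul_diagonal, Matrix.diagonal_mul]
    fin_cases i <;> fin_cases j
    · simp [symTraceless, ← h00]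
    · simpa [symTraceless] using hβω
    · simpa [symTraceless] using hβ'
    · simp [symTraceless, h11, mul_comm]
  · have h := congrFun (congrFun hsq 0) 0
    rw [Matrix.mul_apply, Fin.sum_univ_two, h10, h00, RCLike.star_def, Complex.mul_conj'] at h
    simp only [Matrix.smul_apply, Matrix.one_apply_eq, smul_eq_mul, mul_one] at h
    rw [← Complex.ofReal_inj]
    push_cast
    push_cast at h
    rw [← h]
    ring

/-- The canonical form of two Hermitian operators with the same two-dimensional extremal
subspace. -/
theorem exists_canonical_frame {J G : Matrix a a ℂ} (hJ : J.IsHermitian) (hG : G.IsHermitian)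
    (hS : extremalSpace J = extremalSpace G) (h2 : Module.finrank ℂ (extremalSpace J) = 2) :
    ∃ (E : Matrix a (Fin 2) ℂ) (p q : ℝ), Eᴴ * E = 1 ∧
      (J - (midpointEigenvalue J : ℂ) • 1) * E = E * (((spread J / 2 : ℝ) : ℂ) • pauliZ) ∧
      (G - (midpointEigenvalue G : ℂ) • 1) * E = E * symTraceless p q ∧
      0 ≤ q ∧ p ^ 2 + q ^ 2 = (spread G / 2) ^ 2 ∧ (spread J = 0 → p = spread G / 2) ∧
      LinearMap.trace ℂ (EuclideanSpace ℂ a) (extremalPart J ∘ₗ extremalPart G) =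
        ((spread J * p : ℝ) : ℂ) := by
  have h2' : Module.finrank ℂ (extremalSpace G) = 2 := hS ▸ h2
  have hPP : extremalProj J = extremalProj G :=
    congrArg (fun S : Submodule ℂ (EuclideanSpace ℂ a) =>
      ((S.starProjection : EuclideanSpace ℂ a →L[ℂ] EuclideanSpace ℂ a) :
        EuclideanSpace ℂ a →ₗ[ℂ] EuclideanSpace ℂ a)) hS
  obtain ⟨F, hF, hPF, hJF⟩ := exists_extremal_frame hJ h2
  obtain ⟨K, hK, hPK, hGK⟩ := exists_extremal_frame hG h2'
  have hFK : F * Fᴴ = K * Kᴴ := by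
    apply Matrix.toEuclideanLin.injective
    rw [← hPF, hPP, hPK]
  set gJ := spread J / 2 with hgJ
  set gG := spread G / 2 with hgG
  have htrace : ∀ (E : Matrix a (Fin 2) ℂ) (p q : ℝ), Eᴴ * E = 1 → E * Eᴴ = F * Fᴴ →
      (J - (midpointEigenvalue J : ℂ) • 1) * E = E * ((gJ : ℂ) • pauliZ) →
      (G - (midpointEigenvalue G : ℂ) • 1) * E = E * symTraceless p q →
      LinearMap.trace ℂ (EuclideanSpace ℂ a) (extremalPart J ∘ₗ extremalPart G) =
        ((spread J * p : ℝ) : ℂ) := by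
    intro E p q hE hEF hJE hGE
    have t1 : ((gJ : ℂ) • pauliZ).trace = 0 := by rw [Matrix.trace_smul, pauliZ_trace, smul_zero]
    have t2 : (symTraceless p q).trace = 0 := by simp [symTraceless, Matrix.trace]
    rw [extremalPart_eq h2 hE (by rw [hPF, hEF]) hJE t1,
      extremalPart_eq h2' hE (by rw [← hPP, hPF, hEF]) hGE t2, ← toEuclideanLin_mul,
      trace_toEuclideanLin]
    have e : E * ((gJ : ℂ) • pauliZ) * Eᴴ * (E * symTraceless p q * Eᴴ) =
        E * (((gJ : ℂ) • pauliZ) * ((Eᴴ * E) * symTraceless p q)) * Eᴴ := by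
      simp only [Matrix.mul_assoc]
    rw [e, hE, Matrix.one_mul, Matrix.trace_mul_comm, ← Matrix.mul_assoc, hE, Matrix.one_mul,
      Matrix.smul_mul, Matrix.trace_smul]
    simp [pauliZ, symTraceless, Matrix.trace, hgJ]
    ring
  -- Here J is scalar on the subspace, any frame diagonalises it, and the frame of G is taken. The
  -- value of `p` is then recorded separately, since the trace vanishes and says nothing about it.
  by_cases hJ0 : spread J = 0
  · have hg0 : gJ = 0 := by rw [hgJ, hJ0, zero_div]
    have hJK : (J - (midpointEigenvalue J : ℂ) • 1) * K = K * ((gJ : ℂ) • pauliZ) := by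
      have e : K = F * (Fᴴ * K) := by
        rw [← Matrix.mul_assoc, hFK, Matrix.mul_assoc, hK, Matrix.mul_one]
      rw [e, ← Matrix.mul_assoc, hJF, hg0]
      simp
    have hGK' : (G - (midpointEigenvalue G : ℂ) • 1) * K = K * symTraceless gG 0 := by
      rw [hGK]
      congr 1
      ext i j
      fin_cases i <;> fin_cases j <;> simp [pauliZ, symTraceless]
    exact ⟨K, gG, 0, hK, hJK, hGK', le_rfl, by ring, fun _ => rfl,
      htrace K gG 0 hK hFK.symm hJK hGK'⟩
  -- The change of basis between the frames of J and of G; it is unitary because both frames span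
  -- the same subspace.
  · set Q := Fᴴ * K with hQ
    have hFQ : F * Q = K := by
      rw [hQ, ← Matrix.mul_assoc, hFK, Matrix.mul_assoc, hK, Matrix.mul_one]
    have hQF : K * Qᴴ = F := by
      rw [hQ, Matrix.conjTranspose_mul, Matrix.conjTranspose_conjTranspose, ← Matrix.mul_assoc,
        ← hFK, Matrix.mul_assoc, hF, Matrix.mul_one]
    have hQQ : Q * Qᴴ = 1 := by
      rw [← hF, ← hQF, ← Matrix.mul_assoc, hQF]
    have hQQ' : Qᴴ * Q = 1 := mul_eq_one_comm.1 hQQ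
    set Γ := (gG : ℂ) • (Q * pauliZ * Qᴴ) with hΓdef
    have hGF : (G - (midpointEigenvalue G : ℂ) • 1) * F = F * Γ := by
      rw [← hQF, ← Matrix.mul_assoc, hGK, hQF, hΓdef, Matrix.mul_smul, Matrix.mul_smul,
        Matrix.smul_mul, ← Matrix.mul_assoc, ← Matrix.mul_assoc, hFQ]
    have hΓ : Γ.IsHermitian :=
      isHermitian_ofReal_smul (Matrix.isHermitian_mul_mul_conjTranspose Q pauliZ_isHermitian) _
    have hΓtr : Γ.trace = 0 := by
      rw [hΓdef, Matrix.trace_smul, Matrix.trace_mul_comm, ← Matrix.mul_assoc, hQQ', Matrix.one_mul,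
        pauliZ_trace, smul_zero]
    have hΓsq : Γ * Γ = ((gG ^ 2 : ℝ) : ℂ) • 1 := by
      have e : Q * pauliZ * Qᴴ * (Q * pauliZ * Qᴴ) = Q * (pauliZ * ((Qᴴ * Q) * pauliZ)) * Qᴴ := by
        simp only [Matrix.mul_assoc]
      rw [hΓdef, Matrix.smul_mul, Matrix.mul_smul, e, hQQ', Matrix.one_mul, pauliZ_mul_self,
        Matrix.mul_one, hQQ, smul_smul]
      push_cast
      rw [sq]
    obtain ⟨D, p, q, hD, hD', hDZ, hDΓ, hq, hpq⟩ := exists_canonical_phase hΓ hΓtr hΓsq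
    have hE : (F * D)ᴴ * (F * D) = 1 := by
      rw [Matrix.conjTranspose_mul, Matrix.mul_assoc, ← Matrix.mul_assoc Fᴴ, hF, Matrix.one_mul, hD]
    have hEE : (F * D) * (F * D)ᴴ = F * Fᴴ := by
      rw [Matrix.conjTranspose_mul, Matrix.mul_assoc, ← Matrix.mul_assoc D, hD', Matrix.one_mul]
    have hJE : (J - (midpointEigenvalue J : ℂ) • 1) * (F * D) =
        F * D * ((gJ : ℂ) • pauliZ) := by
      rw [← Matrix.mul_assoc, hJF, Matrix.mul_assoc, Matrix.mul_assoc, Matrix.smul_mul, hDZ]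
      simp only [Matrix.mul_smul]
    have hGE : (G - (midpointEigenvalue G : ℂ) • 1) * (F * D) = F * D * symTraceless p q := by
      rw [← Matrix.mul_assoc, hGF, Matrix.mul_assoc, Matrix.mul_assoc, hDΓ]
    exact ⟨F * D, p, q, hE, hJE, hGE, hq, hpq, fun h => absurd h hJ0,
      htrace (F * D) p q hE hEE hJE hGE⟩

end CanonicalForm

/- ### `JA ⊗ JB + GA ⊗ GB` simulates the Ising interaction -/

section Controlled

variable {a b k l : Type*} [Fintype a] [DecidableEq a] [Fintype b] [DecidableEq b]
  [Fintype k] [DecidableEq k] [Fintype l] [DecidableEq l]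

/-- The operator that applies `T i` when the control register is in the state `i`. -/
def controlled (T : k → Matrix a a ℂ) : Matrix (a × k) (a × k) ℂ :=
  Matrix.of fun x y => if x.2 = y.2 then T x.2 x.1 y.1 else 0

theorem controlled_mul (T T' : k → Matrix a a ℂ) :
    controlled T * controlled T' = controlled fun i => T i * T' i := by
  ext x y
  simp only [controlled, Matrix.mul_apply, Matrix.of_apply, Fintype.sum_prod_type_right, ite_mul,
    zero_mul, mul_ite, mul_zero]
  rw [Finset.sum_eq_single x.2]
  · by_cases h : x.2 = y.2 <;> simp [h]
  · intro j _ hj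
    simp [Ne.symm hj]
  · simp

theorem controlled_conjTranspose (T : k → Matrix a a ℂ) :
    (controlled T)ᴴ = controlled fun i => (T i)ᴴ := by
  ext x y
  by_cases h : x.2 = y.2
  · simp [controlled, h]
  · simp [controlled, h, Ne.symm h]

theorem controlled_one : controlled (fun _ : k => (1 : Matrix a a ℂ)) = 1 := by
  ext x y
  simp only [controlled, Matrix.of_apply, Matrix.one_apply, Prod.ext_iff]
  split_ifs <;> simp_all

theorem controlled_mem_unitary {T : k → Matrix a a ℂ}
    (hT : ∀ i, T i ∈ Matrix.unitaryGroup a ℂ) : controlled T ∈ Matrix.unitaryGroup (a × k) ℂ := by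
  rw [Matrix.mem_unitaryGroup_iff, Matrix.star_eq_conjTranspose, controlled_conjTranspose,
    controlled_mul, ← controlled_one]
  congr 1
  funext i
  exact Matrix.mem_unitaryGroup_iff.1 (hT i)

theorem controlled_kronecker_mulVec (T : k → Matrix a a ℂ) (T' : l → Matrix b b ℂ)
    (Ψ : (a × k) × (b × l) → ℂ) (x : (a × k) × (b × l)) :
    ((controlled T ⊗ₖ controlled T') *ᵥ Ψ) x =
      ((T x.1.2 ⊗ₖ T' x.2.2) *ᵥ fun z => Ψ ((z.1, x.1.2), (z.2, x.2.2))) (x.1.1, x.2.1) := by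
  simp only [Matrix.mulVec, dotProduct, Fintype.sum_prod_type, Matrix.kroneckerMap_apply, controlled,
    Matrix.of_apply]
  refine Finset.sum_congr rfl fun i _ => ?_
  rw [Finset.sum_eq_single x.1.2]
  · refine Finset.sum_congr rfl fun j _ => ?_
    rw [Finset.sum_eq_single x.2.2]
    · simp
    · intro j' _ hj
      simp [Ne.symm hj]
    · simp
  · intro j _ hj
    simp [Ne.symm hj]
  · simp

theorem withAncillas_mulVec (H : Matrix (a × b) (a × b) ℂ) (Ψ : (a × k) × (b × l) → ℂ)
    (x : (a × k) × (b × l)) :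
    (withAncillas k l H *ᵥ Ψ) x =
      (H *ᵥ fun z => Ψ ((z.1, x.1.2), (z.2, x.2.2))) (x.1.1, x.2.1) := by
  rw [withAncillas_eq_ampliate, ampliate_mulVec]
  rfl

end Controlled

/-! ### The maximally entangled catalyst and phase kickback. -/

section Isometry

open scoped Matrix.Norms.L2Operator

variable {a b : Type*} [Fintype a] [DecidableEq a] [Fintype b] [DecidableEq b]

theorem norm_isometry_mulVec {n m : Type*} [Fintype n] [DecidableEq n] [Fintype m] [DecidableEq m]
    {E : Matrix n m ℂ} (hE : Eᴴ * E = 1) (v : m → ℂ) :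
    ‖WithLp.toLp 2 (E *ᵥ v)‖ = ‖WithLp.toLp 2 v‖ := by
  have hn : ‖E‖ ≤ 1 := norm_le_one_of_conjTranspose_mul_self (d := 1)
    (by rw [hE]; exact Matrix.diagonal_one.symm) (by simp)
  have hn' : ‖Eᴴ‖ ≤ 1 := by rwa [Matrix.l2_opNorm_conjTranspose]
  apply le_antisymm
  · exact (norm_mulVec_le E v).trans (mul_le_of_le_one_left (norm_nonneg _) hn)
  · have h := norm_mulVec_le Eᴴ (E *ᵥ v)
    rw [Matrix.mulVec_mulVec, hE, Matrix.one_mulVec] at h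
    exact h.trans (mul_le_of_le_one_left (norm_nonneg _) hn')

/-- The quarter turn of the range of the isometry `E`, extended by the identity. -/
def turnOn (E : Matrix a (Fin 2) ℂ) : Matrix a a ℂ := 1 - E * Eᴴ + E * quarterTurn * Eᴴ

theorem turnOn_mul {E : Matrix a (Fin 2) ℂ} (hE : Eᴴ * E = 1) :
    turnOn E * E = E * quarterTurn := by
  rw [turnOn, Matrix.add_mul, Matrix.sub_mul, Matrix.one_mul, Matrix.mul_assoc, hE,
    Matrix.mul_assoc, hE, Matrix.mul_one, Matrix.mul_one, sub_self, zero_add]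

theorem turnOn_mem_unitary {E : Matrix a (Fin 2) ℂ} (hE : Eᴴ * E = 1) :
    turnOn E ∈ Matrix.unitaryGroup a ℂ := by
  have h1 : (turnOn E)ᴴ = 1 - E * Eᴴ - E * quarterTurn * Eᴴ := by
    rw [turnOn]
    simp only [Matrix.conjTranspose_add, Matrix.conjTranspose_sub, Matrix.conjTranspose_one,
      Matrix.conjTranspose_mul, Matrix.conjTranspose_conjTranspose, quarterTurn_conjTranspose,
      Matrix.neg_mul, Matrix.mul_neg, Matrix.mul_assoc, ← sub_eq_add_neg]
  have h2 : turnOn E * (E * Eᴴ) = E * quarterTurn * Eᴴ := by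
    rw [← Matrix.mul_assoc, turnOn_mul hE]
  have h3 : turnOn E * (E * quarterTurn * Eᴴ) = -(E * Eᴴ) := by
    rw [Matrix.mul_assoc, ← Matrix.mul_assoc, turnOn_mul hE, ← Matrix.mul_assoc,
      Matrix.mul_assoc E, quarterTurn_mul_self, Matrix.mul_neg, Matrix.mul_one, Matrix.neg_mul]
  rw [Matrix.mem_unitaryGroup_iff, Matrix.star_eq_conjTranspose, h1, Matrix.mul_sub, Matrix.mul_sub,
    Matrix.mul_one, h2, h3, turnOn]
  abel

/-- A maximally entangled state of two qubits. -/
def bellState : Fin 2 × Fin 2 → ℂ := fun x => if x.1 = x.2 then ((√2 : ℝ) : ℂ)⁻¹ else 0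

theorem norm_bellState : ‖WithLp.toLp 2 bellState‖ = 1 := by
  rw [← sq_eq_sq₀ (norm_nonneg _) zero_le_one, norm_sq_toLp]
  simp [bellState, Fin.sum_univ_two, abs_of_nonneg]
  norm_num

/-- A quarter turn if `i = 1`. -/
def turnIf (i : Fin 2) : Matrix (Fin 2) (Fin 2) ℂ := if i = 0 then 1 else quarterTurn

/-- Both 2 × 2 matrices are real symmetric and traceless: their tensor squares multiply the Bell
state by the scalar squares x² and p² + q², and each quarter turn anticommutes with them,
contributing a sign. -/
theorem bell_eigenvector (x p q : ℝ) (i j : Fin 2) :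
    (((x : ℂ) • pauliZ) ⊗ₖ ((x : ℂ) • pauliZ) + symTraceless p q ⊗ₖ symTraceless p q) *ᵥ
        ((turnIf i ⊗ₖ turnIf j) *ᵥ bellState) =
      (((x ^ 2 + (p ^ 2 + q ^ 2) : ℝ) : ℂ) * (pauliZ i i * pauliZ j j)) •
        ((turnIf i ⊗ₖ turnIf j) *ᵥ bellState) := by
  funext y
  obtain ⟨y1, y2⟩ := y
  fin_cases i <;> fin_cases j <;> fin_cases y1 <;> fin_cases y2 <;>
  simp [Matrix.mulVec, dotProduct, Fintype.sum_prod_type, Fin.sum_univ_two, turnIf, pauliZ,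
    symTraceless, quarterTurn, bellState, Matrix.kroneckerMap_apply] <;> ring

theorem ising_mulVec (c : ℂ) (ψ : Fin 2 × Fin 2 → ℂ) (i j : Fin 2) :
    ((c • isingHamiltonian) *ᵥ ψ) (i, j) = c * (pauliZ i i * pauliZ j j) * ψ (i, j) := by
  rw [Matrix.smul_mulVec]
  fin_cases i <;> fin_cases j <;>
  simp [isingHamiltonian, Matrix.mulVec, dotProduct, Fintype.sum_prod_type, Fin.sum_univ_two,
    pauliZ, Matrix.kroneckerMap_apply]

/-- The catalyst: a maximally entangled state of the extremal subspaces. -/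
def catalyst (EA : Matrix a (Fin 2) ℂ) (EB : Matrix b (Fin 2) ℂ) :
    (a × Fin 1) × (b × Fin 1) → ℂ :=
  fun x => ((EA ⊗ₖ EB) *ᵥ bellState) (x.1.1, x.2.1)

theorem norm_catalyst {EA : Matrix a (Fin 2) ℂ} {EB : Matrix b (Fin 2) ℂ} (hA : EAᴴ * EA = 1)
    (hB : EBᴴ * EB = 1) : ‖WithLp.toLp 2 (catalyst EA EB)‖ = 1 := by
  have h : ‖WithLp.toLp 2 (catalyst EA EB)‖ = ‖WithLp.toLp 2 ((EA ⊗ₖ EB) *ᵥ bellState)‖ := by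
    rw [← sq_eq_sq₀ (norm_nonneg _) (norm_nonneg _), norm_sq_toLp, norm_sq_toLp]
    simp [Fintype.sum_prod_type, catalyst]
  rw [h, norm_isometry_mulVec, norm_bellState]
  rw [Matrix.conjTranspose_kronecker, ← Matrix.mul_kronecker_mul, hA, hB, Matrix.one_kronecker_one]

/-- Phase kickback: for control values i, j the turned catalyst is an eigenvector of the centred
interaction, and the sign of its eigenvalue is that of σ_z ⊗ σ_z at (i, j). Undoing the turns
restores the catalyst and leaves the phase on the controls. -/
theorem simulatesWith_ising {JA GA : Matrix a a ℂ} {JB GB : Matrix b b ℂ}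
    (hJA : JA.IsHermitian) (hGA : GA.IsHermitian) (hJB : JB.IsHermitian) (hGB : GB.IsHermitian)
    {μJ νJ μG νG x p q : ℝ} {EA : Matrix a (Fin 2) ℂ} {EB : Matrix b (Fin 2) ℂ}
    (hEA : EAᴴ * EA = 1) (hEB : EBᴴ * EB = 1)
    (h1 : (JA - (μJ : ℂ) • 1) * EA = EA * ((x : ℂ) • pauliZ))
    (h2 : (JB - (νJ : ℂ) • 1) * EB = EB * ((x : ℂ) • pauliZ))
    (h3 : (GA - (μG : ℂ) • 1) * EA = EA * symTraceless p q)
    (h4 : (GB - (νG : ℂ) • 1) * EB = EB * symTraceless p q) :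
    SimulatesWith (JA ⊗ₖ JB + GA ⊗ₖ GB)
      (((x ^ 2 + (p ^ 2 + q ^ 2) : ℝ) : ℂ) • isingHamiltonian) (catalyst EA EB) 1 := by
  set H := JA ⊗ₖ JB + GA ⊗ₖ GB with hHdef
  have hH : H.IsHermitian := (isHermitian_kronecker hJA hJB).add (isHermitian_kronecker hGA hGB)
  set H' := (JA - (μJ : ℂ) • 1) ⊗ₖ (JB - (νJ : ℂ) • 1) +
    (GA - (μG : ℂ) • 1) ⊗ₖ (GB - (νG : ℂ) • 1) with hH'
  have hsubA : ∀ {X : Matrix a a ℂ}, X.IsHermitian → ∀ μ : ℝ, (X - (μ : ℂ) • 1).IsHermitian :=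
    fun hX μ => hX.sub (isHermitian_ofReal_smul Matrix.isHermitian_one μ)
  set X := ((-νJ : ℝ) : ℂ) • (JA - (μJ : ℂ) • 1) + ((-νG : ℝ) : ℂ) • (GA - (μG : ℂ) • 1) with hX
  set Y := ((-μJ : ℝ) : ℂ) • JB + ((-μG : ℝ) : ℂ) • GB with hY
  have hXh : X.IsHermitian :=
    (isHermitian_ofReal_smul (hsubA hJA _) _).add (isHermitian_ofReal_smul (hsubA hGA _) _)
  have hYh : Y.IsHermitian := (isHermitian_ofReal_smul hJB _).add (isHermitian_ofReal_smul hGB _)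
  have hsplit : H' = H + (X ⊗ₖ (1 : Matrix b b ℂ) + (1 : Matrix a a ℂ) ⊗ₖ Y) := by
    ext i j
    simp only [hHdef, hH', hX, hY, Matrix.kroneckerMap_apply, Matrix.add_apply, Matrix.sub_apply,
      Matrix.smul_apply, smul_eq_mul, Complex.ofReal_neg]
    ring
  have hanc : withAncillas (Fin 2 × Fin 1) (Fin 2 × Fin 1) H' =
      withAncillas (Fin 2 × Fin 1) (Fin 2 × Fin 1) H +
        (ampliate (Equiv.refl _) X ⊗ₖ 1 + 1 ⊗ₖ ampliate (Equiv.refl _) Y) := by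
    have hadd : ∀ A B : Matrix (a × b) (a × b) ℂ,
        withAncillas (Fin 2 × Fin 1) (Fin 2 × Fin 1) (A + B) =
          withAncillas (Fin 2 × Fin 1) (Fin 2 × Fin 1) A +
            withAncillas (Fin 2 × Fin 1) (Fin 2 × Fin 1) B :=
      fun A B => map_add (ampliate (Equiv.prodProdProdComm a (Fin 2 × Fin 1) b (Fin 2 × Fin 1))) A B
    rw [hsplit, hadd H, hadd (X ⊗ₖ 1), withAncillas_kronecker X, withAncillas_kronecker 1, map_one,
      map_one]
  have iX := ampliate_isHermitian (Equiv.refl (a × (Fin 2 × Fin 1))) hXh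
  have iY := ampliate_isHermitian (Equiv.refl (b × (Fin 2 × Fin 1))) hYh
  have k1 := isHermitian_kronecker iX
    (Matrix.isHermitian_one : (1 : Matrix (b × (Fin 2 × Fin 1)) _ ℂ).IsHermitian)
  have k2 := isHermitian_kronecker
    (Matrix.isHermitian_one : (1 : Matrix (a × (Fin 2 × Fin 1)) _ ℂ).IsHermitian) iY
  have r := (Reach.interaction (r := Fin 2 × Fin 1) (s := Fin 2 × Fin 1) H).add hH
    (withAncillas_isHermitian hH) (k1.add k2) ((Reach.alice iX).add hH k1 k2 (Reach.bob iY))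
  rw [← hanc, add_zero, add_zero] at r
  set TA : Fin 2 × Fin 1 → Matrix a a ℂ := fun i => if i.1 = 0 then 1 else turnOn EA with hTA
  set TB : Fin 2 × Fin 1 → Matrix b b ℂ := fun i => if i.1 = 0 then 1 else turnOn EB with hTB
  have hTAu : ∀ i, TA i ∈ Matrix.unitaryGroup a ℂ := by
    intro i
    simp only [hTA]
    split_ifs
    · exact one_mem _
    · exact turnOn_mem_unitary hEA
  have hTBu : ∀ i, TB i ∈ Matrix.unitaryGroup b ℂ := by
    intro i
    simp only [hTB]
    split_ifs
    · exact one_mem _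
    · exact turnOn_mem_unitary hEB
  have hTAE : ∀ i, TA i * EA = EA * turnIf i.1 := by
    intro i
    simp only [hTA, turnIf]
    split_ifs
    · simp
    · exact turnOn_mul hEA
  have hTBE : ∀ i, TB i * EB = EB * turnIf i.1 := by
    intro i
    simp only [hTB, turnIf]
    split_ifs
    · simp
    · exact turnOn_mul hEB
  have hVA := controlled_mem_unitary hTAu
  have hVB := controlled_mem_unitary hTBu
  refine (r.conj ⟨_, hVA⟩ ⟨_, hVB⟩).simulatesWith (norm_catalyst hEA hEB) fun ψ => ?_
  change (((controlled TA ⊗ₖ controlled TB)ᴴ * withAncillas (Fin 2 × Fin 1) (Fin 2 × Fin 1) H' *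
    (controlled TA ⊗ₖ controlled TB)) *ᵥ attach ψ (catalyst EA EB)) = _
  have hV := Matrix.mem_unitaryGroup_iff'.1 (kronecker_mem_unitary hVA hVB)
  rw [Matrix.star_eq_conjTranspose] at hV
  -- At fixed control values the state is a multiple of the embedded Bell state, turned accordingly.
  have hslice : ∀ φ : Fin 2 × Fin 2 → ℂ, ∀ k l : Fin 2 × Fin 1,
      (fun z : a × b => ((controlled TA ⊗ₖ controlled TB) *ᵥ attach φ (catalyst EA EB))
        ((z.1, k), (z.2, l))) =
      φ (k.1, l.1) • ((EA ⊗ₖ EB) *ᵥ ((turnIf k.1 ⊗ₖ turnIf l.1) *ᵥ bellState)) := by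
    intro φ k l
    funext z
    rw [controlled_kronecker_mulVec]
    have e : (fun y : a × b => attach φ (catalyst EA EB) ((y.1, k), (y.2, l))) =
        φ (k.1, l.1) • ((EA ⊗ₖ EB) *ᵥ bellState) := by
      funext y
      simp [attach, catalyst]
    simp only [e]
    rw [Matrix.mulVec_smul, Matrix.mulVec_mulVec, Matrix.mulVec_mulVec, ← Matrix.mul_kronecker_mul,
      ← Matrix.mul_kronecker_mul, hTAE, hTBE]
  have hmain : withAncillas (Fin 2 × Fin 1) (Fin 2 × Fin 1) H' *ᵥ
      ((controlled TA ⊗ₖ controlled TB) *ᵥ attach ψ (catalyst EA EB)) =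
      (controlled TA ⊗ₖ controlled TB) *ᵥ attach
        ((((x ^ 2 + (p ^ 2 + q ^ 2) : ℝ) : ℂ) • isingHamiltonian) *ᵥ ψ) (catalyst EA EB) := by
    funext y
    rw [withAncillas_mulVec, hslice]
    have h5 := congrFun (hslice
      ((((x ^ 2 + (p ^ 2 + q ^ 2) : ℝ) : ℂ) • isingHamiltonian) *ᵥ ψ) y.1.2 y.2.2) (y.1.1, y.2.1)
    refine Eq.trans ?_ h5.symm
    have hE : H' * (EA ⊗ₖ EB) = (EA ⊗ₖ EB) * (((x : ℂ) • pauliZ) ⊗ₖ ((x : ℂ) • pauliZ) +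
        symTraceless p q ⊗ₖ symTraceless p q) := by
      rw [hH', Matrix.add_mul, ← Matrix.mul_kronecker_mul, ← Matrix.mul_kronecker_mul, h1, h2, h3,
        h4, Matrix.mul_kronecker_mul, Matrix.mul_kronecker_mul, Matrix.mul_add]
    rw [Matrix.mulVec_smul, Matrix.mulVec_mulVec, hE, ← Matrix.mulVec_mulVec, bell_eigenvector,
      Matrix.mulVec_smul, smul_smul, ising_mulVec, mul_comm (ψ _)]
  rw [← Matrix.mulVec_mulVec, ← Matrix.mulVec_mulVec, hmain, Matrix.mulVec_mulVec, hV,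
    Matrix.one_mulVec]

end Isometry

/- ### Protocols with several copies of the interacting systems -/

section Generation

variable {a b r s : Type*} [Fintype a] [DecidableEq a] [Fintype b] [DecidableEq b]
  [Fintype r] [DecidableEq r] [Fintype s] [DecidableEq s]

/-- Some protocol of duration `T` generates at least `g` ebits. -/
def Generates (H : Matrix (a × b) (a × b) ℂ) (T g : ℝ) : Prop :=
  ∃ (m n : ℕ) (ψ : (a × Fin m) × (b × Fin n) → ℂ) (P : List (Step a b (Fin m) (Fin n))),
    ‖WithLp.toLp 2 ψ‖ = 1 ∧ duration P = T ∧ entanglement ψ + g ≤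
      entanglement (protocolOperator H P *ᵥ ψ)

theorem lift_mulVec_tensorVec {r' s' u v : Type*} [Fintype r'] [DecidableEq r'] [Fintype s']
    [DecidableEq s'] [Fintype u] [DecidableEq u] [Fintype v] [DecidableEq v]
    (H : Matrix (a × b) (a × b) ℂ) (e : r' ≃ r × u) (f : s' ≃ s × v) (P : List (Step a b r s))
    (ψ : (a × r) × (b × s) → ℂ) (χ : u × v → ℂ) :
    protocolOperator H (P.map (Step.lift e f)) *ᵥ
        tensorVec (splitAncilla a e) (splitAncilla b f) ψ χ =
      tensorVec (splitAncilla a e) (splitAncilla b f) (protocolOperator H P *ᵥ ψ) χ := by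
  funext x
  rw [protocolOperator_lift, ampliate_mulVec]
  have h : ∀ w : (a × r) × (b × s), tensorVec (splitAncilla a e) (splitAncilla b f) ψ χ
      ((splitAncillas a b e f).symm (w, (splitAncillas a b e f x).2)) =
      χ (splitAncillas a b e f x).2 * ψ w := by
    intro w
    simp [tensorVec, splitAncillas, mul_comm]
  simp only [h]
  change (_ *ᵥ (χ (splitAncillas a b e f x).2 • ψ)) _ = _
  rw [Matrix.mulVec_smul, Pi.smul_apply, smul_eq_mul, mul_comm]
  rfl

/-- This moves arbitrary finite ancillas to the form `Fin m`; the factor `Unit` makes the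
relabelling an instance of `Step.lift`. -/
theorem generates_of_protocol {H : Matrix (a × b) (a × b) ℂ} (hH : H.IsHermitian)
    (P : List (Step a b r s)) {ψ : (a × r) × (b × s) → ℂ} (hψ : ‖WithLp.toLp 2 ψ‖ = 1) :
    Generates H (duration P) (entanglement (protocolOperator H P *ᵥ ψ) - entanglement ψ) := by
  set e : Fin (Fintype.card r) ≃ r × Unit :=
    (Fintype.equivFin r).symm.trans (Equiv.prodPUnit r).symm
  set f : Fin (Fintype.card s) ≃ s × Unit :=
    (Fintype.equivFin s).symm.trans (Equiv.prodPUnit s).symm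
  have h1 : ‖WithLp.toLp 2 (fun _ : Unit × Unit => (1 : ℂ))‖ = 1 := by
    simp [EuclideanSpace.norm_eq]
  have hP : ‖WithLp.toLp 2 (protocolOperator H P *ᵥ ψ)‖ = 1 := by
    rw [norm_unitary_mulVec (protocolOperator_mem_unitary hH P), hψ]
  refine ⟨_, _, tensorVec (splitAncilla a e) (splitAncilla b f) ψ fun _ => 1,
    P.map (Step.lift e f), by rw [norm_tensorVec, hψ, h1, one_mul], duration_lift _ _ _, ?_⟩
  rw [lift_mulVec_tensorVec, entanglement_tensorVec _ _ hψ h1, entanglement_tensorVec _ _ hP h1]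
  linarith

theorem GainBound.le_of_generates {H : Matrix (a × b) (a × b) ℂ} {C T g : ℝ} (h : GainBound H C)
    (hg : Generates H T g) : g ≤ C * T := by
  obtain ⟨m, n, ψ, P, hψ, rfl, hP⟩ := hg
  linarith [h m n ψ P hψ]

theorem relabel_mem_unitary {n : Type*} [Fintype n] [DecidableEq n] (σ : n ≃ n) :
    (1 : Matrix n n ℂ).submatrix σ id ∈ Matrix.unitaryGroup n ℂ := by
  rw [Matrix.mem_unitaryGroup_iff, Matrix.star_eq_conjTranspose, Matrix.conjTranspose_submatrix,
    Matrix.conjTranspose_one, ← Matrix.submatrix_mul _ _ σ id σ Function.bijective_id]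
  simp

theorem relabel_kronecker_mulVec {n m : Type*} [Fintype n] [DecidableEq n] [Fintype m]
    [DecidableEq m] (σ : n ≃ n) (τ : m ≃ m) (ψ : n × m → ℂ) :
    ((1 : Matrix n n ℂ).submatrix σ id ⊗ₖ (1 : Matrix m m ℂ).submatrix τ id) *ᵥ ψ =
      fun x => ψ (σ x.1, τ x.2) := by
  have h : (1 : Matrix n n ℂ).submatrix σ id ⊗ₖ (1 : Matrix m m ℂ).submatrix τ id =
      (1 : Matrix (n × m) (n × m) ℂ).submatrix (Equiv.prodCongr σ τ) id := by
    rw [← Matrix.one_kronecker_one]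
    rfl
  funext x
  rw [h]
  simp [Matrix.mulVec, dotProduct, Matrix.one_apply, Prod.map]

/-- Exchange of the interacting system with the copy held in the ancilla. -/
def swapCopy (a r r' : Type*) : a × (r × (a × r')) ≃ a × (r × (a × r')) where
  toFun x := (x.2.2.1, (x.2.1, (x.1, x.2.2.2)))
  invFun x := (x.2.2.1, (x.2.1, (x.1, x.2.2.2)))
  left_inv _ := rfl
  right_inv _ := rfl

/-- Rearrangement of the ancillas for the use of the second copy. -/
def secondCopy (a r r' : Type*) : r × (a × r') ≃ r' × (a × r) where
  toFun x := (x.2.2, (x.2.1, x.1))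
  invFun x := (x.2.2, (x.2.1, x.1))
  left_inv _ := rfl
  right_inv _ := rfl

/-- A second copy of the interacting systems waits in the ancillas and is swapped in after the first
run. The two copies remain in a product state, so the gains add. -/
theorem Generates.add {H : Matrix (a × b) (a × b) ℂ} (hH : H.IsHermitian) {T₁ T₂ g₁ g₂ : ℝ}
    (h₁ : Generates H T₁ g₁) (h₂ : Generates H T₂ g₂) : Generates H (T₁ + T₂) (g₁ + g₂) := by
  obtain ⟨m₁, n₁, ψ₁, P₁, hψ₁, rfl, hg₁⟩ := h₁
  obtain ⟨m₂, n₂, ψ₂, P₂, hψ₂, rfl, hg₂⟩ := h₂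
  set eA := Equiv.refl (Fin m₁ × (a × Fin m₂))
  set eB := Equiv.refl (Fin n₁ × (b × Fin n₂))
  set P : List (Step a b (Fin m₁ × (a × Fin m₂)) (Fin n₁ × (b × Fin n₂))) :=
    P₂.map (Step.lift (secondCopy a (Fin m₁) (Fin m₂)) (secondCopy b (Fin n₁) (Fin n₂))) ++
      ⟨0, ⟨_, relabel_mem_unitary (swapCopy a (Fin m₁) (Fin m₂))⟩,
        ⟨_, relabel_mem_unitary (swapCopy b (Fin n₁) (Fin n₂))⟩⟩ ::
        P₁.map (Step.lift eA eB) with hPdef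
  set ψ := tensorVec (splitAncilla a eA) (splitAncilla b eB) ψ₁ ψ₂ with hψdef
  set φ₁ := protocolOperator H P₁ *ᵥ ψ₁ with hφ₁def
  set φ₂ := protocolOperator H P₂ *ᵥ ψ₂ with hφ₂def
  have hφ₁ : ‖WithLp.toLp 2 φ₁‖ = 1 := by
    rw [hφ₁def, norm_unitary_mulVec (protocolOperator_mem_unitary hH P₁), hψ₁]
  have hφ₂ : ‖WithLp.toLp 2 φ₂‖ = 1 := by
    rw [hφ₂def, norm_unitary_mulVec (protocolOperator_mem_unitary hH P₂), hψ₂]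
  have hψ : ‖WithLp.toLp 2 ψ‖ = 1 := by rw [hψdef, norm_tensorVec, hψ₁, hψ₂, one_mul]
  have hdur : duration P = duration P₁ + duration P₂ := by
    rw [hPdef, duration_append, duration_cons, duration_lift, duration_lift, NNReal.coe_zero,
      zero_add, add_comm]
  have hop : protocolOperator H P *ᵥ ψ =
      tensorVec (splitAncilla a (secondCopy a (Fin m₁) (Fin m₂)))
        (splitAncilla b (secondCopy b (Fin n₁) (Fin n₂))) φ₂ φ₁ := by
    rw [hPdef, protocolOperator_append, protocolOperator_cons, ← Matrix.mulVec_mulVec,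
      ← Matrix.mulVec_mulVec, hψdef, lift_mulVec_tensorVec, Step.operator, NNReal.coe_zero,
      evolution_zero, Matrix.mul_one, relabel_kronecker_mulVec, hφ₂def,
      ← lift_mulVec_tensorVec H (secondCopy a (Fin m₁) (Fin m₂)) (secondCopy b (Fin n₁) (Fin n₂))]
    congr 1
    funext x
    exact mul_comm (_ : ℂ) _
  have h := generates_of_protocol hH P hψ
  rw [hdur, hop, hψdef, entanglement_tensorVec _ _ hφ₂ hφ₁, entanglement_tensorVec _ _ hψ₁ hψ₂] at h
  obtain ⟨m, n, ξ, Q, hξ, hQ, hQg⟩ := h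
  exact ⟨m, n, ξ, Q, hξ, hQ, by linarith⟩

theorem Generates.nsmul {H : Matrix (a × b) (a × b) ℂ} (hH : H.IsHermitian) {T g : ℝ}
    (h : Generates H T g) (n : ℕ) : Generates H ((n + 1 : ℕ) * T) ((n + 1 : ℕ) * g) := by
  induction n with
  | zero => simpa using h
  | succ n ih =>
    have := ih.add hH h
    convert this using 1 <;> push_cast <;> ring

/-- Arbitrarily close to `C` ebits per unit of time can be generated, over any period. -/
def Attains (H : Matrix (a × b) (a × b) ℂ) (C : ℝ) : Prop :=
  ∀ C' < C, ∀ T : ℝ, 0 < T → Generates H T (C' * T)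

/-- The optimal rate equals `C` for every T > 0, so the limit is that of an eventually constant
function. -/
theorem hasEntanglementCapacity_of_gainBound {H : Matrix (a × b) (a × b) ℂ} {C : ℝ}
    (hC : GainBound H C) (hC' : Attains H C) : HasEntanglementCapacity H C := by
  refine tendsto_const_nhds.congr' ?_
  filter_upwards [Filter.eventually_gt_atTop 0] with T hT
  apply le_antisymm
  · refine le_of_forall_lt fun e he => ?_
    obtain ⟨q, hq1, hq2⟩ := EReal.lt_iff_exists_real_btwn.1 he
    obtain ⟨m, n, ψ, P, hψ, hP, hg⟩ := hC' q (EReal.coe_lt_coe_iff.1 hq2) T hT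
    refine hq1.trans_le (le_trans ?_ (le_sSup ⟨m, n, ψ, P, hψ, hP, rfl⟩))
    rw [EReal.coe_le_coe_iff, le_div_iff₀ hT]
    linarith
  · refine sSup_le ?_
    rintro _ ⟨m, n, ψ, P, hψ, hP, rfl⟩
    rw [EReal.coe_le_coe_iff, div_le_iff₀ hT]
    have := hC m n ψ P hψ
    rw [hP] at this
    linarith

end Generation

/- ### Entanglement generation and simulation -/

section Transfer

variable {a b a' b' u v : Type*} [Fintype a] [DecidableEq a] [Fintype b] [DecidableEq b]
  [Fintype a'] [DecidableEq a'] [Fintype b'] [DecidableEq b']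
  [Fintype u] [DecidableEq u] [Fintype v] [DecidableEq v]

/-- The catalyst, and with it the dimension, is the same for all accuracies, so plain continuity of
the entanglement suffices; the strict inequality absorbs the error. -/
theorem SimulatesWith.generates {H : Matrix (a × b) (a × b) ℂ} {K : Matrix (a' × b') (a' × b') ℂ}
    (hH : H.IsHermitian) (hK : K.IsHermitian) {η : (a × u) × (b × v) → ℂ}
    (hη : ‖WithLp.toLp 2 η‖ = 1) (h : SimulatesWith H K η 1) {ψ : a' × b' → ℂ}
    (hψ : ‖WithLp.toLp 2 ψ‖ = 1) {t g : ℝ} (ht : 0 ≤ t)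
    (hg : entanglement ψ + g < entanglement (evolution K t *ᵥ ψ)) : Generates H t g := by
  have hK' : ‖WithLp.toLp 2 (evolution K t *ᵥ ψ)‖ = 1 := by
    rw [norm_unitary_mulVec (evolution_mem_unitary hK t), hψ]
  choose P hPt hP using fun N : ℕ => h t ht (1 / ((N : ℝ) + 1)) (by positivity)
  have hlim : Filter.Tendsto (fun N => protocolOperator H (P N) *ᵥ attach ψ η) Filter.atTop
      (nhds (attach (evolution K t *ᵥ ψ) η)) := by
    refine tendsto_pi_nhds.2 fun x => tendsto_iff_norm_sub_tendsto_zero.2 ?_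
    refine squeeze_zero (fun _ => norm_nonneg _) (fun N => ?_)
      tendsto_one_div_add_atTop_nhds_zero_nat
    exact (PiLp.norm_apply_le (WithLp.toLp 2 (protocolOperator H (P N) *ᵥ attach ψ η -
      attach (evolution K t *ᵥ ψ) η)) x).trans (hP N ψ hψ)
  have hE := (continuous_entanglement.tendsto _).comp hlim
  rw [entanglement_attach hK' hη] at hE
  obtain ⟨N, hN⟩ := (hE.eventually (lt_mem_nhds (show entanglement ψ + g + entanglement η <
    _ by linarith))).exists
  have hψη : ‖WithLp.toLp 2 (attach ψ η)‖ = 1 := by rw [norm_attach, hψ, hη, one_mul]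
  obtain ⟨m, n, ξ, Q, hξ, hQ, hQg⟩ := generates_of_protocol hH (P N) hψη
  rw [entanglement_attach hψ hη] at hQg
  simp only [Function.comp_apply] at hN
  exact ⟨m, n, ξ, Q, hξ, by rw [hQ, hPt, one_mul], by linarith⟩

/-- The register of `ψ` and its idle ancilla in front of the catalyst. -/
def idleRegisterFirst (a a' u k : Type*) : a × ((a' × u) × k) ≃ (a' × k) × (a × u) where
  toFun x := ((x.2.1.1, x.2.2), (x.1, x.2.1.2))
  invFun x := (x.2.1, ((x.1.1, x.2.2), x.1.2))
  left_inv _ := rfl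
  right_inv _ := rfl

/-- Needed for the slices of a state with idle ancillas, which are not normalised. -/
theorem norm_simulation_error_le {U : Matrix ((a × (a' × u)) × (b × (b' × v))) _ ℂ}
    {V : Matrix (a' × b') (a' × b') ℂ} {η : (a × u) × (b × v) → ℂ} {ε : ℝ}
    (h : ∀ ψ : a' × b' → ℂ, ‖WithLp.toLp 2 ψ‖ = 1 →
      ‖WithLp.toLp 2 (U *ᵥ attach ψ η - attach (V *ᵥ ψ) η)‖ ≤ ε) (ψ : a' × b' → ℂ) :
    ‖WithLp.toLp 2 (U *ᵥ attach ψ η - attach (V *ᵥ ψ) η)‖ ≤ ε * ‖WithLp.toLp 2 ψ‖ := by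
  set M := U * attachMatrix a' b' η - attachMatrix a' b' η * V with hM
  have e : ∀ φ, U *ᵥ attach φ η - attach (V *ᵥ φ) η = M *ᵥ φ := by
    intro φ
    rw [hM, Matrix.sub_mulVec, ← Matrix.mulVec_mulVec, ← Matrix.mulVec_mulVec, attachMatrix_mulVec,
      attachMatrix_mulVec]
  simp only [e] at h ⊢
  by_cases h0 : ‖WithLp.toLp 2 ψ‖ = 0
  · have : ψ = 0 := by simpa using h0
    simp [this]
  have hc : ((‖WithLp.toLp 2 ψ‖⁻¹ : ℝ) : ℂ) • M *ᵥ ψ = M *ᵥ (((‖WithLp.toLp 2 ψ‖⁻¹ : ℝ) : ℂ) • ψ) :=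
    (Matrix.mulVec_smul _ _ _).symm
  have hn : ‖WithLp.toLp 2 (((‖WithLp.toLp 2 ψ‖⁻¹ : ℝ) : ℂ) • ψ)‖ = 1 := by
    rw [WithLp.toLp_smul, norm_smul, Complex.norm_real, norm_inv, norm_norm, inv_mul_cancel₀ h0]
  have := h _ hn
  rw [← hc, WithLp.toLp_smul, norm_smul, Complex.norm_real, norm_inv, norm_norm] at this
  have hpos : 0 < ‖WithLp.toLp 2 ψ‖ := lt_of_le_of_ne (norm_nonneg _) (Ne.symm h0)
  rwa [inv_mul_le_iff₀ hpos, mul_comm] at this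

/-- Each evolution under `K` for a time t, idle ancillas included, is approximated using `H` for at
most t/γ, and the catalyst comes back. So it gains at most D t/γ, by continuity of the entanglement.
-/
theorem GainBound.of_simulatesAtRate {H : Matrix (a × b) (a × b) ℂ}
    {K : Matrix (a' × b') (a' × b') ℂ} (hH : H.IsHermitian) (hK : K.IsHermitian) {D γ : ℝ}
    (hγ : 0 < γ) (hD : 0 ≤ D) (hHD : GainBound H D) (h : SimulatesAtRate H K γ) :
    GainBound K (D / γ) := by
  obtain ⟨m, n, η, hη, h⟩ := h
  intro k l ψ Q hψ
  refine entanglement_protocol_le hK (fun φ hφ t ht => ?_) Q hψ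
  choose P hPt hP using fun N : ℕ => h t ht (1 / ((N : ℝ) + 1)) (by positivity)
  set eA := idleRegisterFirst a a' (Fin m) (Fin k)
  set eB := idleRegisterFirst b b' (Fin n) (Fin l)
  set P' := fun N => (P N).map (Step.lift (Equiv.refl ((a' × Fin m) × Fin k))
    (Equiv.refl ((b' × Fin n) × Fin l))) with hP'
  set V := evolution (withAncillas (Fin k) (Fin l) K) t with hV
  have hVφ : ‖WithLp.toLp 2 (V *ᵥ φ)‖ = 1 := by
    rw [hV, norm_unitary_mulVec (evolution_mem_unitary (withAncillas_isHermitian hK) t), hφ]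
  have hφη : ‖WithLp.toLp 2 (tensorVec eA eB φ η)‖ = 1 := by rw [norm_tensorVec, hφ, hη, one_mul]
  have hlim : Filter.Tendsto (fun N => protocolOperator H (P' N) *ᵥ tensorVec eA eB φ η)
      Filter.atTop (nhds (tensorVec eA eB (V *ᵥ φ) η)) := by
    refine tendsto_pi_nhds.2 fun x => tendsto_iff_norm_sub_tendsto_zero.2 ?_
    -- Idle ancillas are handled entrywise: at fixed values of them the simulation acts on a slice
    -- of `φ`.
    set φ' : a' × b' → ℂ := fun z => φ ((z.1, x.1.2.2), (z.2, x.2.2.2)) with hφ'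
    set z : (a × (a' × Fin m)) × (b × (b' × Fin n)) := ((x.1.1, x.1.2.1), (x.2.1, x.2.2.1))
    have e1 : ∀ N, (protocolOperator H (P' N) *ᵥ tensorVec eA eB φ η) x =
        (protocolOperator H (P N) *ᵥ attach φ' η) z := by
      intro N
      rw [hP', protocolOperator_lift, ampliate_mulVec]
      rfl
    have e2 : tensorVec eA eB (V *ᵥ φ) η x = attach (evolution K t *ᵥ φ') η z := by
      rw [tensorVec, hV, withAncillas_eq_ampliate, evolution_ampliate, ampliate_mulVec]
      rfl
    simp only [e1, e2]
    refine squeeze_zero (fun _ => norm_nonneg _) (fun N => ?_)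
      (by simpa only [zero_mul] using
        (tendsto_one_div_add_atTop_nhds_zero_nat (𝕜 := ℝ)).mul_const ‖WithLp.toLp 2 φ'‖)
    exact (PiLp.norm_apply_le (WithLp.toLp 2 (protocolOperator H (P N) *ᵥ attach φ' η -
      attach (evolution K t *ᵥ φ') η)) z).trans (norm_simulation_error_le (hP N) φ')
  have hE := (continuous_entanglement.tendsto _).comp hlim
  rw [entanglement_tensorVec _ _ hVφ hη] at hE
  have hle : ∀ N, entanglement (protocolOperator H (P' N) *ᵥ tensorVec eA eB φ η) ≤
      entanglement φ + entanglement η + D / γ * t := by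
    intro N
    have h1 := hHD.le_of_generates (generates_of_protocol hH (P' N) hφη)
    rw [entanglement_tensorVec _ _ hφ hη, hP', duration_lift] at h1
    have h2 : D * duration (P N) ≤ D / γ * t := by
      rw [div_mul_eq_mul_div, le_div_iff₀ hγ]
      nlinarith [mul_le_mul_of_nonneg_left (hPt N) hD]
    linarith
  have := le_of_tendsto' hE hle
  linarith

/-- A rate γ > 1 would bound the gain of `K` by C/γ < C, against `Attains`. -/
theorem optimalRate_eq_one {H : Matrix (a × b) (a × b) ℂ} {K : Matrix (a' × b') (a' × b') ℂ}
    (hH : H.IsHermitian) (hK : K.IsHermitian) {C : ℝ} (hC : 0 < C) (hHC : GainBound H C)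
    (hKC : Attains K C) (h : SimulatesAtRate H K 1) : optimalRate K H = 1 := by
  apply le_antisymm
  · refine iSup₂_le fun γ hγ => ?_
    by_contra! hlt
    rw [← ENNReal.coe_one, ENNReal.coe_lt_coe] at hlt
    have hlt' : (1 : ℝ) < γ := by exact_mod_cast hlt
    have hK' := hHC.of_simulatesAtRate hH hK (by linarith) hC.le hγ
    have hlt2 : C / γ < C := div_lt_self hC hlt'
    obtain ⟨C', h1, h2⟩ := exists_between hlt2
    have := hK'.le_of_generates (hKC C' h2 1 one_pos)
    linarith
  · refine le_iSup₂_of_le (1 : ℝ≥0) ?_ ?_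
    · simpa using h
    · simp

end Transfer

/- ### Entanglement generated by the Ising interaction -/

section IsingGain

/-- The orbit of a product state under the Ising interaction. -/
def isingOrbit (θ : ℝ) : Fin 2 × Fin 2 → ℂ := evolution isingHamiltonian θ *ᵥ fun _ => 1 / 2

theorem norm_isingOrbit (θ : ℝ) : ‖WithLp.toLp 2 (isingOrbit θ)‖ = 1 := by
  rw [isingOrbit, norm_unitary_mulVec (evolution_mem_unitary isingHamiltonian_isHermitian θ),
    EuclideanSpace.norm_eq, Real.sqrt_eq_one]
  simp
  norm_num

theorem evolution_isingOrbit (c t θ : ℝ) :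
    evolution ((c : ℂ) • isingHamiltonian) t *ᵥ isingOrbit θ = isingOrbit (θ + c * t) := by
  rw [isingOrbit, Matrix.mulVec_mulVec, evolution_smul, ← evolution_add_time, add_comm]
  rfl

theorem isingOrbit_apply (θ : ℝ) (i j : Fin 2) :
    isingOrbit θ (i, j) = Complex.exp (-(Complex.I * θ) * (pauliZ i i * pauliZ j j)) / 2 := by
  have hd : isingHamiltonian = Matrix.diagonal fun z => pauliZ z.1 z.1 * pauliZ z.2 z.2 := by
    ext ⟨x1, x2⟩ ⟨y1, y2⟩
    fin_cases x1 <;> fin_cases x2 <;> fin_cases y1 <;> fin_cases y2 <;>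
      simp [isingHamiltonian, pauliZ, Matrix.diagonal]
  rw [isingOrbit, evolution, hd, ← Matrix.diagonal_smul, Matrix.exp_diagonal,
    Matrix.mulVec_diagonal, Pi.coe_exp, ← Complex.exp_eq_exp_ℂ]
  simp [div_eq_mul_inv]

theorem reducedState_isingOrbit (θ : ℝ) :
    reducedState (isingOrbit θ) =
      !![1 / 2, (Real.cos (2 * θ) : ℂ) / 2; (Real.cos (2 * θ) : ℂ) / 2, 1 / 2] := by
  have h1 : Complex.exp (Complex.I * θ) * Complex.exp (-(Complex.I * θ)) = 1 := by
    rw [← Complex.exp_add]; simp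
  have h2 : (Real.cos (2 * θ) : ℂ) = (Complex.exp (Complex.I * θ) * Complex.exp (Complex.I * θ) +
      Complex.exp (-(Complex.I * θ)) * Complex.exp (-(Complex.I * θ))) / 2 := by
    rw [← Complex.exp_add, ← Complex.exp_add, Complex.ofReal_cos, Complex.cos]
    congr 3 <;> push_cast <;> ring
  have h3 : ∀ z : ℂ, (starRingEnd ℂ) (Complex.exp z) = Complex.exp ((starRingEnd ℂ) z) :=
    fun z => (Complex.exp_conj z).symm
  rw [h2]
  ext i j
  fin_cases i <;> fin_cases j <;>
  simp [reducedState, coeffMatrix, Matrix.mul_apply, Fin.sum_univ_two, isingOrbit_apply, pauliZ,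
    h3] <;> first | linear_combination (1 / 2) * h1 | ring

theorem entanglement_isingOrbit (θ : ℝ) :
    entanglement (isingOrbit θ) =
      (Real.negMulLog (Real.cos θ ^ 2) + Real.negMulLog (Real.sin θ ^ 2)) / Real.log 2 := by
  have h : (reducedState (isingOrbit θ)).charpoly.roots =
      Finset.univ.val.map fun i : Fin 2 => ((![Real.cos θ ^ 2, Real.sin θ ^ 2] i : ℝ) : ℂ) := by
    have hp : (reducedState (isingOrbit θ)).charpoly =
        ∏ i : Fin 2, (Polynomial.X -
          Polynomial.C ((![Real.cos θ ^ 2, Real.sin θ ^ 2] i : ℝ) : ℂ)) := by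
      have hs : (Real.sin θ : ℂ) ^ 2 + (Real.cos θ : ℂ) ^ 2 = 1 := by
        exact_mod_cast Real.sin_sq_add_cos_sq θ
      have ht : (1 / 2 + 1 / 2 : ℂ) = (Real.cos θ : ℂ) ^ 2 + (Real.sin θ : ℂ) ^ 2 := by
        linear_combination -hs
      have hdet : (1 / 2 * (1 / 2) - (Real.cos (2 * θ) : ℂ) / 2 * ((Real.cos (2 * θ) : ℂ) / 2)) =
          (Real.cos θ : ℂ) ^ 2 * (Real.sin θ : ℂ) ^ 2 := by
        rw [Real.cos_two_mul]
        push_cast at hs ⊢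
        linear_combination (-(Complex.cos θ) ^ 2) * hs
      rw [Matrix.charpoly_fin_two, reducedState_isingOrbit, Matrix.trace_fin_two_of,
        Matrix.det_fin_two_of, ht, hdet, Fin.prod_univ_two]
      simp only [Matrix.cons_val_zero, Matrix.cons_val_one, Complex.ofReal_pow, map_add, map_mul]
      ring
    rw [hp, Polynomial.roots_prod]
    · simp
    · exact Finset.prod_ne_zero_iff.2 fun i _ => Polynomial.X_sub_C_ne_zero _
  rw [entanglement_eq_schmidtSum, schmidtSum, sum_eigenvalues_eq_of_roots _ _ h, Fin.sum_univ_two]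
  rfl

/-- The Schmidt weights are cos² θ and sin² θ; with x = cos² θ and θ in the first quadrant the slope
is twice the function maximised in α. -/
theorem hasDerivAt_entanglement_isingOrbit {θ : ℝ} (hs : Real.sin θ ≠ 0) (hc : Real.cos θ ≠ 0) :
    HasDerivAt (fun τ => entanglement (isingOrbit τ))
      (2 * (Real.cos θ * Real.sin θ) * Real.logb 2 (Real.cos θ ^ 2 / Real.sin θ ^ 2)) θ := by
  have h1 := (Real.hasDerivAt_negMulLog (pow_ne_zero 2 hc)).comp θ ((Real.hasDerivAt_cos θ).pow 2)
  have h2 := (Real.hasDerivAt_negMulLog (pow_ne_zero 2 hs)).comp θ ((Real.hasDerivAt_sin θ).pow 2)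
  have h3 := (h1.add h2).div_const (Real.log 2)
  have e : (fun τ => entanglement (isingOrbit τ)) = fun τ =>
      (Real.negMulLog (Real.cos τ ^ 2) + Real.negMulLog (Real.sin τ ^ 2)) / Real.log 2 :=
    funext entanglement_isingOrbit
  rw [e]
  refine h3.congr_deriv ?_
  rw [Real.logb, Real.log_div (pow_ne_zero 2 hc) (pow_ne_zero 2 hs)]
  push_cast
  ring

theorem exists_lt_alpha_function {C : ℝ} (hC : C < alphaConst) :
    ∃ x ∈ Set.Ioo (0 : ℝ) 1, C < 2 * (√(x * (1 - x)) * Real.logb 2 (x / (1 - x))) := by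
  -- Comparing with `max C 0` excludes the endpoints, where the function is 0 and the slope formula
  -- does not apply.
  have hm : max C 0 / 2 < alphaConst / 2 := by
    have := max_lt hC alphaConst_pos
    linarith
  rw [alphaConst, mul_div_cancel_left₀ _ two_ne_zero] at hm
  obtain ⟨_, ⟨x, hx, rfl⟩, hlt⟩ := exists_lt_of_lt_csSup
    ((Set.nonempty_Icc.2 zero_le_one).image _) hm
  have h0 : (0 : ℝ) ≤ max C 0 := le_max_right _ _
  have hC0 : C ≤ max C 0 := le_max_left _ _
  refine ⟨x, ⟨lt_of_le_of_ne hx.1 ?_, lt_of_le_of_ne hx.2 ?_⟩, by linarith⟩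
  · rintro rfl
    simp at hlt
    linarith
  · rintro rfl
    simp at hlt
    linarith

theorem exists_ising_gain {c C : ℝ} (hc : 0 ≤ c) (hC : C < alphaConst * c) :
    ∃ ψ : Fin 2 × Fin 2 → ℂ, ‖WithLp.toLp 2 ψ‖ = 1 ∧
      ∀ᶠ t in nhdsWithin (0 : ℝ) (Set.Ioi 0), entanglement ψ + C * t <
        entanglement (evolution ((c : ℂ) • isingHamiltonian) t *ᵥ ψ) := by
  obtain ⟨x, hx, hxC⟩ : ∃ x ∈ Set.Ioo (0 : ℝ) 1,
      C < 2 * (√(x * (1 - x)) * Real.logb 2 (x / (1 - x))) * c := by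
    rcases hc.eq_or_lt with rfl | hc
    -- For c = 0 the bound `C` is negative and any interior point would do.
    · exact ⟨1 / 2, by constructor <;> norm_num, by simpa using hC⟩
    · obtain ⟨x, hx, h⟩ := exists_lt_alpha_function ((div_lt_iff₀ hc).2 hC)
      exact ⟨x, hx, (div_lt_iff₀ hc).1 h⟩
  have h1 : 0 < 1 - x := by linarith [hx.2]
  set θ := Real.arccos √x with hθ
  have hcos : Real.cos θ = √x := Real.cos_arccos (by linarith [Real.sqrt_nonneg x])
    (Real.sqrt_le_one.2 hx.2.le)
  have hsin : Real.sin θ = √(1 - x) := by rw [hθ, Real.sin_arccos, Real.sq_sqrt hx.1.le]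
  have hd := hasDerivAt_entanglement_isingOrbit (θ := θ)
    (by rw [hsin]; exact (Real.sqrt_pos.2 h1).ne') (by rw [hcos]; exact (Real.sqrt_pos.2 hx.1).ne')
  rw [hcos, hsin, Real.sq_sqrt hx.1.le, Real.sq_sqrt h1.le, ← Real.sqrt_mul hx.1.le,
    mul_assoc] at hd
  have hd' : HasDerivAt (fun t : ℝ => entanglement (isingOrbit (θ + c * t)))
      (2 * (√(x * (1 - x)) * Real.logb 2 (x / (1 - x))) * c) 0 := by
    have hl : HasDerivAt (fun t : ℝ => θ + c * t) c 0 := by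
      simpa using ((hasDerivAt_id (0 : ℝ)).const_mul c).const_add θ
    exact HasDerivAt.comp (0 : ℝ) (by simpa using hd) hl
  refine ⟨isingOrbit θ, norm_isingOrbit θ, ?_⟩
  have hslope := (hasDerivAt_iff_tendsto_slope.1 hd').mono_left
    (nhdsWithin_mono 0 fun t (ht : 0 < t) => ht.ne')
  filter_upwards [hslope.eventually (lt_mem_nhds hxC), self_mem_nhdsWithin] with t ht ht0
  have ht0 : 0 < t := ht0
  rw [slope_def_field, sub_zero, mul_zero, add_zero, lt_div_iff₀ ht0] at ht
  rw [evolution_isingOrbit]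
  linarith

/-- The best slope is available only for a short time from the optimal state, so the time T is cut
into N + 1 equal pieces, each spent on a fresh copy of that state. -/
theorem SimulatesWith.attains {a b u v : Type*} [Fintype a] [DecidableEq a] [Fintype b]
    [DecidableEq b] [Fintype u] [DecidableEq u] [Fintype v] [DecidableEq v]
    {H : Matrix (a × b) (a × b) ℂ} (hH : H.IsHermitian) {c : ℝ} (hc : 0 ≤ c)
    {η : (a × u) × (b × v) → ℂ} (hη : ‖WithLp.toLp 2 η‖ = 1)
    (h : SimulatesWith H ((c : ℂ) • isingHamiltonian) η 1) : Attains H (alphaConst * c) := by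
  intro C hC T hT
  obtain ⟨ψ, hψ, hgain⟩ := exists_ising_gain hc hC
  have hlim : Filter.Tendsto (fun N : ℕ => T / ((N + 1 : ℕ) : ℝ)) Filter.atTop
      (nhdsWithin 0 (Set.Ioi 0)) := by
    refine tendsto_nhdsWithin_iff.2 ⟨?_, Filter.Eventually.of_forall fun N => ?_⟩
    · exact (tendsto_const_div_atTop_nhds_zero_nat T).comp (Filter.tendsto_add_atTop_nat 1)
    · exact div_pos hT (by positivity)
  obtain ⟨N, hN⟩ := (hlim.eventually hgain).exists
  have hg := (h.generates hH (isHermitian_ofReal_smul isingHamiltonian_isHermitian c) hη hψ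
    (by positivity) hN).nsmul hH N
  have hN0 : ((N + 1 : ℕ) : ℝ) ≠ 0 := by positivity
  rwa [mul_div_cancel₀ _ hN0, mul_left_comm, mul_div_cancel₀ _ hN0] at hg

end IsingGain

/- ### The equivalence class of the interaction -/

section Main

variable {a b : Type*} [Fintype a] [DecidableEq a] [Fintype b] [DecidableEq b]

open scoped Matrix.Norms.L2Operator

theorem norm_pauliZ_le : ‖pauliZ‖ ≤ 1 :=
  norm_le_one_of_mem_unitary (Matrix.mem_unitaryGroup_iff.2 (by
    rw [Matrix.star_eq_conjTranspose, pauliZ_isHermitian.eq, pauliZ_mul_self]))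

/-- With G = 0 the Ising interaction has the same two-term form as `H`, so the general bound and
simulation apply to it as well. -/
theorem smul_ising_eq {c : ℝ} (hc : 0 ≤ c) : (c : ℂ) • isingHamiltonian =
    ((√c : ℂ) • pauliZ) ⊗ₖ ((√c : ℂ) • pauliZ) + (0 : Matrix (Fin 2) (Fin 2) ℂ) ⊗ₖ 0 := by
  rw [Matrix.smul_kronecker, Matrix.kronecker_smul, smul_smul, ← Complex.ofReal_mul,
    Real.mul_self_sqrt hc, Matrix.zero_kronecker, add_zero, isingHamiltonian]

theorem gainBound_ising {c : ℝ} (hc : 0 ≤ c) :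
    GainBound ((c : ℂ) • isingHamiltonian) (alphaConst * c) := by
  have hZ : ((√c : ℂ) • pauliZ).IsHermitian := isHermitian_ofReal_smul pauliZ_isHermitian _
  have hn : ‖(√c : ℂ) • pauliZ - ((0 : ℝ) : ℂ) • 1‖ ≤ √c := by
    rw [Complex.ofReal_zero, zero_smul, sub_zero, norm_smul, Complex.norm_real,
      Real.norm_of_nonneg (Real.sqrt_nonneg c)]
    exact mul_le_of_le_one_right (Real.sqrt_nonneg c) norm_pauliZ_le
  have h0 : ‖(0 : Matrix (Fin 2) (Fin 2) ℂ) - ((0 : ℝ) : ℂ) • 1‖ ≤ 0 := by simp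
  have h := gainBound_of_norm_le hZ Matrix.isHermitian_zero hZ Matrix.isHermitian_zero hn hn h0 h0
  rwa [← smul_ising_eq hc, Real.mul_self_sqrt hc, mul_zero, add_zero] at h

theorem attains_ising {c : ℝ} (hc : 0 ≤ c) :
    Attains ((c : ℂ) • isingHamiltonian) (alphaConst * c) := by
  have hZ : ((√c : ℂ) • pauliZ).IsHermitian := isHermitian_ofReal_smul pauliZ_isHermitian _
  have h1 : (1 : Matrix (Fin 2) (Fin 2) ℂ)ᴴ * 1 = 1 := by simp
  have hz : ((√c : ℂ) • pauliZ - ((0 : ℝ) : ℂ) • 1) * 1 = 1 * ((√c : ℂ) • pauliZ) := by simp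
  have h0 : ((0 : Matrix (Fin 2) (Fin 2) ℂ) - ((0 : ℝ) : ℂ) • 1) * 1 = 1 * symTraceless 0 0 := by
    ext i j
    fin_cases i <;> fin_cases j <;> simp [symTraceless]
  have h := simulatesWith_ising hZ Matrix.isHermitian_zero hZ Matrix.isHermitian_zero h1 h1 hz hz
    h0 h0
  rw [← smul_ising_eq hc, Real.sq_sqrt hc, zero_pow two_ne_zero, add_zero, add_zero] at h
  exact h.attains (isHermitian_ofReal_smul isingHamiltonian_isHermitian c) hc (norm_catalyst h1 h1)

theorem eq_smul_one_of_spread_eq_zero {M : Matrix a a ℂ} (hM : M.IsHermitian)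
    (h : spread M = 0) : M = (midpointEigenvalue M : ℂ) • 1 := by
  have := norm_sub_midpoint_le hM
  rw [h, zero_div] at this
  exact sub_eq_zero.1 (norm_le_zero_iff.1 this)

theorem spread_nonneg {M : Matrix a a ℂ} (hM : M.IsHermitian) : 0 ≤ spread M := by
  have := (norm_nonneg _).trans (norm_sub_midpoint_le hM)
  linarith

end Main

end BipartiteSimulation

end

open BipartiteSimulation in
theorem mainTheorem7 {a b : Type*} [Fintype a] [DecidableEq a] [Fintype b] [DecidableEq b]
    (JA GA : Matrix a a ℂ) (JB GB : Matrix b b ℂ)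
    (hJA : JA.IsHermitian) (hGA : GA.IsHermitian) (hJB : JB.IsHermitian) (hGB : GB.IsHermitian)
    (ΔJ ΔG : ℝ)
    (hΔJA : spread JA = ΔJ) (hΔJB : spread JB = ΔJ)
    (hΔGA : spread GA = ΔG) (hΔGB : spread GB = ΔG)
    (hA : extremalSpace JA = extremalSpace GA) (hA2 : Module.finrank ℂ (extremalSpace JA) = 2)
    (hB : extremalSpace JB = extremalSpace GB) (hB2 : Module.finrank ℂ (extremalSpace JB) = 2)
    (htr : LinearMap.trace ℂ (EuclideanSpace ℂ a) (extremalPart JA ∘ₗ extremalPart GA) =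
      LinearMap.trace ℂ (EuclideanSpace ℂ b) (extremalPart JB ∘ₗ extremalPart GB)) :
    LocallyEquivalent (JA ⊗ₖ JB + GA ⊗ₖ GB)
        ((((ΔJ ^ 2 + ΔG ^ 2) / 4 : ℝ) : ℂ) • isingHamiltonian) ∧
      HasEntanglementCapacity (JA ⊗ₖ JB + GA ⊗ₖ GB)
        (alphaConst / 4 * (ΔJ ^ 2 + ΔG ^ 2)) := by
  have hx := norm_sub_midpoint_le hJA
  have hy := norm_sub_midpoint_le hJB
  have hz := norm_sub_midpoint_le hGA
  have hw := norm_sub_midpoint_le hGB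
  have hJ0 := spread_nonneg hJA
  have hG0 := spread_nonneg hGA
  rw [hΔJA] at hx hJ0
  rw [hΔJB] at hy
  rw [hΔGA] at hz hG0
  rw [hΔGB] at hw
  set c := (ΔJ ^ 2 + ΔG ^ 2) / 4 with hc
  have hc0 : 0 ≤ c := by positivity
  have hH : (JA ⊗ₖ JB + GA ⊗ₖ GB).IsHermitian :=
    (isHermitian_kronecker hJA hJB).add (isHermitian_kronecker hGA hGB)
  have hK : ((c : ℂ) • isingHamiltonian).IsHermitian :=
    isHermitian_ofReal_smul isingHamiltonian_isHermitian c
  obtain ⟨EA, pA, qA, hEA, hJEA, hGEA, hqA, hnA, hpA, htA⟩ := exists_canonical_frame hJA hGA hA hA2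
  obtain ⟨EB, pB, qB, hEB, hJEB, hGEB, hqB, hnB, hpB, htB⟩ := exists_canonical_frame hJB hGB hB hB2
  rw [hΔJA] at hJEA hpA htA
  rw [hΔGA] at hnA hpA
  rw [hΔJB] at hJEB hpB htB
  rw [hΔGB] at hnB hpB
  -- The trace condition reads Δ_J p_A = Δ_J p_B. It is void for Δ_J = 0, where both frames were
  -- chosen with p = Δ_G/2.
  have hp : pB = pA := by
    by_cases h0 : ΔJ = 0
    · rw [hpA h0, hpB h0]
    · rw [htA, htB, Complex.ofReal_inj] at htr
      exact (mul_left_cancel₀ h0 htr).symm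
  subst hp
  have hq : qB = qA := by
    rw [← sq_eq_sq₀ hqB hqA]
    linarith
  subst hq
  have hsim := simulatesWith_ising hJA hGA hJB hGB hEA hEB hJEA hJEB hGEA hGEB
  rw [hnA, show (ΔJ / 2) ^ 2 + (ΔG / 2) ^ 2 = c by rw [hc]; ring] at hsim
  have hη := norm_catalyst hEA hEB
  have hgain := gainBound_of_norm_le hJA hGA hJB hGB hx hy hz hw
  rw [show ΔJ / 2 * (ΔJ / 2) + ΔG / 2 * (ΔG / 2) = c by rw [hc]; ring] at hgain
  have hattain := hsim.attains hH hc0 hη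
  have hHK := hsim.simulatesAtRate_one hη le_rfl
  have hKH : SimulatesAtRate ((c : ℂ) • isingHamiltonian) (JA ⊗ₖ JB + GA ⊗ₖ GB) 1 := by
    -- For c = 0 both spreads vanish and no interaction time is needed; otherwise the two product
    -- terms take the shares Δ_J²/(4c) and Δ_G²/(4c) of the time, which add up to 1.
    rcases hc0.eq_or_lt with h0 | h0
    · have hJz : ΔJ = 0 := by nlinarith [sq_nonneg ΔG]
      have hGz : ΔG = 0 := by nlinarith [sq_nonneg ΔJ]
      exact (ising_simulatesWith (c := c) (wJ := 0) (wG := 0) hJA hGA hJB hGB hx hy hz hw le_rfl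
        le_rfl (by simp [hJz]) (by simp [hGz])).simulatesAtRate_one norm_zeroZero (by simp)
    · refine (ising_simulatesWith (c := c) (wJ := ΔJ ^ 2 / 4 / c) (wG := ΔG ^ 2 / 4 / c) hJA hGA
        hJB hGB hx hy hz hw (by positivity) (by positivity) ?_ ?_).simulatesAtRate_one
        norm_zeroZero ?_
      · rw [div_mul_cancel₀ _ h0.ne']; ring
      · rw [div_mul_cancel₀ _ h0.ne']; ring
      · rw [← add_div, ← add_div, ← hc, div_self h0.ne']
  refine ⟨⟨hHK, hKH, fun hloc => ?_⟩, ?_⟩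
  · have hcpos : 0 < c := by
      -- If c = 0, Alice's factors are scalars and `H` would be local.
      refine lt_of_le_of_ne hc0 fun h0 => hloc ?_
      have hJz : ΔJ = 0 := by nlinarith [sq_nonneg ΔG]
      have hGz : ΔG = 0 := by nlinarith [sq_nonneg ΔJ]
      rw [eq_smul_one_of_spread_eq_zero hJA (hΔJA.trans hJz),
        eq_smul_one_of_spread_eq_zero hGA (hΔGA.trans hGz)]
      exact ⟨0, (midpointEigenvalue JA : ℂ) • JB + (midpointEigenvalue GA : ℂ) • GB, by
        rw [Matrix.zero_kronecker, zero_add, Matrix.kronecker_add, Matrix.smul_kronecker,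
          Matrix.smul_kronecker, Matrix.kronecker_smul, Matrix.kronecker_smul]⟩
    have hα : 0 < alphaConst * c := mul_pos alphaConst_pos hcpos
    exact ⟨optimalRate_eq_one hH hK hα hgain (attains_ising hc0) hHK,
      optimalRate_eq_one hK hH hα (gainBound_ising hc0) hattain hKH⟩
  · have h := hasEntanglementCapacity_of_gainBound hgain hattain
    rwa [show alphaConst * c = alphaConst / 4 * (ΔJ ^ 2 + ΔG ^ 2) by rw [hc]; ring] at h
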